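/- Let $q,r\in\mathcal S(\mathbb R)$ be complex-valued Schwartz functions and consider the linear system $$\frac{d}{dx}\begin{bmatrix}\alpha\\ \beta\end{bmatrix}=\begin{bmatrix}-i\zeta^2-\frac i2 q(x)r(x)&\zeta q(x)\\ \zeta r(x)&i\zeta^2+\frac i2 q(x)r(x)\end{bmatrix}\begin{bmatrix}\alpha\\ \beta\end{bmatrix},\qquad x\in\mathbb R. \qquad(1)$$ Put $\lambda=\zeta^2$, $\zeta=\sqrt\lambda$ (principal root). Overbars do not denote complex conjugation. The Jost solutions of (1) are the solutions $\psi,\phi$ (for $\operatorname{Im}\lambda\ge0$) and $\bar\psi,\bar\phi$ (for $\operatorname{Im}\lambda\le0$) with $\psi=(o(1),\,e^{i\lambda x}[1+o(1)])$ and $\bar\psi=(e^{-i\lambda x}[1+o(1)],\,o(1))$ as $x\to+\infty$, and $\phi=(e^{-i\lambda x}[1+o(1)],\,o(1))$ and $\bar\phi=(o(1),\,e^{i\lambda x}[1+o(1)])$ as $x\to-\infty$. With the ($x$-independent) Wronskian $[f;g]=f_1g_2-g_1f_2$ let $$T=\frac1{[\phi;\psi]},\quad \bar T=\frac1{[\bar\psi;\bar\phi]},\quad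 R=\frac{[\phi;\bar\psi]}{[\psi;\phi]},\quad \bar R=\frac{[\bar\phi;\psi]}{[\bar\psi;\bar\phi]},$$ and assume that $T$ and $\bar T$ have no singularities on the real $\lambda$-axis, i.e. $[\phi;\psi]\ne0$ and $[\bar\psi;\bar\phi]\neq0$ for $\lambda\in\mathbb R$. Let $$\hat R(y)=\frac1{2\pi}\int_{-\infty}^\infty \frac{R(\zeta)}{\zeta}e^{i\lambda y}\,d\lambda,\qquad \hat{\bar R}(y)=\frac1{2\pi}\int_{-\infty}^\infty \frac{\bar R(\zeta)}{\zeta}e^{-i\lambda y}\,d\lambda .$$ Let $\lambda_1,\dots,\lambda_N$ be the distinct poles of $T$, as a function of $\lambda$, in the open upper half plane, with multiplicities $m_j$. Let the dependency constants $\gamma_{jk}$, $0\le k<m_j$, be such that, with $\gamma_j(\lambda)=\sum_{k<m_j}\gamma_{jk}(\lambda-\lambda_j)^k/k!$, one has $\phi=\gamma_j(\lambda)\psi+O((\lambda-\lambda_j)^{m_j})$ as $\lambda\to\lambda_j$ for every $x$, and let the normalization constants $c_{jk}$ be such that $T\gamma_j/\zeta-\sum_{k<m_j} i\,c_{jk}(\lambda-\lambda_j)^{-(k+1)}$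 is bounded near $\lambda_j$. Let $A$ be the block diagonal matrix with the upper triangular $m_j\times m_j$ Jordan blocks with eigenvalue $\lambda_j$, $B$ the column with blocks $(0,\dots,0,1)^T$, and $C$ the row with blocks $(c_{j(m_j-1)},\dots,c_{j0})$. Define $(\bar A,\bar B,\bar C)$ in the same way from the poles of $\bar T$ in the open lower half plane, with $\bar\phi,\bar\psi$ in place of $\phi,\psi$ and $-i\,\bar c_{jk}$ in place of $i\,c_{jk}$. Put $$\Omega(y)=\hat R(y)+Ce^{iAy}B,\qquad \bar\Omega(y)=\hat{\bar R}(y)+\bar Ce^{-i\bar Ay}\bar B .$$ Let $\mathcal K(x,y)=\begin{bmatrix}\bar K_1(x,y)&K_1(x,y)\\ \bar K_2(x,y)&K_2(x,y)\end{bmatrix}$ be the solution, with entries square integrable in $y\in(x,\infty)$ for each $x\in\mathbb R$, of the Marchenko system $$\begin{bmatrix}0&0\\0&0\end{bmatrix}=\mathcal K(x,y)+\begin{bmatrix}0&\bar\Omega(x+y)\\ \Omega(x+y)&0\end{bmatrix}+\int_x^\infty dz\begin{bmatrix}-iK_1(x,z)\Omega'(z+y)&\bar K_1(x,z)\bar\Omega(z+y)\\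 K_2(x,z)\Omega(z+y)&i\bar K_2(x,z)\bar\Omega'(z+y)\end{bmatrix},\qquad x<y.$$ Then for every $x\in\mathbb R$ the four limits $K_j(x,x):=\lim_{y\to x^+}K_j(x,y)$, $\bar K_j(x,x):=\lim_{y\to x^+}\bar K_j(x,y)$, $j=1,2$, exist, and $$K_1(x,x)=-\frac{q(x)}2,\qquad \bar K_2(x,x)=-\frac{r(x)}2,$$ $$K_2(x,x)=-\frac{i\,q(x)r(x)}4-\frac i4\int_x^\infty q(y)r'(y)\,dy-\frac18\int_x^\infty q(y)^2r(y)^2\,dy,$$ $$\bar K_1(x,x)=-\frac i4\int_x^\infty q(y)r'(y)\,dy-\frac18\int_x^\infty q(y)^2r(y)^2\,dy .$$ -/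

import Mathlib

open Filter Topology MeasureTheory Asymptotics
open scoped SchwartzMap

noncomputable section

namespace GIScattering

/-! The linear system with energy-dependent potentials
`(α, β)' = X(ζ, x) (α, β)` on the line, its Jost solutions, scattering coefficients and bound-state
data, and the associated Marchenko system.  The suffix `Bar` stands for the customary overbar, which
never means complex conjugation. -/

/-- The coefficient matrix of the linear system with potentials `q`, `r` at spectral value `ζ`. -/
def coeffMatrix (q r : ℝ → ℂ) (ζ : ℂ) (x : ℝ) : Matrix (Fin 2) (Fin 2) ℂ :=
  !![-Complex.I * ζ ^ 2 - Complex.I / 2 * (q x * r x), ζ * q x;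
     ζ * r x, Complex.I * ζ ^ 2 + Complex.I / 2 * (q x * r x)]

/-- `f` solves the linear system on the whole real line. -/
def IsSolution (q r : ℝ → ℂ) (ζ : ℂ) (f : ℝ → Fin 2 → ℂ) : Prop :=
  ∀ x : ℝ, HasDerivAt f (Matrix.mulVec (coeffMatrix q r ζ x) (f x)) x

/-- `ψ₁ = o(1)` and `ψ₂ = e^{iζ²x}[1 + o(1)]` as `x → +∞`. -/
structure IsJostPsi (q r : ℝ → ℂ) (ζ : ℂ) (f : ℝ → Fin 2 → ℂ) : Prop where
  sol : IsSolution q r ζ f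
  fst : Tendsto (fun x => f x 0) atTop (𝓝 0)
  snd : Tendsto (fun x : ℝ => f x 1 * Complex.exp (-Complex.I * ζ ^ 2 * x)) atTop (𝓝 1)

/-- `ψ̄₁ = e^{-iζ²x}[1 + o(1)]` and `ψ̄₂ = o(1)` as `x → +∞`. -/
structure IsJostPsiBar (q r : ℝ → ℂ) (ζ : ℂ) (f : ℝ → Fin 2 → ℂ) : Prop where
  sol : IsSolution q r ζ f
  fst : Tendsto (fun x : ℝ => f x 0 * Complex.exp (Complex.I * ζ ^ 2 * x)) atTop (𝓝 1)
  snd : Tendsto (fun x => f x 1) atTop (𝓝 0)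

/-- `φ₁ = e^{-iζ²x}[1 + o(1)]` and `φ₂ = o(1)` as `x → -∞`. -/
structure IsJostPhi (q r : ℝ → ℂ) (ζ : ℂ) (f : ℝ → Fin 2 → ℂ) : Prop where
  sol : IsSolution q r ζ f
  fst : Tendsto (fun x : ℝ => f x 0 * Complex.exp (Complex.I * ζ ^ 2 * x)) atBot (𝓝 1)
  snd : Tendsto (fun x => f x 1) atBot (𝓝 0)

/-- `φ̄₁ = o(1)` and `φ̄₂ = e^{iζ²x}[1 + o(1)]` as `x → -∞`. -/
structure IsJostPhiBar (q r : ℝ → ℂ) (ζ : ℂ) (f : ℝ → Fin 2 → ℂ) : Prop where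
  sol : IsSolution q r ζ f
  fst : Tendsto (fun x => f x 0) atBot (𝓝 0)
  snd : Tendsto (fun x : ℝ => f x 1 * Complex.exp (-Complex.I * ζ ^ 2 * x)) atBot (𝓝 1)

/-- The Jost solution `ψ(ζ, ·)`; used only for `Im ζ² ≥ 0`, where (for Schwartz potentials) exactly
one function has the defining property. -/
def jostPsi (q r : ℝ → ℂ) (ζ : ℂ) : ℝ → Fin 2 → ℂ := Classical.epsilon (IsJostPsi q r ζ)

/-- The Jost solution `ψ̄(ζ, ·)`; used only for `Im ζ² ≤ 0`. -/
def jostPsiBar (q r : ℝ → ℂ) (ζ : ℂ) : ℝ → Fin 2 → ℂ := Classical.epsilon (IsJostPsiBar q r ζ)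

/-- The Jost solution `φ(ζ, ·)`; used only for `Im ζ² ≥ 0`. -/
def jostPhi (q r : ℝ → ℂ) (ζ : ℂ) : ℝ → Fin 2 → ℂ := Classical.epsilon (IsJostPhi q r ζ)

/-- The Jost solution `φ̄(ζ, ·)`; used only for `Im ζ² ≤ 0`. -/
def jostPhiBar (q r : ℝ → ℂ) (ζ : ℂ) : ℝ → Fin 2 → ℂ := Classical.epsilon (IsJostPhiBar q r ζ)

/-- The Wronskian `[f; g]`.  For two solutions with the same `ζ` the determinant does not depend on
`x`, because the coefficient matrix is traceless; it is evaluated at `x = 0`. -/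
def wronskian (f g : ℝ → Fin 2 → ℂ) : ℂ := f 0 0 * g 0 1 - g 0 0 * f 0 1

/-- The principal square root `ζ = √λ`. -/
def zetaOf (l : ℂ) : ℂ := l ^ (1 / 2 : ℂ)

/-- Transmission coefficient `T(ζ) = 1 / [φ; ψ]`. -/
def transT (q r : ℝ → ℂ) (ζ : ℂ) : ℂ := 1 / wronskian (jostPhi q r ζ) (jostPsi q r ζ)

/-- Transmission coefficient `T̄(ζ) = 1 / [ψ̄; φ̄]`. -/
def transTBar (q r : ℝ → ℂ) (ζ : ℂ) : ℂ := 1 / wronskian (jostPsiBar q r ζ) (jostPhiBar q r ζ)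

/-- Right reflection coefficient `R(ζ) = [φ; ψ̄] / [ψ; φ]`. -/
def reflR (q r : ℝ → ℂ) (ζ : ℂ) : ℂ :=
  wronskian (jostPhi q r ζ) (jostPsiBar q r ζ) / wronskian (jostPsi q r ζ) (jostPhi q r ζ)

/-- Right reflection coefficient `R̄(ζ) = [φ̄; ψ] / [ψ̄; φ̄]`. -/
def reflRBar (q r : ℝ → ℂ) (ζ : ℂ) : ℂ :=
  wronskian (jostPhiBar q r ζ) (jostPsi q r ζ) / wronskian (jostPsiBar q r ζ) (jostPhiBar q r ζ)

/-- The transmission coefficients have no singularity on the real `λ`-axis: the Wronskians in their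
denominators do not vanish there. -/
def NoRealSingularity (q r : ℝ → ℂ) : Prop :=
  ∀ l : ℝ,
    wronskian (jostPhi q r (zetaOf l)) (jostPsi q r (zetaOf l)) ≠ 0 ∧
    wronskian (jostPsiBar q r (zetaOf l)) (jostPhiBar q r (zetaOf l)) ≠ 0

/-- `R̂(y) = (1/2π) ∫ (R(ζ)/ζ) e^{iλy} dλ`. -/
def reflHat (q r : ℝ → ℂ) (y : ℝ) : ℂ :=
  1 / (2 * Real.pi) *
    ∫ l : ℝ, reflR q r (zetaOf l) / zetaOf l * Complex.exp (Complex.I * l * y)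

/-- `(1/2π) ∫ (R̄(ζ)/ζ) e^{-iλy} dλ`. -/
def reflBarHat (q r : ℝ → ℂ) (y : ℝ) : ℂ :=
  1 / (2 * Real.pi) *
    ∫ l : ℝ, reflRBar q r (zetaOf l) / zetaOf l * Complex.exp (-Complex.I * l * y)

/-- A set `{λ_j, m_j, {c_{jk}}_{0 ≤ k < m_j}}_{1 ≤ j ≤ N}` of candidate bound-state data. -/
structure BoundStates where
  N : ℕ
  pole : Fin N → ℂ
  mult : Fin N → ℕ
  c : (j : Fin N) → Fin (mult j) → ℂ

/-- Index set of size `∑ m_j` of the matrix triplet. -/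
abbrev BoundStates.Idx (b : BoundStates) : Type := Σ j : Fin b.N, Fin (b.mult j)

/-- `A`: block diagonal with upper triangular Jordan blocks `A_j` of size `m_j`, eigenvalue `λ_j`. -/
def BoundStates.matA (b : BoundStates) : Matrix b.Idx b.Idx ℂ :=
  Matrix.blockDiagonal' fun j => Matrix.of fun i k : Fin (b.mult j) =>
    if i = k then b.pole j else if i.val + 1 = k.val then 1 else 0

/-- `B`: the column whose blocks are `(0, …, 0, 1)`. -/
def BoundStates.vecB (b : BoundStates) : b.Idx → ℂ :=
  fun p => if p.2.val + 1 = b.mult p.1 then 1 else 0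

/-- `C`: the row whose blocks are `(c_{j(m_j-1)}, …, c_{j1}, c_{j0})`. -/
def BoundStates.vecC (b : BoundStates) : b.Idx → ℂ :=
  fun p => b.c p.1 (Fin.rev p.2)

/-- `C e^{sAy} B` for a complex scalar `s` (`s = i` or `s = -i` below). -/
def BoundStates.expTerm (b : BoundStates) (s : ℂ) (y : ℝ) : ℂ :=
  dotProduct b.vecC (Matrix.mulVec (NormedSpace.exp ((s * (y : ℂ)) • b.matA)) b.vecB)

/-- `b` lists the distinct poles `λ_j` of the transmission coefficient `T` in the open half plane
`U` (everything as a function of `λ`), their multiplicities `m_j`, and the normalization constants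
`c_{jk}`, which are built from `T` and from the dependency constants `γ_{jk}` as follows: near `λ_j`,
`f = (∑_k γ_{jk} (λ-λ_j)^k / k!) g + O((λ-λ_j)^{m_j})` for all `x` (that is,
`∂_λ^k f = ∑_l binom(k,l) γ_{j,k-l} ∂_λ^l g` at `λ_j` for `k < m_j`), and `s c_{jk}` is the
coefficient of `(λ-λ_j)^{-(k+1)}` in the Laurent expansion of
`T(ζ) ζ⁻¹ ∑_k γ_{jk} (λ-λ_j)^k / k!`. -/
structure IsBoundStateData (U : Set ℂ) (T : ℂ → ℂ) (f g : ℂ → ℝ → Fin 2 → ℂ) (s : ℂ)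
    (b : BoundStates) : Prop where
  injective : Function.Injective b.pole
  mem : ∀ j, b.pole j ∈ U
  complete : ∀ l ∈ U, meromorphicOrderAt (fun z => T (zetaOf z)) l < 0 → ∃ j, b.pole j = l
  mult_pos : ∀ j, 0 < b.mult j
  order : ∀ j, meromorphicOrderAt (fun z => T (zetaOf z)) (b.pole j) = ((-(b.mult j : ℤ) : ℤ) : WithTop ℤ)
  norming : ∀ j, ∃ γ : Fin (b.mult j) → ℂ,
    (∀ x : ℝ,
      (fun z : ℂ => f (zetaOf z) x -
          (∑ k, γ k * (z - b.pole j) ^ (k : ℕ) / (Nat.factorial k : ℂ)) • g (zetaOf z) x)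
        =O[𝓝 (b.pole j)] fun z : ℂ => (z - b.pole j) ^ (b.mult j)) ∧
    (fun z : ℂ =>
        T (zetaOf z) / zetaOf z * (∑ k, γ k * (z - b.pole j) ^ (k : ℕ) / (Nat.factorial k : ℂ)) -
          ∑ k, s * b.c j k / (z - b.pole j) ^ ((k : ℕ) + 1))
      =O[𝓝[≠] (b.pole j)] fun _ : ℂ => (1 : ℂ)

/-- Bound-state data `{λ_j, m_j, c_{jk}}` in the upper half plane: poles of `T`, dependency of `φ`
on `ψ`. -/
def IsUpperBoundStates (q r : ℝ → ℂ) (b : BoundStates) : Prop :=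
  IsBoundStateData {l : ℂ | 0 < l.im} (transT q r) (jostPhi q r) (jostPsi q r) Complex.I b

/-- Bound-state data `{λ̄_j, m̄_j, c̄_{jk}}` in the lower half plane: poles of `T̄`, dependency of
`φ̄` on `ψ̄`. -/
def IsLowerBoundStates (q r : ℝ → ℂ) (b : BoundStates) : Prop :=
  IsBoundStateData {l : ℂ | l.im < 0} (transTBar q r) (jostPhiBar q r) (jostPsiBar q r)
    (-Complex.I) b

/-- `Ω(y) = R̂(y) + C e^{iAy} B`. -/
def marchenkoOmega (q r : ℝ → ℂ) (b : BoundStates) (y : ℝ) : ℂ :=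
  reflHat q r y + b.expTerm Complex.I y

/-- `Ω̄(y)`: the Fourier transform of `R̄(ζ)/ζ` plus `C̄ e^{-iĀy} B̄`. -/
def marchenkoOmegaBar (q r : ℝ → ℂ) (b : BoundStates) (y : ℝ) : ℂ :=
  reflBarHat q r y + b.expTerm (-Complex.I) y

/-- `K = [[K̄₁, K₁], [K̄₂, K₂]]` solves the Marchenko system with the kernels `Ω`, `Ω̄`; for every
`x` the entries of `K(x, ·)` are square integrable on `(x, ∞)`. -/
structure IsMarchenkoSolution (Ω ΩBar : ℝ → ℂ) (K : ℝ → ℝ → Matrix (Fin 2) (Fin 2) ℂ) : Prop where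
  memLp : ∀ (x : ℝ) (i j : Fin 2), MemLp (fun y => K x y i j) 2 (volume.restrict (Set.Ioi x))
  eqn : ∀ x y : ℝ, x < y →
    (0 : Matrix (Fin 2) (Fin 2) ℂ) = K x y + !![0, ΩBar (x + y); Ω (x + y), 0] +
      !![∫ z in Set.Ioi x, -Complex.I * K x z 0 1 * deriv Ω (z + y),
         ∫ z in Set.Ioi x, K x z 0 0 * ΩBar (z + y);
         ∫ z in Set.Ioi x, K x z 1 1 * Ω (z + y),
         ∫ z in Set.Ioi x, Complex.I * K x z 1 0 * deriv ΩBar (z + y)]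

end GIScattering

end

noncomputable section

namespace GIScattering

/-! ### Contour integrals in the upper half plane -/

/-! Two gauge transformations remove the energy dependence of the potentials. Let `potV = -(i/2) r'
- q r²/4` and `potU = (i/2) q' - q² r/4`. If `(α, β)` solves the Zakharov–Shabat system `α' = -iλα +
uβ`, `β' = iλβ + vα` with `(u, v) = (q, potV)`, then `(ζα, β + (i/2) r α)` solves (1); if `(u, v) =
(potU, r)`, then `(α - (i/2) q β, ζβ)` does. The reflection coefficients become `ζR` and `R̄/ζ` in
the first gauge, `R/ζ` and `ζR̄` in the second. The two versions of each differ by the factor `λ =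
ζ²`, that is, by a derivative on the Fourier side. The bound-state terms behave in the same way.
Hence the first row of the Marchenko system, with kernels `-iΩ'` and `Ω̄`, is the classical
Marchenko system of `(q, potV)`, and the second row, with kernels `Ω` and `iΩ̄'`, is that of `(potU,
r)`.

It remains to find the boundary values of an arbitrary square integrable solution of a classical
Marchenko system. Neither a uniqueness theorem for that system nor a triangular representation of
the Jost solutions is needed; a duality argument replaces both. Fix `x`, translate it to the origin,
and let `A₁, A₂` be the entries of the Jost function normalised at `+∞`, as functions of `λ`. For
`μ` in the upper half plane, `N = A₂(μ) A₁ - A₁(μ) A₂` vanishes at `μ`, and `N/(λ - μ)` is the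
transform of a test function on the half line. The two Marchenko equations are tested against this
function and its partner from the other half plane. The jump relation on the real line, the residue
conditions at the bound states and Cauchy's theorem evaluate all terms. In the sum of the two
identities only the Laplace transform of the solution survives: `s + ∫₀^∞ k(z) e^{iμz} dz = s' A₁(μ)
+ s A₂(μ)` (`coef_eq_of_marchenko`), where `s, s'` are the coefficients of the inhomogeneous terms.

With `μ = iτ`, `τ → ∞`, the initial value theorem (`tendsto_mul_coef`) recovers `k(0+)` from the
left side, and the expansions `A₁ ~ u(x)/(2iλ)`, `A₂ ~ 1 + (i/(2λ)) ∫_x^∞ u v` (`IsJost.isBigO₁`,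
`IsJost.isBigO₂`) evaluate the right side. The result is `k(0+) = -s' u(x)/2 + (s/2) ∫_x^∞ u v`. The
four entries of `K` are the cases `(s, s') = (0, 1)` and `(1, 0)` in either gauge; an integration by
parts of `q' r` gives the stated form of `K₂(x, x)`.

The remaining work supplies the hypotheses. The Jost functions are built by Picard iteration and
identified with the chosen Jost solutions of (1) by uniqueness. The matrix triplets become finite
families of poles (`PoleFamily`), which encode the exponential kernels and the principal parts of
the meromorphic Jost data simultaneously. -/

theorem integrable_inv_one_add_norm_sq : Integrable fun x : ℝ => ((1 + ‖x‖) ^ 2)⁻¹ := by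
  have := integrable_one_add_norm (E := ℝ) (μ := volume) (r := 2) (by simp)
  refine this.congr (Eventually.of_forall fun x => ?_)
  have h : (0:ℝ) < 1 + ‖x‖ := by positivity
  simp only [Real.rpow_neg h.le]
  norm_num

/-- Cauchy's theorem on the rectangle with base `[-R, R]` and height `R`: the other three sides have
total length `4R`, and `h` is at most `C / R²` on them. -/
theorem integral_eq_zero_of_upper {h : ℂ → ℂ} (hd : DifferentiableOn ℂ h {l | 0 < l.im})
    (hc : ContinuousOn h {l | 0 ≤ l.im}) {C : ℝ}
    (hb : ∀ l : ℂ, 0 ≤ l.im → ‖h l‖ ≤ C / (1 + ‖l‖) ^ 2) :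
    Integrable (fun x : ℝ => h x) ∧ ∫ x : ℝ, h x = 0 := by
  have hC : 0 ≤ C := by
    have := (norm_nonneg _).trans (hb 0 (by simp))
    simpa using this
  have hcr : Continuous fun x : ℝ => h x :=
    hc.comp_continuous Complex.continuous_ofReal (fun x => by simp)
  have hint : Integrable fun x : ℝ => h x := by
    refine (integrable_inv_one_add_norm_sq.const_mul C).mono' hcr.aestronglyMeasurable
      (Eventually.of_forall fun x => ?_)
    have := hb x (by simp)
    simpa [div_eq_mul_inv] using this
  refine ⟨hint, ?_⟩
  have h1 : Tendsto (fun R : ℝ => ∫ x in (-R)..R, h x) atTop (𝓝 (∫ x : ℝ, h x)) :=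
    intervalIntegral_tendsto_integral hint tendsto_neg_atTop_atBot tendsto_id
  have h2 : Tendsto (fun R : ℝ => ∫ x in (-R)..R, h x) atTop (𝓝 0) := by
    have hz : Tendsto (fun R : ℝ => 4 * C / R) atTop (𝓝 0) :=
      tendsto_const_nhds.div_atTop tendsto_id
    refine squeeze_zero_norm' ?_ hz
    filter_upwards [eventually_gt_atTop 0] with R hR
    have hrect := Complex.integral_boundary_rect_eq_zero_of_continuousOn_of_differentiableOn h
      (-R : ℂ) (R + R * Complex.I)
      (hc.mono (by
        intro l hl
        simp [Complex.mem_reProdIm, Set.uIcc_of_le hR.le] at hl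
        exact hl.2.1))
      (hd.mono (by
        intro l hl
        simp [Complex.mem_reProdIm, min_eq_left hR.le] at hl
        exact hl.2.1))
    simp at hrect
    have hbd : ∀ l : ℂ, 0 ≤ l.im → R ≤ ‖l‖ → ‖h l‖ ≤ C / R ^ 2 := by
      intro l hl hRl
      refine (hb l hl).trans ?_
      gcongr
      linarith
    have b1 : ‖∫ x : ℝ in -R..R, h (x + R * Complex.I)‖ ≤ C / R ^ 2 * |R - -R| := by
      refine intervalIntegral.norm_integral_le_of_norm_le_const fun x _ => hbd _ (by simp [hR.le]) ?_
      have := Complex.abs_im_le_norm ((x : ℂ) + R * Complex.I)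
      simpa [abs_of_pos hR] using this
    have b2 : ‖∫ y : ℝ in (0:ℝ)..R, h (R + y * Complex.I)‖ ≤ C / R ^ 2 * |R - 0| := by
      refine intervalIntegral.norm_integral_le_of_norm_le_const fun y hy => hbd _ ?_ ?_
      · rw [Set.uIoc_of_le hR.le] at hy; simpa using hy.1.le
      · have := Complex.abs_re_le_norm ((R : ℂ) + y * Complex.I)
        simpa [abs_of_pos hR] using this
    have b3 : ‖∫ y : ℝ in (0:ℝ)..R, h (-R + y * Complex.I)‖ ≤ C / R ^ 2 * |R - 0| := by
      refine intervalIntegral.norm_integral_le_of_norm_le_const fun y hy => hbd _ ?_ ?_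
      · rw [Set.uIoc_of_le hR.le] at hy; simpa using hy.1.le
      · have := Complex.abs_re_le_norm (-(R : ℂ) + y * Complex.I)
        simpa [abs_of_pos hR] using this
    have e : (∫ x : ℝ in -R..R, h x) = (∫ x : ℝ in -R..R, h (x + R * Complex.I))
        - Complex.I * (∫ y : ℝ in (0:ℝ)..R, h (R + y * Complex.I))
        + Complex.I * (∫ y : ℝ in (0:ℝ)..R, h (-R + y * Complex.I)) := by
      linear_combination hrect
    rw [e]
    refine (norm_add_le _ _).trans ((add_le_add_left (norm_sub_le _ _) _).trans ?_)
    rw [norm_mul, norm_mul, Complex.norm_I, one_mul, one_mul]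
    have a1 : |R - -R| = 2 * R := by rw [abs_of_pos] <;> linarith
    have a2 : |R - 0| = R := by rw [sub_zero, abs_of_pos hR]
    rw [a1] at b1; rw [a2] at b2 b3
    have : C / R ^ 2 * (2 * R) + C / R ^ 2 * R + C / R ^ 2 * R = 4 * C / R := by
      field_simp; ring
    linarith
  exact tendsto_nhds_unique h1 h2

/-- Functions analytic in the open upper half plane, continuous up to the real line, and
`O(1 / (1 + |λ|))` on the closed half plane. -/
structure IsHardy (h : ℂ → ℂ) : Prop where
  diff : DifferentiableOn ℂ h {l | 0 < l.im}
  cont : ContinuousOn h {l | 0 ≤ l.im}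
  bound : ∃ C, ∀ l : ℂ, 0 ≤ l.im → ‖h l‖ ≤ C / (1 + ‖l‖)

theorem IsHardy.continuous_real {h : ℂ → ℂ} (hh : IsHardy h) : Continuous fun x : ℝ => h x :=
  hh.cont.comp_continuous Complex.continuous_ofReal (fun x => by simp)

theorem IsHardy.mul {f g : ℂ → ℂ} (hf : IsHardy f) (hg : IsHardy g) :
    Integrable (fun x : ℝ => f x * g x) ∧ ∫ x : ℝ, f x * g x = 0 := by
  obtain ⟨C, hC⟩ := hf.bound
  obtain ⟨D, hD⟩ := hg.bound
  refine integral_eq_zero_of_upper (h := fun l => f l * g l) (C := C * D) (hf.diff.mul hg.diff)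
    (hf.cont.mul hg.cont) fun l hl => ?_
  rw [norm_mul]
  calc ‖f l‖ * ‖g l‖ ≤ C / (1 + ‖l‖) * (D / (1 + ‖l‖)) :=
        mul_le_mul (hC l hl) (hD l hl) (norm_nonneg _) ((norm_nonneg _).trans (hC l hl))
    _ = _ := by rw [div_mul_div_comm, sq]

theorem IsHardy.add {f g : ℂ → ℂ} (hf : IsHardy f) (hg : IsHardy g) :
    IsHardy fun l => f l + g l := by
  obtain ⟨C, hC⟩ := hf.bound
  obtain ⟨D, hD⟩ := hg.bound
  refine ⟨hf.diff.add hg.diff, hf.cont.add hg.cont, C + D, fun l hl => ?_⟩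
  rw [add_div]
  exact (norm_add_le _ _).trans (add_le_add (hC l hl) (hD l hl))

theorem IsHardy.const_mul {f : ℂ → ℂ} (hf : IsHardy f) (c : ℂ) : IsHardy fun l => c * f l := by
  obtain ⟨C, hC⟩ := hf.bound
  refine ⟨hf.diff.const_mul c, continuousOn_const.mul hf.cont, ‖c‖ * C, fun l hl => ?_⟩
  rw [norm_mul, mul_div_assoc]
  exact mul_le_mul_of_nonneg_left (hC l hl) (norm_nonneg _)

/-- The filter of neighbourhoods of infinity in the closed upper half plane. -/
def upInf : Filter ℂ := Bornology.cobounded ℂ ⊓ 𝓟 {l | 0 ≤ l.im}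

theorem upInf_le : upInf ≤ Bornology.cobounded ℂ := inf_le_left

/-- Far out `1 + ‖l‖ ≤ 2‖l‖`, so the asymptotic bound applies with a factor `2 ^ n`; on the
remaining compact half disc continuity bounds `h`. -/
theorem exists_bound_of_isBigO {h : ℂ → ℂ} (hc : ContinuousOn h {l | 0 ≤ l.im}) (n : ℕ)
    (hO : h =O[upInf] fun l => (l ^ n)⁻¹) :
    ∃ C, ∀ l : ℂ, 0 ≤ l.im → ‖h l‖ ≤ C / (1 + ‖l‖) ^ n := by
  obtain ⟨C, hC⟩ := hO.bound
  rw [upInf, eventually_inf_principal] at hC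
  obtain ⟨R, -, hR⟩ := (Metric.hasBasis_cobounded_compl_closedBall (0 : ℂ)).eventually_iff.1 hC
  have hK : IsCompact (Metric.closedBall (0 : ℂ) (max R 1) ∩ {l | 0 ≤ l.im}) :=
    (isCompact_closedBall _ _).inter_right (isClosed_le continuous_const Complex.continuous_im)
  obtain ⟨M, hM⟩ := hK.exists_bound_of_continuousOn (hc.mono Set.inter_subset_right)
  refine ⟨max (|M| * (1 + max R 1) ^ n) (|C| * 2 ^ n), fun l hl => ?_⟩
  have hp : 0 < (1 + ‖l‖) ^ n := by positivity
  rw [le_div_iff₀ hp]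
  by_cases hlR : ‖l‖ ≤ max R 1
  · refine le_trans ?_ (le_max_left _ _)
    have := (hM l ⟨by simpa using hlR, hl⟩).trans (le_abs_self M)
    gcongr
  · push Not at hlR
    refine le_trans ?_ (le_max_right _ _)
    have h1 : 1 < ‖l‖ := (le_max_right _ _).trans_lt hlR
    have h2 := hR (x := l) (by simpa using (le_max_left _ _).trans_lt hlR) hl
    have h3 : ‖h l‖ ≤ |C| * (‖l‖ ^ n)⁻¹ := by
      refine h2.trans ?_
      rw [norm_inv, norm_pow]
      gcongr
      exact le_abs_self C
    calc ‖h l‖ * (1 + ‖l‖) ^ n ≤ |C| * (‖l‖ ^ n)⁻¹ * (2 * ‖l‖) ^ n := by gcongr; linarith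
      _ = |C| * 2 ^ n := by
        rw [mul_pow]; field_simp

theorem IsHardy.of_isBigO {h : ℂ → ℂ} (hd : DifferentiableOn ℂ h {l | 0 < l.im})
    (hc : ContinuousOn h {l | 0 ≤ l.im}) (hO : h =O[upInf] fun l => l⁻¹) : IsHardy h := by
  obtain ⟨C, hC⟩ := exists_bound_of_isBigO hc 1 (by simpa using hO)
  exact ⟨hd, hc, C, by simpa using hC⟩

theorem IsHardy.isBigO {h : ℂ → ℂ} (hh : IsHardy h) : h =O[upInf] fun l => l⁻¹ := by
  obtain ⟨C, hC⟩ := hh.bound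
  refine IsBigO.of_bound C ?_
  rw [upInf, eventually_inf_principal]
  have h0 : 0 ≤ C := by
    have := (norm_nonneg _).trans (hC 0 (by simp))
    simpa using this
  filter_upwards [(Metric.hasBasis_cobounded_compl_closedBall (0 : ℂ)).mem_of_mem
    (i := 0) trivial] with l hl hl'
  refine (hC l hl').trans ?_
  have : 0 < ‖l‖ := by simpa using hl
  rw [norm_inv, div_eq_mul_inv]
  gcongr
  linarith

theorem isBigO_inv_sub (ν : ℂ) :
    (fun l : ℂ => (l - ν)⁻¹) =O[Bornology.cobounded ℂ] fun l => l⁻¹ := by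
  refine IsBigO.inv_rev ?_ ?_
  · have h1 : (fun _ : ℂ => ν) =o[Bornology.cobounded ℂ] fun l : ℂ => l :=
      isLittleO_const_id_cobounded ν
    have := (h1.right_isBigO_sub)
    simpa using this
  · filter_upwards [(Metric.hasBasis_cobounded_compl_closedBall (0 : ℂ)).mem_of_mem
      (i := ‖ν‖) trivial] with l hl h
    have hl' : ‖ν‖ < ‖l‖ := by simpa using hl
    rw [show l = 0 from h, norm_zero] at hl'
    exact absurd hl' (not_lt.2 (norm_nonneg _))

theorem sub_ne_zero_of_im_neg {ν l : ℂ} (hν : ν.im < 0) (hl : 0 ≤ l.im) : l - ν ≠ 0 := by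
  intro h
  have := congrArg Complex.im h
  simp at this; linarith

theorem isHardy_inv_sub {ν : ℂ} (hν : ν.im < 0) : IsHardy fun l => (l - ν)⁻¹ := by
  refine IsHardy.of_isBigO ?_ ?_ ((isBigO_inv_sub ν).mono upInf_le)
  · exact (differentiable_id.sub_const ν).differentiableOn.inv
      fun l hl => sub_ne_zero_of_im_neg hν (le_of_lt hl)
  · exact (continuous_id.sub continuous_const).continuousOn.inv₀
      fun l hl => sub_ne_zero_of_im_neg hν hl

theorem isBigO_inv_sub_sub_inv (ν : ℂ) :
    (fun l : ℂ => (l - ν)⁻¹ - l⁻¹) =O[Bornology.cobounded ℂ] fun l => (l ^ 2)⁻¹ := by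
  have h1 : (fun l : ℂ => ν * ((l - ν)⁻¹ * l⁻¹)) =O[Bornology.cobounded ℂ] fun l => l⁻¹ * l⁻¹ :=
    ((isBigO_inv_sub ν).mul (isBigO_refl _ _)).const_mul_left ν
  refine (h1.congr' ?_ ?_)
  · filter_upwards [(Metric.hasBasis_cobounded_compl_closedBall (0 : ℂ)).mem_of_mem
      (i := ‖ν‖) trivial] with l hl
    have hl' : ‖ν‖ < ‖l‖ := by simpa using hl
    have h2 : l ≠ 0 := by
      rintro rfl; simp at hl'; exact absurd hl' (not_lt.2 (norm_nonneg _))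
    have h3 : l - ν ≠ 0 := by
      intro h; rw [sub_eq_zero.1 h] at hl'; exact lt_irrefl _ hl'
    field_simp; ring
  · exact Eventually.of_forall fun l => by simp only [sq, mul_inv]

theorem integral_inv_I_sub_inv :
    ∫ x : ℝ, (((x : ℂ) + Complex.I)⁻¹ + (-(x : ℂ) + Complex.I)⁻¹)
      = -2 * Real.pi * Complex.I := by
  have h : ∀ x : ℝ, (((x : ℂ) + Complex.I)⁻¹ + (-(x : ℂ) + Complex.I)⁻¹)
      = -2 * Complex.I * (((1 + x ^ 2)⁻¹ : ℝ) : ℂ) := by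
    intro x
    have h0 : (1 + x ^ 2 : ℝ) ≠ 0 := by positivity
    have h0' : (1 + x ^ 2 : ℂ) ≠ 0 := by exact_mod_cast h0
    have h1 : (x : ℂ) + Complex.I ≠ 0 := fun h => by simpa using congrArg Complex.im h
    have h2 : -(x : ℂ) + Complex.I ≠ 0 := fun h => by simpa using congrArg Complex.im h
    push_cast
    field_simp
    ring_nf
    simp only [show Complex.I ^ 3 = -Complex.I by rw [pow_succ, Complex.I_sq]; ring]
    ring
  simp_rw [h]
  rw [integral_const_mul, integral_complex_ofReal, integral_univ_inv_one_add_sq]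
  ring

/-- If a function analytic above and one analytic below the real line share the leading
behaviour `c / λ`, the integral of their difference is `-2πic`. -/
theorem integral_jump {f g : ℂ → ℂ} (hf : IsHardy f) (hg : IsHardy g) {c : ℂ}
    (hfc : (fun l => f l - c * l⁻¹) =O[upInf] fun l => (l ^ 2)⁻¹)
    (hgc : (fun l => g l + c * l⁻¹) =O[upInf] fun l => (l ^ 2)⁻¹) :
    Integrable (fun x : ℝ => f x - g (-x)) ∧
      ∫ x : ℝ, (f x - g (-x)) = -2 * Real.pi * Complex.I * c := by
  -- Subtracting `d / (l + i)`, whose pole lies below the real line, removes the tail `d / l`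
  -- without leaving the Hardy class. The remainder is `O(l⁻²)`, so its integral vanishes.
  have hI : (-Complex.I).im < 0 := by simp
  have key : ∀ {F : ℂ → ℂ} {d : ℂ}, IsHardy F →
      ((fun l => F l - d * l⁻¹) =O[upInf] fun l => (l ^ 2)⁻¹) →
      Integrable (fun x : ℝ => F x - d * ((x : ℂ) + Complex.I)⁻¹) ∧
        ∫ x : ℝ, (F x - d * ((x : ℂ) + Complex.I)⁻¹) = 0 := by
    intro F d hF hFd
    have h1 := isHardy_inv_sub hI
    have h2 : (fun l => F l - d * (l - -Complex.I)⁻¹) =O[upInf] fun l => (l ^ 2)⁻¹ := by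
      have := hFd.sub (((isBigO_inv_sub_sub_inv (-Complex.I)).mono upInf_le).const_mul_left d)
      refine this.congr_left fun l => ?_
      ring
    obtain ⟨C, hC⟩ := exists_bound_of_isBigO
      (hF.cont.sub (continuousOn_const.mul h1.cont)) 2 h2
    have := integral_eq_zero_of_upper (hF.diff.sub (h1.diff.const_mul d))
      (hF.cont.sub (continuousOn_const.mul h1.cont)) hC
    simpa using this
  obtain ⟨i1, e1⟩ := key hf hfc
  obtain ⟨i2, e2⟩ := key (d := -c) hg (by simpa using hgc)
  have i2' := i2.comp_neg
  have e2' := integral_neg_eq_self (fun x : ℝ => g x - -c * ((x : ℂ) + Complex.I)⁻¹) volume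
  rw [e2] at e2'
  have hsum : ∀ x : ℝ, f x - g (-x) = (f x - c * ((x : ℂ) + Complex.I)⁻¹)
      - (g (-x : ℝ) - -c * (((-x : ℝ) : ℂ) + Complex.I)⁻¹)
      + c * (((x : ℂ) + Complex.I)⁻¹ + (-(x : ℂ) + Complex.I)⁻¹) := by
    intro x; push_cast; ring
  have i3 : Integrable fun x : ℝ =>
      c * (((x : ℂ) + Complex.I)⁻¹ + (-(x : ℂ) + Complex.I)⁻¹) := by
    refine Integrable.const_mul ?_ c
    -- A non-integrable function has integral `0` by convention, which contradicts the nonzero value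
    -- already computed.
    by_contra hni
    have := integral_inv_I_sub_inv
    rw [integral_undef hni] at this
    have h := congrArg Complex.im this
    simp [Real.pi_ne_zero] at h
  simp_rw [hsum]
  refine ⟨(i1.sub i2').add i3, ?_⟩
  refine (integral_add (i1.sub i2') i3).trans ?_
  have e3 := integral_sub i1 i2'
  rw [e1, e2'] at e3
  simp only [Pi.sub_apply]
  rw [e3, integral_const_mul, integral_inv_I_sub_inv]
  ring

/-- Cauchy's integral formula for the upper half plane. -/
theorem IsHardy.cauchy {h : ℂ → ℂ} (hh : IsHardy h) {μ : ℂ} (hμ : 0 < μ.im) :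
    ∫ x : ℝ, h x * ((x : ℂ) - μ)⁻¹ = 2 * Real.pi * Complex.I * h μ := by
  have hdd : DifferentiableOn ℂ (dslope h μ) {l | 0 < l.im} :=
    (Complex.differentiableOn_dslope
      ((isOpen_lt continuous_const Complex.continuous_im).mem_nhds hμ)).2 hh.diff
  have hcd : ContinuousOn (dslope h μ) {l | 0 ≤ l.im} := by
    intro l hl
    by_cases hlμ : l = μ
    · subst hlμ
      exact (hdd.continuousOn.continuousAt
        ((isOpen_lt continuous_const Complex.continuous_im).mem_nhds hμ)).continuousWithinAt
    · exact (continuousWithinAt_dslope_of_ne hlμ).2 (hh.cont l hl)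
  have hO : ∀ᶠ l in upInf, dslope h μ l = (l - μ)⁻¹ * (h l - h μ) := by
    refine upInf_le ?_
    filter_upwards [(Metric.hasBasis_cobounded_compl_closedBall (0 : ℂ)).mem_of_mem
      (i := ‖μ‖) trivial] with l hl
    have hne : l ≠ μ := by rintro rfl; simp at hl
    rw [dslope_of_ne _ hne, slope_def_field, div_eq_inv_mul]
  have hb := (isBigO_inv_sub μ).mono upInf_le
  have hasymp : (fun l => dslope h μ l - (-h μ) * l⁻¹) =O[upInf] fun l => (l ^ 2)⁻¹ := by
    have h1 : (fun l => (l - μ)⁻¹ * h l) =O[upInf] fun l => (l ^ 2)⁻¹ := by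
      refine (hb.mul hh.isBigO).congr_right fun l => by rw [sq, mul_inv]
    have h2 := ((isBigO_inv_sub_sub_inv μ).mono upInf_le).const_mul_left (h μ)
    refine (h1.sub h2).congr' ?_ EventuallyEq.rfl
    filter_upwards [hO] with l hl
    rw [hl]; ring
  have hH : IsHardy (dslope h μ) := by
    refine IsHardy.of_isBigO hdd hcd ?_
    have h1 : (fun l => h l - h μ) =O[upInf] fun _ => (1 : ℂ) := by
      refine IsBigO.sub ?_ (isBigO_const_const _ one_ne_zero _)
      obtain ⟨C, hC⟩ := hh.bound
      refine IsBigO.of_bound |C| ?_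
      rw [upInf, eventually_inf_principal]
      refine Eventually.of_forall fun l hl => (hC l hl).trans ?_
      rw [norm_one, mul_one]
      refine (div_le_div_of_nonneg_right (le_abs_self C) (by positivity)).trans ?_
      exact div_le_self (abs_nonneg _) (by linarith [norm_nonneg l])
    refine ((hb.mul h1).congr' ?_ ?_)
    · filter_upwards [hO] with l hl
      rw [hl]
    · exact Eventually.of_forall fun l => by simp
  have hν : (-μ).im < 0 := by simpa using hμ
  -- Evaluated at `-x`, this function equals `-h μ / (x - μ)` and restores the term that the
  -- difference quotient subtracts. The jump of the pair is therefore the Cauchy integrand itself.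
  have hG : IsHardy fun l => h μ * (l - -μ)⁻¹ := (isHardy_inv_sub hν).const_mul _
  obtain ⟨-, e⟩ := integral_jump (c := -h μ) hH hG hasymp (by
    have h2 := ((isBigO_inv_sub_sub_inv (-μ)).mono upInf_le).const_mul_left (h μ)
    refine h2.congr_left fun l => ?_
    ring)
  rw [show 2 * Real.pi * Complex.I * h μ = -2 * Real.pi * Complex.I * -h μ by ring, ← e]
  refine integral_congr_ae (Eventually.of_forall fun x => ?_)
  have hne : (x : ℂ) ≠ μ := by
    intro h; have := congrArg Complex.im h; simp at this; linarith
  have hne' : (x : ℂ) - μ ≠ 0 := sub_ne_zero.2 hne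
  simp only []
  rw [dslope_of_ne _ hne, slope_def_field]
  have : (-(x : ℂ) - -μ)⁻¹ = -((x : ℂ) - μ)⁻¹ := by rw [← inv_neg]; congr 1; ring
  rw [this]
  field_simp
  ring

theorem IsHardy.integrable_mul_inv_sub {h : ℂ → ℂ} (hh : IsHardy h) {μ : ℂ} (hμ : μ.im < 0) :
    ∫ x : ℝ, h x * ((x : ℂ) - μ)⁻¹ = 0 :=
  (hh.mul (isHardy_inv_sub hμ)).2

section

open scoped FourierTransform

/-! ### The Fourier transform on `L²`, through representatives -/

/-- `g` represents the inverse Fourier transform `∫ f(y) e^{2πi y ξ} dy` of `f ∈ L²`. -/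
def IsFT (f g : ℝ → ℂ) : Prop :=
  ∃ (hf : MemLp f 2 volume) (hg : MemLp g 2 volume), 𝓕⁻ (hf.toLp f) = hg.toLp g

theorem IsFT.memLp_left {f g : ℝ → ℂ} (h : IsFT f g) : MemLp f 2 volume := h.1

theorem IsFT.memLp_right {f g : ℝ → ℂ} (h : IsFT f g) : MemLp g 2 volume := h.2.1

theorem exists_isFT {f : ℝ → ℂ} (hf : MemLp f 2 volume) : ∃ g, IsFT f g :=
  ⟨(𝓕⁻ (hf.toLp f) : Lp ℂ 2 (volume : Measure ℝ)), hf, Lp.memLp _, by simp⟩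

theorem exists_isFT' {g : ℝ → ℂ} (hg : MemLp g 2 volume) : ∃ f, IsFT f g :=
  ⟨(𝓕 (hg.toLp g) : Lp ℂ 2 (volume : Measure ℝ)), Lp.memLp _, hg, by
    rw [Lp.toLp_coeFn]; exact FourierTransform.fourierInv_fourier_eq _⟩

theorem IsFT.congr_left {f f' g : ℝ → ℂ} (h : IsFT f g) (e : f =ᵐ[volume] f') : IsFT f' g := by
  obtain ⟨hf, hg, h⟩ := h
  refine ⟨(memLp_congr_ae e).1 hf, hg, ?_⟩
  rw [← h, MemLp.toLp_congr _ hf e.symm]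

theorem IsFT.congr_right {f g g' : ℝ → ℂ} (h : IsFT f g) (e : g =ᵐ[volume] g') : IsFT f g' := by
  obtain ⟨hf, hg, h⟩ := h
  refine ⟨hf, (memLp_congr_ae e).1 hg, ?_⟩
  rw [h, MemLp.toLp_congr _ hg e.symm]

theorem IsFT.eq_zero {f : ℝ → ℂ} (h : IsFT f (fun _ => 0)) : f =ᵐ[volume] fun _ => 0 := by
  obtain ⟨hf, hg, h⟩ := h
  have h0 : 𝓕⁻ (hf.toLp f) = 0 := by
    rw [h]; exact MemLp.toLp_zero hg
  have h1 : hf.toLp f = 0 := by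
    have := FourierTransform.fourier_fourierInv_eq (E := Lp ℂ 2 (volume : Measure ℝ))
      (F := Lp ℂ 2 (volume : Measure ℝ)) (hf.toLp f)
    rw [h0] at this
    rw [← this]
    exact (Lp.fourierTransformₗᵢ ℝ ℂ).map_zero
  exact (MemLp.toLp_eq_toLp_iff hf MemLp.zero).1 h1

theorem continuous_star_Lp : Continuous fun A : Lp ℂ 2 (volume : Measure ℝ) => star A := by
  refine LipschitzWith.continuous (K := 1) (LipschitzWith.of_dist_le_mul fun A B => ?_)
  rw [dist_eq_norm, dist_eq_norm, NNReal.coe_one, one_mul]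
  refine Lp.norm_le_norm_of_ae_le ?_
  filter_upwards [Lp.coeFn_sub (star A) (star B), Lp.coeFn_sub A B, Lp.coeFn_star A,
    Lp.coeFn_star B] with x h1 h2 h3 h4
  rw [h1, h2, Pi.sub_apply, h3, h4, Pi.sub_apply, Pi.star_apply, Pi.star_apply, ← star_sub,
    norm_star]

/-- Written as `inner ℂ (star F) G`, the bilinear pairing is continuous on `L²`, so the identity
extends from the dense subspace of Schwartz functions. -/
theorem integral_fourierInv_mul_Lp (F G : Lp ℂ 2 (volume : Measure ℝ)) :
    ∫ x, (𝓕⁻ F : Lp ℂ 2 (volume : Measure ℝ)) x * G x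
      = ∫ x, F x * (𝓕⁻ G : Lp ℂ 2 (volume : Measure ℝ)) x := by
  have key : ∀ A B : Lp ℂ 2 (volume : Measure ℝ), ∫ x, A x * B x = inner ℂ (star A) B := by
    intro A B
    rw [L2.inner_def]
    refine integral_congr_ae ?_
    filter_upwards [Lp.coeFn_star A] with x hx
    rw [hx]
    simp [mul_comm]
  simp_rw [key]
  have hc : Continuous fun A : Lp ℂ 2 (volume : Measure ℝ) => (𝓕⁻ A : Lp ℂ 2 (volume : Measure ℝ)) :=
    (Lp.fourierTransformₗᵢ ℝ ℂ).symm.continuous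
  refine DenseRange.induction_on₂ (e := SchwartzMap.toLpCLM ℂ (E := ℝ) ℂ 2 volume)
    (SchwartzMap.denseRange_toLpCLM (by norm_num)) (p := fun F G =>
      inner ℂ (star (𝓕⁻ F : Lp ℂ 2 (volume : Measure ℝ))) G
        = inner ℂ (star F) (𝓕⁻ G : Lp ℂ 2 (volume : Measure ℝ))) ?_ ?_ F G
  · refine isClosed_eq ?_ ?_
    · exact (continuous_star_Lp.comp (hc.comp continuous_fst)).inner continuous_snd
    · exact (continuous_star_Lp.comp continuous_fst).inner (hc.comp continuous_snd)
  · intro f g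
    change inner ℂ (star (𝓕⁻ (f.toLp 2) : Lp ℂ 2 (volume : Measure ℝ))) (g.toLp 2)
        = inner ℂ (star (f.toLp 2)) (𝓕⁻ (g.toLp 2) : Lp ℂ 2 (volume : Measure ℝ))
    rw [← key, ← key, SchwartzMap.toLp_fourierInv_eq, SchwartzMap.toLp_fourierInv_eq]
    have e1 : ∫ x, (𝓕⁻ f).toLp 2 volume x * g.toLp 2 volume x = ∫ x, 𝓕⁻ f x * g x := by
      refine integral_congr_ae ?_
      filter_upwards [SchwartzMap.coeFn_toLp (𝓕⁻ f) 2 volume, SchwartzMap.coeFn_toLp g 2 volume]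
        with x h1 h2
      rw [h1, h2]
    have e2 : ∫ x, f.toLp 2 volume x * (𝓕⁻ g).toLp 2 volume x = ∫ x, f x * 𝓕⁻ g x := by
      refine integral_congr_ae ?_
      filter_upwards [SchwartzMap.coeFn_toLp (𝓕⁻ g) 2 volume, SchwartzMap.coeFn_toLp f 2 volume]
        with x h1 h2
      rw [h1, h2]
    rw [e1, e2]
    exact SchwartzMap.integral_fourierInv_mul_eq f g

/-- Multiplication formula. -/
theorem IsFT.integral_mul {f g f' g' : ℝ → ℂ} (h : IsFT f g) (h' : IsFT f' g') :
    ∫ x, g x * f' x = ∫ x, f x * g' x := by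
  obtain ⟨hf, hg, h⟩ := h
  obtain ⟨hf', hg', h'⟩ := h'
  have := integral_fourierInv_mul_Lp (hf.toLp f) (hf'.toLp f')
  rw [h, h'] at this
  refine Eq.trans (integral_congr_ae ?_) (this.trans (integral_congr_ae ?_))
  · filter_upwards [hg.coeFn_toLp, hf'.coeFn_toLp] with x h1 h2
    rw [h1, h2]
  · filter_upwards [hf.coeFn_toLp, hg'.coeFn_toLp] with x h1 h2
    rw [h1, h2]

theorem isFT_schwartz (φ : 𝓢(ℝ, ℂ)) : IsFT φ (𝓕⁻ φ : 𝓢(ℝ, ℂ)) :=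
  ⟨φ.memLp 2, (𝓕⁻ φ).memLp 2, SchwartzMap.toLp_fourierInv_eq φ⟩

theorem ae_eq_of_integral_schwartz {f g : ℝ → ℂ} (hf : LocallyIntegrable f)
    (hg : LocallyIntegrable g)
    (h : ∀ φ : 𝓢(ℝ, ℂ), ∫ x, f x * φ x = ∫ x, g x * φ x) : f =ᵐ[volume] g := by
  refine ae_eq_of_integral_contDiff_smul_eq hf hg fun ψ hψ hc => ?_
  have h1 : ContDiff ℝ (⊤ : ℕ∞) fun x => ((ψ x : ℝ) : ℂ) := Complex.ofRealCLM.contDiff.comp hψ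
  have h2 : HasCompactSupport fun x => ((ψ x : ℝ) : ℂ) :=
    hc.comp_left (g := fun r : ℝ => (r : ℂ)) (by simp)
  have := h (h2.toSchwartzMap h1)
  simpa [mul_comm] using this

/-- A weak characterisation of the transform: by the multiplication formula the true transform has
the same pairings with Schwartz functions as `g`, hence agrees with it almost everywhere. -/
theorem isFT_of_integral_schwartz {f g : ℝ → ℂ} (hf : MemLp f 2 volume)
    (hg : LocallyIntegrable g)
    (h : ∀ φ : 𝓢(ℝ, ℂ), ∫ x, g x * φ x = ∫ x, f x * (𝓕⁻ φ : 𝓢(ℝ, ℂ)) x) : IsFT f g := by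
  obtain ⟨g', hg'⟩ := exists_isFT hf
  refine hg'.congr_right ?_
  refine ae_eq_of_integral_schwartz (hg'.memLp_right.locallyIntegrable (by norm_num)) hg fun φ => ?_
  rw [h, hg'.integral_mul (isFT_schwartz φ)]

theorem fourierInv_apply (f : ℝ → ℂ) (ξ : ℝ) :
    𝓕⁻ f ξ = ∫ y : ℝ, Complex.exp (2 * Real.pi * Complex.I * ξ * y) * f y := by
  rw [Real.fourierInv_eq']
  refine integral_congr_ae (Eventually.of_forall fun y => ?_)
  simp only [smul_eq_mul]
  congr 2
  simp
  ring

/-- On `L¹ ∩ L²` the transform is given by the integral. -/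
theorem isFT_of_integrable {f : ℝ → ℂ} (h1 : Integrable f) (h2 : MemLp f 2 volume) :
    IsFT f fun ξ => ∫ y : ℝ, Complex.exp (2 * Real.pi * Complex.I * ξ * y) * f y := by
  have hcont : Continuous (𝓕⁻ f) := by
    have := VectorFourier.fourierIntegral_continuous (μ := volume) (L := -innerₗ ℝ)
      Real.continuous_fourierChar (show Continuous fun p : ℝ × ℝ => (-innerₗ ℝ) p.1 p.2 from
        (continuous_inner (𝕜 := ℝ) (E := ℝ)).neg) h1
    exact this
  simp_rw [← fourierInv_apply]
  refine isFT_of_integral_schwartz h2 hcont.locallyIntegrable fun φ => ?_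
  have := VectorFourier.integral_bilin_fourierIntegral_eq_flip (μ := volume) (ν := volume)
    (ContinuousLinearMap.mul ℂ ℂ) (L := -innerₗ ℝ)
    Real.continuous_fourierChar (show Continuous fun p : ℝ × ℝ => (-innerₗ ℝ) p.1 p.2 from
      (continuous_inner (𝕜 := ℝ) (E := ℝ)).neg) h1 φ.integrable
  have e : (-innerₗ ℝ).flip = -innerₗ ℝ := by
    ext; simp
  rw [e] at this
  rw [SchwartzMap.fourierInv_coe]
  exact this

/-- Fourier inversion. -/
theorem IsFT.inversion {f g : ℝ → ℂ} (h : IsFT f g) : IsFT g fun x => f (-x) := by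
  have hm : MemLp (fun x => f (-x)) 2 volume :=
    h.memLp_left.comp_measurePreserving (Measure.measurePreserving_neg volume)
  refine isFT_of_integral_schwartz h.memLp_right (hm.locallyIntegrable (by norm_num)) fun φ => ?_
  rw [h.integral_mul (isFT_schwartz (𝓕⁻ φ))]
  rw [← integral_neg_eq_self]
  refine integral_congr_ae (Eventually.of_forall fun x => ?_)
  simp only [neg_neg]
  congr 1
  rw [SchwartzMap.fourierInv_apply_eq]
  simp [FourierTransform.fourier_fourierInv_eq]

/-- Parseval's formula. -/
theorem IsFT.parseval {f g f' g' : ℝ → ℂ} (h : IsFT f g) (h' : IsFT f' g') :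
    ∫ x, g x * g' x = ∫ x, f x * f' (-x) :=
  h.integral_mul h'.inversion

theorem IsFT.comp_neg {f g : ℝ → ℂ} (h : IsFT f g) :
    IsFT (fun x => f (-x)) fun x => g (-x) := by
  exact h.inversion.inversion

end

/-! ### Exponential polynomials on the half line and half-line transforms -/

/-- `(iy)^a / a! · e^{iμy}`. -/
def expPoly (μ : ℂ) (a : ℕ) (y : ℝ) : ℂ :=
  (Complex.I * y) ^ a / (a.factorial : ℂ) * Complex.exp (Complex.I * μ * y)

theorem continuous_expPoly (μ : ℂ) (a : ℕ) : Continuous (expPoly μ a) := by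
  unfold expPoly; fun_prop

theorem expPoly_zero_left (μ : ℂ) (y : ℝ) : expPoly μ 0 y = Complex.exp (Complex.I * μ * y) := by
  simp [expPoly]

theorem norm_exp_I_mul (μ : ℂ) (y : ℝ) :
    ‖Complex.exp (Complex.I * μ * y)‖ = Real.exp (-μ.im * y) := by
  rw [Complex.norm_exp]; congr 1; simp

/-- Half of the exponential decay is spent on the power, through `t ^ a / a! ≤ e ^ t` with `t = μ.im
/ 2 * y`. -/
theorem norm_expPoly_le {μ : ℂ} (hμ : 0 < μ.im) (a : ℕ) {y : ℝ} (hy : 0 < y) :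
    ‖expPoly μ a y‖ ≤ (2 / μ.im) ^ a * Real.exp (-(μ.im / 2) * y) := by
  rw [expPoly, norm_mul, norm_exp_I_mul, norm_div, norm_pow, norm_mul, Complex.norm_I, one_mul,
    Complex.norm_natCast, Complex.norm_real, Real.norm_of_nonneg hy.le]
  have h1 := Real.pow_div_factorial_le_exp (μ.im / 2 * y) (by positivity) a
  have h2 : y ^ a / (a.factorial : ℝ) ≤ (2 / μ.im) ^ a * Real.exp (μ.im / 2 * y) := by
    calc y ^ a / (a.factorial : ℝ)
        = (2 / μ.im) ^ a * ((μ.im / 2 * y) ^ a / (a.factorial : ℝ)) := by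
          rw [mul_pow, mul_div_assoc, ← mul_assoc, ← mul_pow]
          have : 2 / μ.im * (μ.im / 2) = 1 := by field_simp
          rw [this, one_pow, one_mul]
      _ ≤ _ := by gcongr
  calc _ ≤ (2 / μ.im) ^ a * Real.exp (μ.im / 2 * y) * Real.exp (-μ.im * y) := by gcongr
    _ = _ := by rw [mul_assoc, ← Real.exp_add]; congr 2; ring

theorem integrable_memLp_of_exp_bound {f : ℝ → ℂ} (hf : AEStronglyMeasurable f volume)
    {C c : ℝ} (hc : 0 < c) (h0 : ∀ y ≤ 0, f y = 0)
    (hb : ∀ y > 0, ‖f y‖ ≤ C * Real.exp (-c * y)) : Integrable f ∧ MemLp f 2 volume := by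
  have hg : Integrable ((Set.Ioi (0:ℝ)).indicator fun y => C * Real.exp (-c * y)) := by
    refine IntegrableOn.integrable_indicator ?_ measurableSet_Ioi
    exact (integrableOn_exp_mul_Ioi (by linarith) 0).const_mul C
  have hb' : ∀ y, ‖f y‖ ≤ (Set.Ioi (0:ℝ)).indicator (fun y => C * Real.exp (-c * y)) y := by
    intro y
    rcases le_or_gt y 0 with h | h
    · rw [h0 y h, Set.indicator_of_notMem (by simpa using h), norm_zero]
    · rw [Set.indicator_of_mem (by simpa using h)]; exact hb y h
  have hi : Integrable f := hg.mono' hf (Eventually.of_forall hb')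
  refine ⟨hi, (memLp_two_iff_integrable_sq_norm hf).2 ?_⟩
  refine (hi.norm.const_mul |C|).mono' (hf.norm.pow 2) (Eventually.of_forall fun y => ?_)
  rw [Real.norm_of_nonneg (by positivity), sq]
  refine mul_le_mul_of_nonneg_right ?_ (norm_nonneg _)
  rcases le_or_gt y 0 with h | h
  · rw [h0 y h, norm_zero]; positivity
  · refine (hb y h).trans ((mul_le_mul_of_nonneg_right (le_abs_self C) (Real.exp_pos _).le).trans ?_)
    refine mul_le_of_le_one_right (abs_nonneg _) ?_
    rw [Real.exp_le_one_iff]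
    nlinarith

theorem expPoly_ind_integrable_memLp {μ : ℂ} (hμ : 0 < μ.im) (a : ℕ) :
    Integrable ((Set.Ioi (0:ℝ)).indicator (expPoly μ a)) ∧
      MemLp ((Set.Ioi (0:ℝ)).indicator (expPoly μ a)) 2 volume := by
  refine integrable_memLp_of_exp_bound
    ((continuous_expPoly μ a).aestronglyMeasurable.indicator measurableSet_Ioi)
    (C := (2 / μ.im) ^ a) (c := μ.im / 2) (by linarith) ?_ ?_
  · intro y hy; rw [Set.indicator_of_notMem (by simpa using hy)]
  · intro y hy
    rw [Set.indicator_of_mem (by simpa using hy)]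
    exact norm_expPoly_le hμ a hy

theorem hasDerivAt_expPoly_zero (μ : ℂ) (y : ℝ) :
    HasDerivAt (expPoly μ 0) (Complex.I * (μ * expPoly μ 0 y)) y := by
  have h1 : HasDerivAt (fun y : ℝ => Complex.I * μ * (y : ℂ)) (Complex.I * μ * 1) y :=
    (Complex.ofRealCLM.hasDerivAt (x := y)).const_mul _
  have h2 := h1.cexp
  rw [funext (expPoly_zero_left μ)]
  refine h2.congr_deriv ?_
  ring

theorem hasDerivAt_expPoly_succ (μ : ℂ) (a : ℕ) (y : ℝ) :
    HasDerivAt (expPoly μ (a + 1))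
      (Complex.I * (expPoly μ a y + μ * expPoly μ (a + 1) y)) y := by
  have h1 : HasDerivAt (fun y : ℝ => Complex.I * μ * (y : ℂ)) (Complex.I * μ * 1) y :=
    (Complex.ofRealCLM.hasDerivAt (x := y)).const_mul _
  have h0 : HasDerivAt (fun y : ℝ => Complex.I * (y : ℂ)) (Complex.I * 1) y :=
    (Complex.ofRealCLM.hasDerivAt (x := y)).const_mul _
  have h2 := ((h0.pow (a + 1)).div_const ((a + 1).factorial : ℂ)).mul h1.cexp
  refine h2.congr_deriv ?_
  simp only [expPoly, Nat.factorial_succ, Nat.cast_mul, Nat.cast_add, Nat.cast_one,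
    Nat.add_sub_cancel, Pi.pow_apply]
  have hf : (a.factorial : ℂ) ≠ 0 := by exact_mod_cast a.factorial_ne_zero
  have hf' : (a : ℂ) + 1 ≠ 0 := by exact_mod_cast a.succ_ne_zero
  field_simp

theorem tendsto_expPoly {μ : ℂ} (hμ : 0 < μ.im) (a : ℕ) :
    Tendsto (expPoly μ a) atTop (𝓝 0) := by
  have h1 : Tendsto (fun y : ℝ => (2 / μ.im) ^ a * Real.exp (-(μ.im / 2) * y)) atTop (𝓝 0) := by
    rw [← mul_zero ((2 / μ.im) ^ a)]
    refine Tendsto.const_mul _ (Real.tendsto_exp_atBot.comp ?_)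
    exact tendsto_id.const_mul_atTop_of_neg (by linarith)
  refine squeeze_zero_norm' ?_ h1
  filter_upwards [eventually_gt_atTop 0] with y hy
  exact norm_expPoly_le hμ a hy

theorem integrableOn_expPoly {μ : ℂ} (hμ : 0 < μ.im) (a : ℕ) :
    IntegrableOn (expPoly μ a) (Set.Ioi 0) :=
  (integrable_indicator_iff measurableSet_Ioi).1 (expPoly_ind_integrable_memLp hμ a).1

/-- With `J_a` the integral, integrating the derivative of `expPoly w (a + 1)`, which vanishes at
both ends, gives `J_{a+1} = -J_a / w`. For `a = 0` the boundary value `1` at the origin gives `J_0 =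
i / w`. -/
theorem integral_expPoly {w : ℂ} (hw : 0 < w.im) (a : ℕ) :
    ∫ y in Set.Ioi (0:ℝ), expPoly w a y = Complex.I * (-1) ^ a * (w ^ (a + 1))⁻¹ := by
  have hw0 : w ≠ 0 := by rintro rfl; simp at hw
  induction a with
  | zero =>
    have h := integral_Ioi_of_hasDerivAt_of_tendsto (a := 0)
      (continuous_expPoly w 0).continuousWithinAt
      (fun y _ => hasDerivAt_expPoly_zero w y)
      (((integrableOn_expPoly hw 0).const_mul w).const_mul Complex.I) (tendsto_expPoly hw 0)
    rw [integral_const_mul, integral_const_mul] at h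
    simp [expPoly_zero_left] at h ⊢
    field_simp
    linear_combination (-Complex.I) * h +
      w * (∫ y in Set.Ioi (0:ℝ), Complex.exp (Complex.I * w * y)) * Complex.I_sq
  | succ a ih =>
    have h := integral_Ioi_of_hasDerivAt_of_tendsto (a := 0)
      (continuous_expPoly w (a + 1)).continuousWithinAt
      (fun y _ => hasDerivAt_expPoly_succ w a y)
      (((integrableOn_expPoly hw a).add ((integrableOn_expPoly hw (a + 1)).const_mul w)).const_mul
        Complex.I) (tendsto_expPoly hw (a + 1))
    rw [integral_const_mul, integral_add (integrableOn_expPoly hw a)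
      ((integrableOn_expPoly hw (a + 1)).const_mul w), integral_const_mul, ih] at h
    have h0 : expPoly w (a + 1) 0 = 0 := by simp [expPoly]
    rw [h0, sub_zero] at h
    have h1 := (mul_eq_zero.1 h).resolve_left Complex.I_ne_zero
    have h2 : ∫ y in Set.Ioi (0:ℝ), expPoly w (a + 1) y
        = -(Complex.I * (-1) ^ a * (w ^ (a + 1))⁻¹) / w := by
      rw [eq_div_iff hw0]
      linear_combination h1
    rw [h2, pow_succ (-1 : ℂ), pow_succ w (a + 1)]
    field_simp

theorem exp_mul_expPoly (ξ : ℝ) (μ : ℂ) (a : ℕ) (y : ℝ) :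
    Complex.exp (2 * Real.pi * Complex.I * ξ * y) * expPoly μ a y
      = expPoly (2 * Real.pi * ξ + μ) a y := by
  rw [expPoly, expPoly, mul_left_comm, ← Complex.exp_add]
  congr 2; ring

theorem isFT_expPoly {μ : ℂ} (hμ : 0 < μ.im) (a : ℕ) :
    IsFT ((Set.Ioi (0:ℝ)).indicator (expPoly μ a))
      fun ξ : ℝ => Complex.I * (-1) ^ a * ((2 * Real.pi * ξ + μ) ^ (a + 1))⁻¹ := by
  obtain ⟨h1, h2⟩ := expPoly_ind_integrable_memLp hμ a
  refine (isFT_of_integrable h1 h2).congr_right (Eventually.of_forall fun ξ => ?_)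
  simp only []
  rw [← integral_expPoly (w := 2 * Real.pi * ξ + μ) (by simpa using hμ) a,
    ← integral_indicator measurableSet_Ioi]
  refine integral_congr_ae (Eventually.of_forall fun y => ?_)
  by_cases hy : y ∈ Set.Ioi (0:ℝ)
  · simp only [Set.indicator_of_mem hy, exp_mul_expPoly]
  · simp only [Set.indicator_of_notMem hy, mul_zero]

theorem isFT_expPoly_neg {μ : ℂ} (hμ : 0 < μ.im) (a : ℕ) :
    IsFT (fun y => (Set.Ioi (0:ℝ)).indicator (expPoly μ a) (-y))
      fun ξ : ℝ => -Complex.I * ((2 * Real.pi * ξ - μ) ^ (a + 1))⁻¹ := by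
  refine (isFT_expPoly hμ a).comp_neg.congr_right (Eventually.of_forall fun ξ => ?_)
  simp only []
  rw [show (2 * Real.pi * ((-ξ : ℝ) : ℂ) + μ) = -1 * (2 * Real.pi * ξ - μ) by push_cast; ring,
    mul_pow, mul_inv, pow_succ]
  have : ((-1 : ℂ) ^ a) ≠ 0 := by simp
  field_simp

/-- Coefficient functional `∫_0^∞ k(z) (iz)^a / a! e^{iμz} dz`. -/
def coef (k : ℝ → ℂ) (μ : ℂ) (a : ℕ) : ℂ := ∫ z in Set.Ioi (0:ℝ), k z * expPoly μ a z

theorem coef_eq_integral (k : ℝ → ℂ) (μ : ℂ) (a : ℕ) :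
    coef k μ a = ∫ z, k z * (Set.Ioi (0:ℝ)).indicator (expPoly μ a) z := by
  rw [coef, ← integral_indicator measurableSet_Ioi]
  refine integral_congr_ae (Eventually.of_forall fun z => ?_)
  by_cases hz : z ∈ Set.Ioi (0:ℝ)
  · simp only [Set.indicator_of_mem hz]
  · simp only [Set.indicator_of_notMem hz, mul_zero]

theorem integrable_mul_expPoly {k : ℝ → ℂ} (hk : MemLp k 2 volume) {μ : ℂ} (hμ : 0 < μ.im)
    (a : ℕ) : IntegrableOn (fun z => k z * expPoly μ a z) (Set.Ioi 0) := by
  have := hk.integrable_mul (expPoly_ind_integrable_memLp hμ a).2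
  refine (this.integrableOn (s := Set.Ioi 0)).congr_fun (fun z hz => ?_) measurableSet_Ioi
  simp only [Pi.mul_apply, Set.indicator_of_mem hz]

/-- Parseval against a reflected exponential polynomial: a pole in the upper half plane on the
frequency side extracts a Laplace functional of `k`. -/
theorem IsFT.integral_mul_inv_pow {k n : ℝ → ℂ} (h : IsFT k n) {μ : ℂ} (hμ : 0 < μ.im) (a : ℕ) :
    ∫ ξ : ℝ, n ξ * ((2 * Real.pi * ξ - μ) ^ (a + 1))⁻¹ = Complex.I * coef k μ a := by
  have := h.parseval (isFT_expPoly_neg hμ a)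
  simp only [neg_neg] at this
  rw [← coef_eq_integral] at this
  rw [← this, ← integral_const_mul]
  refine integral_congr_ae (Eventually.of_forall fun ξ => ?_)
  linear_combination (n ξ * ((2 * Real.pi * ξ - μ) ^ (a + 1))⁻¹) * Complex.I_sq

theorem memLp_inv_pow {μ : ℂ} (hμ : 0 < μ.im) (a : ℕ) :
    MemLp (fun ξ : ℝ => ((2 * Real.pi * ξ - μ) ^ (a + 1))⁻¹) 2 volume := by
  have := (isFT_expPoly_neg hμ a).memLp_right.const_mul Complex.I
  refine (memLp_congr_ae (Eventually.of_forall fun ξ => ?_)).1 this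
  linear_combination (-((2 * Real.pi * ξ - μ) ^ (a + 1))⁻¹) * Complex.I_sq

/-- Two functions supported on the positive half line have orthogonal transforms. -/
theorem IsFT.integral_mul_eq_zero {k n φ g : ℝ → ℂ} (h : IsFT k n) (h' : IsFT φ g)
    (hk : ∀ y ≤ 0, k y = 0) (hφ : ∀ y ≤ 0, φ y = 0) : ∫ ξ, n ξ * g ξ = 0 := by
  rw [h.parseval h']
  refine (integral_congr_ae (Eventually.of_forall fun x => ?_)).trans (integral_zero ℝ ℂ)
  rcases le_or_gt x 0 with hx | hx
  · simp [hk x hx]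
  · simp [hφ (-x) (by linarith)]

theorem two_pi_mul_integral (f : ℝ → ℂ) :
    ∫ ξ : ℝ, f (2 * Real.pi * ξ) = (2 * Real.pi : ℂ)⁻¹ * ∫ x : ℝ, f x := by
  rw [Measure.integral_comp_mul_left f (2 * Real.pi), abs_of_pos (by positivity)]
  rw [Complex.real_smul]; push_cast; rfl

theorem IsHardy.memLp {h : ℂ → ℂ} (hh : IsHardy h) :
    MemLp (fun ξ : ℝ => h (2 * Real.pi * ξ)) 2 volume := by
  obtain ⟨C, hC⟩ := hh.bound
  have hm : Continuous fun ξ : ℝ => h (2 * Real.pi * ξ) := by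
    have := hh.continuous_real.comp (continuous_const.mul continuous_id :
      Continuous fun ξ : ℝ => 2 * Real.pi * ξ)
    refine this.congr fun ξ => ?_
    simp
  rw [memLp_two_iff_integrable_sq_norm hm.aestronglyMeasurable]
  have hi : Integrable fun ξ : ℝ => C ^ 2 * ((1 + ‖2 * Real.pi * ξ‖) ^ 2)⁻¹ :=
    (integrable_inv_one_add_norm_sq.comp_mul_left' (by positivity : (2 * Real.pi) ≠ 0)).const_mul _
  refine hi.mono' (hm.norm.pow 2).aestronglyMeasurable (Eventually.of_forall fun ξ => ?_)
  rw [Real.norm_of_nonneg (by positivity)]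
  have := hC (2 * Real.pi * ξ) (by simp)
  calc ‖h (2 * Real.pi * ξ)‖ ^ 2 ≤ (C / (1 + ‖(2 * Real.pi * ξ : ℂ)‖)) ^ 2 := by gcongr
    _ = _ := by
      rw [div_pow, div_eq_mul_inv]
      congr 4
      rw [← Complex.norm_real]; push_cast; rfl

/-- A half-line function whose Laplace transform vanishes is zero. -/
theorem ae_eq_zero_of_coef_eq_zero {w : ℝ → ℂ} (hw : MemLp w 2 volume) (h0 : ∀ y ≤ 0, w y = 0)
    (h : ∀ μ : ℂ, 0 < μ.im → coef w μ 0 = 0) : w =ᵐ[volume] fun _ => 0 := by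
  -- The damping factor `e^{-y}` makes `w` integrable. The transform of the damped function at `ξ`
  -- is the Laplace functional of `w` at `2πξ + i`, so it vanishes and injectivity on `L²` applies.
  set f : ℝ → ℂ := fun y => w y * (Set.Ioi (0:ℝ)).indicator (expPoly Complex.I 0) y with hf
  have hI : 0 < Complex.I.im := by simp
  have hfi : Integrable f := hw.integrable_mul (expPoly_ind_integrable_memLp hI 0).2
  have hf2 : MemLp f 2 volume := by
    refine hw.mono hfi.aestronglyMeasurable (Eventually.of_forall fun y => ?_)
    rw [hf, norm_mul]
    refine mul_le_of_le_one_right (norm_nonneg _) ?_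
    by_cases hy : y ∈ Set.Ioi (0:ℝ)
    · rw [Set.indicator_of_mem hy, expPoly_zero_left, norm_exp_I_mul, Real.exp_le_one_iff]
      simpa using le_of_lt hy
    · rw [Set.indicator_of_notMem hy]; simp
  have h1 := (isFT_of_integrable hfi hf2).congr_right (g' := fun _ => 0)
    (Eventually.of_forall fun ξ => by
      have := h (2 * Real.pi * ξ + Complex.I) (by simp)
      rw [coef_eq_integral] at this
      refine Eq.trans (integral_congr_ae (Eventually.of_forall fun y => ?_)) this
      simp only [hf]
      by_cases hy : y ∈ Set.Ioi (0:ℝ)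
      · simp only [Set.indicator_of_mem hy]
        rw [mul_left_comm, exp_mul_expPoly]
      · simp only [Set.indicator_of_notMem hy, mul_zero])
  filter_upwards [h1.eq_zero] with y hy
  rcases le_or_gt y 0 with h | h
  · exact h0 y h
  · simp only [hf] at hy
    rw [Set.indicator_of_mem (by simpa using h), expPoly_zero_left] at hy
    exact (mul_eq_zero.1 hy).resolve_right (Complex.exp_ne_zero _)

/-- Functions of Hardy type are transforms of functions supported on the half line. -/
theorem IsHardy.exists_isFT {h : ℂ → ℂ} (hh : IsHardy h) :
    ∃ φ : ℝ → ℂ, (∀ y ≤ 0, φ y = 0) ∧ IsFT φ (fun ξ => h (2 * Real.pi * ξ)) ∧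
      ∀ μ : ℂ, 0 < μ.im → coef φ μ 0 = h μ := by
  obtain ⟨φ, hφ⟩ := exists_isFT' hh.memLp
  have hneg : MemLp (fun y => φ (-y)) 2 volume := hφ.comp_neg.memLp_left
  -- The part of `φ` on the negative half line has Laplace transform at `μ` equal to a pairing of
  -- `h` with a multiple of `1 / (λ + μ)`. That pole lies below the real line, so the pairing is
  -- zero.
  have hz : (Set.Ioi (0:ℝ)).indicator (fun y => φ (-y)) =ᵐ[volume] fun _ => 0 := by
    refine ae_eq_zero_of_coef_eq_zero (hneg.indicator measurableSet_Ioi) (fun y hy => ?_)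
      fun μ hμ => ?_
    · rw [Set.indicator_of_notMem (by simpa using hy)]
    · have e1 := hφ.parseval (isFT_expPoly hμ 0)
      have e2 : ∫ ξ : ℝ, h (2 * Real.pi * ξ) *
          (Complex.I * (-1) ^ 0 * ((2 * Real.pi * ξ + μ) ^ (0 + 1))⁻¹) = 0 := by
        have e3 := hh.integrable_mul_inv_sub (μ := -μ) (by simpa using hμ)
        have e4 := two_pi_mul_integral fun x => h x * ((x : ℂ) - -μ)⁻¹
        rw [e3, mul_zero] at e4
        rw [← mul_zero Complex.I, ← e4, ← integral_const_mul]
        refine integral_congr_ae (Eventually.of_forall fun ξ => ?_)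
        simp only [Complex.ofReal_mul, Complex.ofReal_ofNat, sub_neg_eq_add]
        ring
      rw [e2] at e1
      rw [coef, e1, ← integral_indicator measurableSet_Ioi, ← integral_neg_eq_self]
      refine integral_congr_ae (Eventually.of_forall fun y => ?_)
      by_cases hy : -y ∈ Set.Ioi (0:ℝ)
      · simp only [Set.indicator_of_mem hy, neg_neg]
      · simp only [Set.indicator_of_notMem hy, mul_zero]
  have hz' : (Set.Ioi (0:ℝ)).indicator φ =ᵐ[volume] φ := by
    have h1 := (Measure.measurePreserving_neg (volume : Measure ℝ)).quasiMeasurePreserving.ae_eq_comp hz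
    have h2 : ∀ᵐ y : ℝ, y ≠ 0 := by simp [ae_iff]
    filter_upwards [h1, h2] with y hy hy0
    rcases le_or_gt y 0 with h | h
    · have : -y ∈ Set.Ioi (0:ℝ) := by
        have := lt_of_le_of_ne h hy0
        simpa using this
      simp only [Function.comp, Set.indicator_of_mem this, neg_neg] at hy
      rw [hy, Set.indicator_of_notMem (by simpa using h)]
    · rw [Set.indicator_of_mem (by simpa using h)]
  have hφ' := hφ.congr_left hz'.symm
  refine ⟨_, fun y hy => Set.indicator_of_notMem (by simpa using hy) _, hφ', fun μ hμ => ?_⟩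
  have e1 := hφ'.integral_mul_inv_pow hμ 0
  have e2 := two_pi_mul_integral fun x => h x * ((x : ℂ) - μ)⁻¹
  rw [hh.cauchy hμ] at e2
  have e3 : Complex.I * coef ((Set.Ioi (0:ℝ)).indicator φ) μ 0 = Complex.I * h μ := by
    rw [← e1]
    refine Eq.trans ?_ (e2.trans ?_)
    · refine integral_congr_ae (Eventually.of_forall fun ξ => ?_)
      simp
    · have : (Real.pi : ℂ) ≠ 0 := by exact_mod_cast Real.pi_ne_zero
      field_simp
  exact mul_left_cancel₀ Complex.I_ne_zero e3

/-- Taylor expansion of a half-line transform with remainder estimate near `μ`. -/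
theorem coef_taylor {φ : ℝ → ℂ} (hφ : MemLp φ 2 volume) {μ : ℂ} (hμ : 0 < μ.im) (n : ℕ) :
    (fun l => coef φ l 0 - ∑ a ∈ Finset.range n, coef φ μ a * (l - μ) ^ a)
      =O[𝓝 μ] fun l => (l - μ) ^ n := by
  -- Decay at half the rate of `μ` dominates the Taylor remainder uniformly: for `‖l - μ‖ < μ.im /
  -- 2` the growth `e^{‖l - μ‖ z}` is absorbed by the other half.
  set ν : ℂ := Complex.I * ((μ.im / 2 : ℝ) : ℂ) with hν
  have hνim : ν.im = μ.im / 2 := by simp [hν]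
  have hν0 : 0 < ν.im := by rw [hνim]; linarith
  have hint : IntegrableOn (fun z => (n.factorial : ℝ) * ‖φ z * expPoly ν n z‖) (Set.Ioi 0) :=
    ((integrable_mul_expPoly hφ hν0 n).norm).const_mul _
  refine IsBigO.of_bound (∫ z in Set.Ioi (0:ℝ), (n.factorial : ℝ) * ‖φ z * expPoly ν n z‖) ?_
  filter_upwards [Metric.ball_mem_nhds μ (by linarith : 0 < μ.im / 2)] with l hl
  have hl' : ‖l - μ‖ < μ.im / 2 := by simpa [dist_eq_norm] using hl
  have him : 0 < l.im := by
    have := (Complex.abs_im_le_norm (l - μ)).trans_lt hl'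
    rw [Complex.sub_im, abs_lt] at this
    linarith
  have e : coef φ l 0 - ∑ a ∈ Finset.range n, coef φ μ a * (l - μ) ^ a
      = ∫ z in Set.Ioi (0:ℝ), φ z * (expPoly l 0 z
          - ∑ a ∈ Finset.range n, expPoly μ a z * (l - μ) ^ a) := by
    simp_rw [coef, ← integral_mul_const]
    rw [← integral_finsetSum _ fun a _ => (integrable_mul_expPoly hφ hμ a).mul_const _,
      ← integral_sub (integrable_mul_expPoly hφ him 0)
        (integrable_finsetSum _ fun a _ => (integrable_mul_expPoly hφ hμ a).mul_const _)]
    refine integral_congr_ae (Eventually.of_forall fun z => ?_)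
    simp only []
    rw [mul_sub, Finset.mul_sum]
    congr 1
    exact Finset.sum_congr rfl fun a _ => by ring
  rw [e, mul_comm, ← integral_const_mul]
  refine norm_integral_le_of_norm_le (hint.const_mul _) ?_
  filter_upwards [ae_restrict_mem measurableSet_Ioi] with z hz
  have hz0 : 0 < z := hz
  have e2 : expPoly l 0 z - ∑ a ∈ Finset.range n, expPoly μ a z * (l - μ) ^ a
      = Complex.exp (Complex.I * μ * z) * (Complex.exp (Complex.I * (l - μ) * z)
        - ∑ a ∈ Finset.range n, (Complex.I * (l - μ) * z) ^ a / (a.factorial : ℂ)) := by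
    rw [mul_sub, ← Complex.exp_add, Finset.mul_sum, expPoly_zero_left]
    congr 1
    · congr 1; ring
    · refine Finset.sum_congr rfl fun a _ => ?_
      rw [expPoly, show Complex.I * (l - μ) * (z : ℂ) = Complex.I * z * (l - μ) by ring,
        mul_pow (Complex.I * (z : ℂ)) (l - μ)]
      ring
  rw [e2, norm_mul, norm_mul, norm_mul]
  have h3 := Complex.norm_exp_sub_sum_le_norm_mul_exp (Complex.I * (l - μ) * z) n
  have h4 : ‖Complex.I * (l - μ) * (z : ℂ)‖ = ‖l - μ‖ * z := by
    rw [norm_mul, norm_mul, Complex.norm_I, one_mul, Complex.norm_real, Real.norm_of_nonneg hz0.le]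
  rw [h4] at h3
  have h5 : ‖expPoly ν n z‖ = z ^ n / (n.factorial : ℝ) * Real.exp (-(μ.im / 2) * z) := by
    rw [expPoly, norm_mul, norm_exp_I_mul, hνim, norm_div, norm_pow, norm_mul, Complex.norm_I,
      one_mul, Complex.norm_natCast, Complex.norm_real, Real.norm_of_nonneg hz0.le]
  rw [h5, norm_exp_I_mul, norm_pow]
  have hf : (n.factorial : ℝ) ≠ 0 := by exact_mod_cast n.factorial_ne_zero
  have h6 : Real.exp (-μ.im * z) * Real.exp (‖l - μ‖ * z) ≤ Real.exp (-(μ.im / 2) * z) := by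
    rw [← Real.exp_add]
    apply Real.exp_le_exp.2
    nlinarith
  calc _ ≤ ‖φ z‖ * (Real.exp (-μ.im * z) * ((‖l - μ‖ * z) ^ n * Real.exp (‖l - μ‖ * z))) := by
        gcongr
    _ = ‖φ z‖ * (‖l - μ‖ * z) ^ n * (Real.exp (-μ.im * z) * Real.exp (‖l - μ‖ * z)) := by ring
    _ ≤ ‖φ z‖ * (‖l - μ‖ * z) ^ n * Real.exp (-(μ.im / 2) * z) := by gcongr
    _ = _ := by field_simp; ring

section

/-! ### Pole data -/

/-- A finite family of points `λ_i`, orders `κ_i` and coefficients `c_i`, standing for the kernel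
`∑ c_i (iy)^{κ_i}/κ_i! e^{iλ_i y}` and for the principal part `∑ c_i (λ - λ_i)^{-κ_i-1}`. -/
structure PoleFamily where
  ι : Type
  fin : Fintype ι
  loc : ι → ℂ
  ord : ι → ℕ
  coeff : ι → ℂ

attribute [instance] PoleFamily.fin

namespace PoleFamily

variable (p : PoleFamily)

def kernel (y : ℝ) : ℂ := ∑ i, p.coeff i * expPoly (p.loc i) (p.ord i) y

def principal (l : ℂ) : ℂ := ∑ i, p.coeff i * ((l - p.loc i) ^ (p.ord i + 1))⁻¹

/-- The transform of `y ↦ ∫_0^∞ φ(z) D(z + y) dz`, where `D` is the kernel of the family. -/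
def paired (φ : ℝ → ℂ) (l : ℂ) : ℂ :=
  ∑ i, p.coeff i * ∑ a ∈ Finset.range (p.ord i + 1),
    coef φ (p.loc i) a * (-Complex.I * ((l - p.loc i) ^ (p.ord i - a + 1))⁻¹)

/-- The value `∫_0^∞ φ(z) D(z) dz`. -/
def pairedZero (φ : ℝ → ℂ) : ℂ := ∑ i, p.coeff i * coef φ (p.loc i) (p.ord i)

end PoleFamily

/-- The binomial theorem for divided powers. It makes the bound-state kernel `D(z + y)` a finite sum
of products, so its integrals reduce to finitely many values of `coef`. -/
theorem expPoly_add (μ : ℂ) (a : ℕ) (z y : ℝ) :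
    expPoly μ a (z + y)
      = ∑ b ∈ Finset.range (a + 1), expPoly μ (a - b) z * expPoly μ b y := by
  have e1 : Complex.exp (Complex.I * μ * ((z + y : ℝ) : ℂ))
      = Complex.exp (Complex.I * μ * z) * Complex.exp (Complex.I * μ * y) := by
    rw [← Complex.exp_add]; congr 1; push_cast; ring
  rw [expPoly, e1, show Complex.I * ((z + y : ℝ) : ℂ) = Complex.I * y + Complex.I * z by
    push_cast; ring, add_pow, Finset.sum_div, Finset.sum_mul]
  refine Finset.sum_congr rfl fun b hb => ?_
  have hb' : b ≤ a := Nat.lt_succ_iff.1 (Finset.mem_range.1 hb)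
  have h := Nat.choose_mul_factorial_mul_factorial hb'
  have h' : (a.choose b : ℂ) * b.factorial * (a - b).factorial = a.factorial := by exact_mod_cast h
  have f1 : (a.factorial : ℂ) ≠ 0 := by exact_mod_cast a.factorial_ne_zero
  have f2 : (b.factorial : ℂ) ≠ 0 := by exact_mod_cast b.factorial_ne_zero
  have f3 : ((a - b).factorial : ℂ) ≠ 0 := by exact_mod_cast (a - b).factorial_ne_zero
  rw [expPoly, expPoly, ← h']
  have f4 : (a.choose b : ℂ) ≠ 0 := by
    exact_mod_cast (Nat.choose_pos hb').ne'
  field_simp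

/-- The continuous decaying functions used as reflection coefficients. -/
structure IsReflection (ρ : ℝ → ℂ) : Prop where
  cont : Continuous ρ
  bound : ∃ M, ∀ ξ, ‖ρ ξ‖ ≤ M / (1 + ‖ξ‖) ^ 2

namespace IsReflection

variable {ρ : ℝ → ℂ}

theorem integrable (h : IsReflection ρ) : Integrable ρ := by
  obtain ⟨M, hM⟩ := h.bound
  refine (integrable_inv_one_add_norm_sq.const_mul M).mono' h.cont.aestronglyMeasurable
    (Eventually.of_forall fun x => ?_)
  rw [← div_eq_mul_inv]; exact hM x

theorem exists_norm_le (h : IsReflection ρ) : ∃ M, ∀ ξ, ‖ρ ξ‖ ≤ M := by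
  obtain ⟨M, hM⟩ := h.bound
  have h0 : 0 ≤ M := by simpa using (norm_nonneg _).trans (hM 0)
  refine ⟨M, fun ξ => (hM ξ).trans (div_le_self h0 ?_)⟩
  exact one_le_pow₀ (by linarith [norm_nonneg ξ])

theorem memLp_mul (h : IsReflection ρ) {n : ℝ → ℂ} (hn : MemLp n 2 volume) :
    MemLp (fun ξ => ρ ξ * n ξ) 2 volume := by
  obtain ⟨M, hM⟩ := h.exists_norm_le
  refine hn.of_le_mul (c := M) (h.cont.aestronglyMeasurable.mul hn.1)
    (Eventually.of_forall fun ξ => ?_)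
  rw [norm_mul]
  gcongr
  exact hM ξ

theorem memLp (h : IsReflection ρ) : MemLp ρ 2 volume := by
  obtain ⟨M, hM⟩ := h.exists_norm_le
  rw [memLp_two_iff_integrable_sq_norm h.cont.aestronglyMeasurable]
  refine (h.integrable.norm.const_mul M).mono' (h.cont.norm.pow 2).aestronglyMeasurable
    (Eventually.of_forall fun ξ => ?_)
  rw [Real.norm_of_nonneg (by positivity), sq]
  exact mul_le_mul_of_nonneg_right (hM ξ) (norm_nonneg _)

theorem modulate (h : IsReflection ρ) (y : ℝ) :
    IsReflection fun ξ : ℝ => Complex.exp (2 * Real.pi * Complex.I * ξ * y) * ρ ξ := by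
  obtain ⟨M, hM⟩ := h.bound
  refine ⟨by have := h.cont; fun_prop, M, fun ξ => ?_⟩
  rw [norm_mul, show (2 * Real.pi * Complex.I * ξ * y : ℂ)
    = ((2 * Real.pi * ξ * y : ℝ) : ℂ) * Complex.I by push_cast; ring,
    Complex.norm_exp_ofReal_mul_I, one_mul]
  exact hM ξ

end IsReflection

/-- The transform `∫ ρ(ξ) e^{2πiξy} dξ`. -/
def invFour (ρ : ℝ → ℂ) (y : ℝ) : ℂ :=
  ∫ ξ : ℝ, Complex.exp (2 * Real.pi * Complex.I * y * ξ) * ρ ξ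

theorem IsReflection.isFT {ρ : ℝ → ℂ} (h : IsReflection ρ) : IsFT ρ (invFour ρ) :=
  isFT_of_integrable h.integrable h.memLp

theorem setIntegral_eq_of_zero {k f : ℝ → ℂ} (hk0 : ∀ y ≤ 0, k y = 0) :
    ∫ z in Set.Ioi (0:ℝ), k z * f z = ∫ z, k z * f z := by
  rw [← integral_indicator measurableSet_Ioi]
  refine integral_congr_ae (Eventually.of_forall fun z => ?_)
  by_cases hz : z ∈ Set.Ioi (0:ℝ)
  · simp only [Set.indicator_of_mem hz]
  · simp only [Set.indicator_of_notMem hz]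
    rw [hk0 z (by simpa using hz), zero_mul]

/-- The multiplication formula, applied to `ρ` modulated by `e^{2πiξy}`, whose transform is the
translate of `invFour ρ` by `y`. -/
theorem IsReflection.integral_shift {ρ k n : ℝ → ℂ} (h : IsReflection ρ) (hk : IsFT k n)
    (hk0 : ∀ y ≤ 0, k y = 0) (y : ℝ) :
    ∫ z in Set.Ioi (0:ℝ), k z * invFour ρ (z + y) = invFour (fun ξ => ρ ξ * n ξ) y := by
  rw [setIntegral_eq_of_zero hk0]
  have := hk.integral_mul (h.modulate y).isFT
  rw [invFour]
  refine Eq.trans (integral_congr_ae (Eventually.of_forall fun z => ?_)) (this.symm.trans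
    (integral_congr_ae (Eventually.of_forall fun ξ => ?_)))
  · simp only [invFour]
    congr 1
    refine integral_congr_ae (Eventually.of_forall fun ξ => ?_)
    simp only []
    rw [← mul_assoc, ← Complex.exp_add]
    congr 2; push_cast; ring
  · simp only []
    rw [show (2 * Real.pi * Complex.I * ξ * y : ℂ) = 2 * Real.pi * Complex.I * y * ξ by ring]
    ring

theorem PoleFamily.integral_kernel_shift (p : PoleFamily) (hp : ∀ i, 0 < (p.loc i).im)
    {k : ℝ → ℂ} (hk : MemLp k 2 volume) (y : ℝ) :
    IntegrableOn (fun z => k z * p.kernel (z + y)) (Set.Ioi 0) ∧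
    ∫ z in Set.Ioi (0:ℝ), k z * p.kernel (z + y) = ∑ i, p.coeff i *
      ∑ b ∈ Finset.range (p.ord i + 1),
        coef k (p.loc i) (p.ord i - b) * expPoly (p.loc i) b y := by
  have e : ∀ z, k z * p.kernel (z + y) = ∑ i, p.coeff i * ∑ b ∈ Finset.range (p.ord i + 1),
      (k z * expPoly (p.loc i) (p.ord i - b) z) * expPoly (p.loc i) b y := by
    intro z
    rw [kernel, Finset.mul_sum]
    refine Finset.sum_congr rfl fun i _ => ?_
    rw [expPoly_add, mul_left_comm, Finset.mul_sum]
    congr 1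
    exact Finset.sum_congr rfl fun b _ => by ring
  have hi : ∀ i b, IntegrableOn (fun z => (k z * expPoly (p.loc i) (p.ord i - b) z) *
      expPoly (p.loc i) b y) (Set.Ioi 0) := fun i b =>
    (integrable_mul_expPoly hk (hp i) _).mul_const _
  have hi' : ∀ i, IntegrableOn (fun z => p.coeff i * ∑ b ∈ Finset.range (p.ord i + 1),
      (k z * expPoly (p.loc i) (p.ord i - b) z) * expPoly (p.loc i) b y) (Set.Ioi 0) := fun i =>
    (integrable_finsetSum _ fun b _ => hi i b).const_mul _
  simp_rw [e]
  refine ⟨integrable_finsetSum _ fun i _ => hi' i, ?_⟩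
  rw [integral_finsetSum _ fun i _ => hi' i]
  refine Finset.sum_congr rfl fun i _ => ?_
  rw [integral_const_mul, integral_finsetSum _ fun b _ => hi i b]
  congr 1
  refine Finset.sum_congr rfl fun b _ => ?_
  rw [integral_mul_const, coef]

/-- The integral in the Marchenko equation, with the transform inserted. -/
theorem integral_marchenko_kernel {ρ k n : ℝ → ℂ} (h : IsReflection ρ) (p : PoleFamily)
    (hp : ∀ i, 0 < (p.loc i).im) (hk : IsFT k n) (hk0 : ∀ y ≤ 0, k y = 0) (y : ℝ) :
    ∫ z in Set.Ioi (0:ℝ), k z * (invFour ρ (z + y) + p.kernel (z + y))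
      = invFour (fun ξ => ρ ξ * n ξ) y + ∑ i, p.coeff i *
      ∑ b ∈ Finset.range (p.ord i + 1),
        coef k (p.loc i) (p.ord i - b) * expPoly (p.loc i) b y := by
  obtain ⟨i1, e1⟩ := p.integral_kernel_shift hp hk.memLp_left y
  have hm : MemLp (fun z => invFour ρ (z + y)) 2 volume :=
    h.isFT.memLp_right.comp_measurePreserving (measurePreserving_add_right volume y)
  have i2 : IntegrableOn (fun z => k z * invFour ρ (z + y)) (Set.Ioi 0) :=
    (hk.memLp_left.integrable_mul hm).integrableOn
  simp_rw [mul_add]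
  rw [integral_add i2 i1, e1, h.integral_shift hk hk0]

theorem integrable_mul_expPoly_of_zero {φ : ℝ → ℂ} (hφ : MemLp φ 2 volume)
    (hφ0 : ∀ y ≤ 0, φ y = 0) {μ : ℂ} (hμ : 0 < μ.im) (a : ℕ) :
    Integrable fun y => φ y * expPoly μ a y := by
  have := hφ.integrable_mul (expPoly_ind_integrable_memLp hμ a).2
  refine this.congr (Eventually.of_forall fun z => ?_)
  simp only [Pi.mul_apply]
  by_cases hz : z ∈ Set.Ioi (0:ℝ)
  · simp only [Set.indicator_of_mem hz]
  · rw [hφ0 z (by simpa using hz), zero_mul, zero_mul]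

theorem integral_add_five {f₁ f₂ f₃ f₄ f₅ : ℝ → ℂ} (h₁ : Integrable f₁) (h₂ : Integrable f₂)
    (h₃ : Integrable f₃) (h₄ : Integrable f₄) (h₅ : Integrable f₅) :
    ∫ x, (f₁ x + f₂ x + f₃ x + f₄ x + f₅ x)
      = (∫ x, f₁ x) + (∫ x, f₂ x) + (∫ x, f₃ x) + (∫ x, f₄ x) + ∫ x, f₅ x := by
  have a₁ := integral_add h₁ h₂
  have a₂ := integral_add (h₁.add h₂) h₃
  have a₃ := integral_add ((h₁.add h₂).add h₃) h₄
  have a₄ := integral_add (((h₁.add h₂).add h₃).add h₄) h₅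
  simp only [Pi.add_apply] at a₁ a₂ a₃ a₄
  rw [a₄, a₃, a₂, a₁]

/-- One Marchenko equation tested against a half-line function `φ` with transform `g`. -/
theorem marchenko_weak {ρ k n k' n' φ g : ℝ → ℂ} (h : IsReflection ρ) (p : PoleFamily)
    (hp : ∀ i, 0 < (p.loc i).im) (hk : IsFT k n) (hk0 : ∀ y ≤ 0, k y = 0) (hk' : IsFT k' n')
    (hφ : IsFT φ g) (hφ0 : ∀ y ≤ 0, φ y = 0) (s : ℂ)
    (heq : ∀ y > 0, k' y + s * (invFour ρ y + p.kernel y) +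
      ∫ z in Set.Ioi (0:ℝ), k z * (invFour ρ (z + y) + p.kernel (z + y)) = 0) :
    (∫ ξ, g ξ * n' (-ξ)) + s * (∫ ξ, ρ ξ * g ξ) + (∫ ξ, (ρ ξ * n ξ) * g ξ)
      + s * p.pairedZero φ + ∫ ξ : ℝ, n ξ * p.paired φ (2 * Real.pi * ξ) = 0 := by
  set D : ℝ → ℂ := fun y => ∑ i, p.coeff i * ∑ b ∈ Finset.range (p.ord i + 1),
        coef k (p.loc i) (p.ord i - b) * expPoly (p.loc i) b y with hD
  have hρn : MemLp (fun ξ => ρ ξ * n ξ) 2 volume := h.memLp_mul hk.memLp_right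
  have hFTn : IsFT (fun ξ => ρ ξ * n ξ) (invFour fun ξ => ρ ξ * n ξ) :=
    isFT_of_integrable (h.memLp.integrable_mul hk.memLp_right) hρn
  -- The equation is known only for `y > 0`, but `φ` vanishes on the rest of the line, so after
  -- multiplication it holds everywhere and can be integrated over the whole line.
  have pt : ∀ y, φ y * k' y + s * (φ y * invFour ρ y) + s * (φ y * p.kernel y)
      + φ y * invFour (fun ξ => ρ ξ * n ξ) y + φ y * D y = 0 := by
    intro y
    rcases le_or_gt y 0 with hy | hy
    · rw [hφ0 y hy]; ring
    · have := heq y hy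
      rw [integral_marchenko_kernel h p hp hk hk0] at this
      linear_combination φ y * this
  have j1 : Integrable fun y => φ y * k' y := hφ.memLp_left.integrable_mul hk'.memLp_left
  have j2 : Integrable fun y => φ y * invFour ρ y := hφ.memLp_left.integrable_mul h.isFT.memLp_right
  have j3 : Integrable fun y => φ y * p.kernel y := by
    simp only [PoleFamily.kernel, Finset.mul_sum]
    refine integrable_finsetSum _ fun i _ => ?_
    refine ((integrable_mul_expPoly_of_zero hφ.memLp_left hφ0 (hp i) (p.ord i)).const_mul
      (p.coeff i)).congr (Eventually.of_forall fun y => ?_)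
    simp only []; ring
  have j4 : Integrable fun y => φ y * invFour (fun ξ => ρ ξ * n ξ) y :=
    hφ.memLp_left.integrable_mul hFTn.memLp_right
  have eD : ∀ y, φ y * D y = ∑ i, p.coeff i * ∑ b ∈ Finset.range (p.ord i + 1),
      coef k (p.loc i) (p.ord i - b) * (φ y * expPoly (p.loc i) b y) := by
    intro y
    simp only [hD]
    rw [Finset.mul_sum]
    refine Finset.sum_congr rfl fun i _ => ?_
    rw [mul_left_comm, Finset.mul_sum]
    congr 1
    exact Finset.sum_congr rfl fun b _ => by ring
  have jb : ∀ i b, Integrable fun y => coef k (p.loc i) (p.ord i - b) *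
      (φ y * expPoly (p.loc i) b y) := fun i b =>
    (integrable_mul_expPoly_of_zero hφ.memLp_left hφ0 (hp i) b).const_mul _
  have jb' : ∀ i, Integrable fun y => p.coeff i * ∑ b ∈ Finset.range (p.ord i + 1),
      coef k (p.loc i) (p.ord i - b) * (φ y * expPoly (p.loc i) b y) := fun i =>
    (integrable_finsetSum _ fun b _ => jb i b).const_mul _
  have j5 : Integrable fun y => φ y * D y := by
    simp_rw [eD]; exact integrable_finsetSum _ fun i _ => jb' i
  have v1 : ∫ y, φ y * k' y = ∫ ξ, g ξ * n' (-ξ) := by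
    have := hφ.parseval hk'.comp_neg
    simp only [neg_neg] at this
    exact this.symm
  have v2 : ∫ y, φ y * invFour ρ y = ∫ ξ, ρ ξ * g ξ := by
    rw [← h.isFT.integral_mul hφ]
    exact integral_congr_ae (Eventually.of_forall fun y => mul_comm _ _)
  have v4 : ∫ y, φ y * invFour (fun ξ => ρ ξ * n ξ) y = ∫ ξ, (ρ ξ * n ξ) * g ξ := by
    rw [← hFTn.integral_mul hφ]
    exact integral_congr_ae (Eventually.of_forall fun y => mul_comm _ _)
  have v3 : ∫ y, φ y * p.kernel y = p.pairedZero φ := by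
    simp only [PoleFamily.kernel, Finset.mul_sum, PoleFamily.pairedZero]
    rw [integral_finsetSum]
    · refine Finset.sum_congr rfl fun i _ => ?_
      rw [coef, setIntegral_eq_of_zero hφ0, ← integral_const_mul]
      exact integral_congr_ae (Eventually.of_forall fun y => by simp only []; ring)
    · intro i _
      refine ((integrable_mul_expPoly_of_zero hφ.memLp_left hφ0 (hp i) (p.ord i)).const_mul
        (p.coeff i)).congr (Eventually.of_forall fun y => ?_)
      simp only []; ring
  -- The bound-state term is bilinear in the values `coef k` and `coef φ`. Each `coef k` is traded
  -- back for an integral of `n` against a power of `1 / (λ - λ_i)`, which assembles `paired`.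
  have v5 : ∫ y, φ y * D y = ∫ ξ : ℝ, n ξ * p.paired φ (2 * Real.pi * ξ) := by
    have l1 : ∫ y, φ y * D y = ∑ i, p.coeff i * ∑ b ∈ Finset.range (p.ord i + 1),
        coef k (p.loc i) (p.ord i - b) * coef φ (p.loc i) b := by
      simp_rw [eD]
      rw [integral_finsetSum _ fun i _ => jb' i]
      refine Finset.sum_congr rfl fun i _ => ?_
      rw [integral_const_mul, integral_finsetSum _ fun b _ => jb i b]
      congr 1
      refine Finset.sum_congr rfl fun b _ => ?_
      rw [integral_const_mul, coef, coef, setIntegral_eq_of_zero hφ0]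
    have ji : ∀ i a, Integrable fun ξ : ℝ => coef φ (p.loc i) a * (-Complex.I *
        (n ξ * ((2 * Real.pi * ξ - p.loc i) ^ (p.ord i - a + 1))⁻¹)) := fun i a =>
      ((hk.memLp_right.integrable_mul (memLp_inv_pow (hp i) (p.ord i - a))).const_mul _).const_mul _
    have l2 : ∀ ξ : ℝ, n ξ * p.paired φ (2 * Real.pi * ξ) = ∑ i, p.coeff i *
        ∑ a ∈ Finset.range (p.ord i + 1), coef φ (p.loc i) a * (-Complex.I *
        (n ξ * ((2 * Real.pi * ξ - p.loc i) ^ (p.ord i - a + 1))⁻¹)) := by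
      intro ξ
      rw [PoleFamily.paired, Finset.mul_sum]
      refine Finset.sum_congr rfl fun i _ => ?_
      rw [mul_left_comm, Finset.mul_sum]
      congr 1
      exact Finset.sum_congr rfl fun b _ => by ring
    simp_rw [l2]
    rw [l1, integral_finsetSum _ fun i _ =>
      (integrable_finsetSum _ fun a _ => ji i a).const_mul _]
    refine Finset.sum_congr rfl fun i _ => ?_
    rw [integral_const_mul, integral_finsetSum _ fun a _ => ji i a]
    congr 1
    refine Finset.sum_congr rfl fun a _ => ?_
    rw [integral_const_mul, integral_const_mul, hk.integral_mul_inv_pow (hp i)]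
    linear_combination (coef φ (p.loc i) a * coef k (p.loc i) (p.ord i - a)) * Complex.I_sq
  have tot : ∫ y, (φ y * k' y + s * (φ y * invFour ρ y) + s * (φ y * p.kernel y)
      + φ y * invFour (fun ξ => ρ ξ * n ξ) y + φ y * D y) = 0 := by
    simp_rw [pt]; exact integral_zero ℝ ℂ
  rw [integral_add_five j1 (j2.const_mul s) (j3.const_mul s) j4 j5] at tot
  rw [integral_const_mul, integral_const_mul, v1, v2, v3, v4, v5] at tot
  linear_combination tot

end

section

/-! ### The Riemann–Hilbert argument -/

theorem isOpen_upper : IsOpen {l : ℂ | 0 < l.im} := isOpen_lt continuous_const Complex.continuous_im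

/-- Riemann's theorem for finitely many singularities in the upper half plane. -/
theorem exists_holomorphic_extension {f : ℂ → ℂ} {E : Set ℂ} (hE : E.Finite)
    (hsub : E ⊆ {l | 0 < l.im}) (hd : DifferentiableOn ℂ f ({l | 0 < l.im} \ E))
    (hc : ContinuousOn f ({l | 0 ≤ l.im} \ E))
    (hb : ∀ e ∈ E, f =O[𝓝[≠] e] fun _ => (1 : ℂ)) :
    ∃ F : ℂ → ℂ, DifferentiableOn ℂ F {l | 0 < l.im} ∧ ContinuousOn F {l | 0 ≤ l.im} ∧
      ∀ l ∉ E, F l = f l := by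
  classical
  set F : ℂ → ℂ := fun l => if l ∈ E then limUnder (𝓝[≠] l) f else f l with hF
  have hoff : ∀ l ∉ E, F l = f l := fun l hl => by simp [hF, hl]
  have hloc : ∀ l ∉ E, F =ᶠ[𝓝 l] f := by
    intro l hl
    filter_upwards [hE.isClosed.isOpen_compl.mem_nhds hl] with z hz using hoff z hz
  have hdF : DifferentiableOn ℂ F {l | 0 < l.im} := by
    intro l hl
    by_cases hlE : l ∈ E
    · obtain ⟨C, hC⟩ := (hb l hlE).bound
      have hC' : ∀ᶠ z in 𝓝 l, z ≠ l → ‖f z‖ ≤ C := by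
        have := eventually_nhdsWithin_iff.1 hC
        filter_upwards [this] with z hz hne
        simpa using hz hne
      have hEl : ∀ᶠ z in 𝓝 l, z ∉ E \ {l} :=
        ((hE.subset Set.sdiff_subset).isClosed.isOpen_compl).mem_nhds (by simp)
      have hs : {z | (z ≠ l → ‖f z‖ ≤ C) ∧ z ∉ E \ {l} ∧ 0 < z.im} ∈ 𝓝 l := by
        filter_upwards [hC', hEl, isOpen_upper.mem_nhds hl] with z h1 h2 h3 using ⟨h1, h2, h3⟩
      set s := {z | (z ≠ l → ‖f z‖ ≤ C) ∧ z ∉ E \ {l} ∧ 0 < z.im}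
      have h1 := Complex.differentiableOn_update_limUnder_of_bddAbove hs
        (hd.mono fun z hz => ⟨hz.1.2.2, fun hzE => hz.1.2.1 ⟨hzE, hz.2⟩⟩)
        ⟨C, by rintro _ ⟨z, hz, rfl⟩; exact hz.1.1 hz.2⟩
      have h2 := (h1.differentiableAt hs).congr_of_eventuallyEq (f₁ := F) (by
        filter_upwards [hs] with z hz
        by_cases hzl : z = l
        · subst hzl; simp [hF, hlE]
        · rw [Function.update_of_ne hzl, hoff z fun hzE => hz.2.1 ⟨hzE, hzl⟩])
      exact h2.differentiableWithinAt
    · have h1 : DifferentiableAt ℂ f l :=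
        (hd l ⟨hl, hlE⟩).differentiableAt
          ((isOpen_upper.sdiff hE.isClosed).mem_nhds ⟨hl, hlE⟩)
      exact (h1.congr_of_eventuallyEq (hloc l hlE)).differentiableWithinAt
  refine ⟨F, hdF, fun l hl => ?_, hoff⟩
  by_cases hlE : l ∈ E
  · exact (hdF.continuousOn.continuousAt (isOpen_upper.mem_nhds (hsub hlE))).continuousWithinAt
  · have h1 : ContinuousWithinAt f {l | 0 ≤ l.im} l := by
      refine (hc l ⟨hl, hlE⟩).mono_of_mem_nhdsWithin ?_
      exact Filter.inter_mem self_mem_nhdsWithin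
        (mem_nhdsWithin_of_mem_nhds (hE.isClosed.isOpen_compl.mem_nhds hlE))
    exact h1.congr_of_eventuallyEq (eventually_nhdsWithin_of_eventually_nhds (hloc l hlE))
      (hoff l hlE)

theorem isHardy_zero : IsHardy fun _ => 0 :=
  ⟨differentiableOn_const _, continuousOn_const, 0, fun l _ => by simp⟩

theorem IsHardy.sum {ι : Type*} (s : Finset ι) {f : ι → ℂ → ℂ} (hf : ∀ i ∈ s, IsHardy (f i)) :
    IsHardy fun l => ∑ i ∈ s, f i l := by
  classical
  induction s using Finset.induction_on with
  | empty => simpa using isHardy_zero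
  | insert a s ha ih =>
    simp_rw [Finset.sum_insert ha]
    exact (hf a (Finset.mem_insert_self _ _)).add
      (ih fun i hi => hf i (Finset.mem_insert_of_mem hi))

theorem IsHardy.mul_hardy {f g : ℂ → ℂ} (hf : IsHardy f) (hg : IsHardy g) :
    IsHardy fun l => f l * g l := by
  obtain ⟨C, hC⟩ := hf.bound
  obtain ⟨D, hD⟩ := hg.bound
  refine ⟨hf.diff.mul hg.diff, hf.cont.mul hg.cont, C * D, fun l hl => ?_⟩
  rw [norm_mul]
  have h0 : 0 ≤ C := by simpa using (norm_nonneg _).trans (hC 0 (by simp))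
  have h1 : ‖f l‖ ≤ C := (hC l hl).trans (div_le_self h0 (by linarith [norm_nonneg l]))
  calc ‖f l‖ * ‖g l‖ ≤ C * (D / (1 + ‖l‖)) :=
        mul_le_mul h1 (hD l hl) (norm_nonneg _) h0
    _ = _ := by rw [mul_div_assoc]

theorem isHardy_inv_sub_pow {ν : ℂ} (hν : ν.im < 0) (m : ℕ) :
    IsHardy fun l => ((l - ν) ^ (m + 1))⁻¹ := by
  induction m with
  | zero => simpa using isHardy_inv_sub hν
  | succ m ih =>
    have := ih.mul_hardy (isHardy_inv_sub hν)
    simp_rw [pow_succ _ (m + 1), mul_inv]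
    exact this

theorem isBigO_inv_sub_pow (ν : ℂ) (m : ℕ) :
    (fun l : ℂ => ((l - ν) ^ (m + 1))⁻¹ - (if m = 0 then l⁻¹ else 0))
      =O[Bornology.cobounded ℂ] fun l => (l ^ 2)⁻¹ := by
  cases m with
  | zero => simpa using isBigO_inv_sub_sub_inv ν
  | succ m =>
    simp only [Nat.succ_ne_zero, if_false, sub_zero]
    have h1 := (isBigO_inv_sub ν).pow 2
    have h2 : (fun l : ℂ => ((l - ν)⁻¹) ^ m) =O[Bornology.cobounded ℂ] fun _ => (1 : ℂ) := by
      have h3 : (fun l : ℂ => (l - ν)⁻¹) =O[Bornology.cobounded ℂ] fun _ => (1 : ℂ) := by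
        refine (isBigO_inv_sub ν).trans ?_
        exact ((tendsto_inv₀_cobounded (α := ℂ)).isBigO_one ℂ)
      simpa using h3.pow m
    refine (h1.mul h2).congr (fun l => ?_) fun l => by simp
    rw [← pow_add, inv_pow, show 2 + m = m + 1 + 1 by ring]

theorem isBigO_inv_sq_inv : (fun l : ℂ => (l ^ 2)⁻¹) =O[upInf] fun l => l⁻¹ := by
  have h3 : (fun l : ℂ => l⁻¹) =O[upInf] fun _ => (1 : ℂ) :=
    ((tendsto_inv₀_cobounded (α := ℂ)).isBigO_one ℂ).mono upInf_le
  refine ((isBigO_refl (fun l : ℂ => l⁻¹) upInf).mul h3).congr (fun l => ?_) fun l => by simp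
  rw [sq, mul_inv]

namespace PoleFamily

variable {p : PoleFamily}

theorem paired_hardy (hp : ∀ i, 0 < (p.loc i).im) (φ : ℝ → ℂ) :
    IsHardy fun l => p.paired φ (-l) := by
  refine IsHardy.sum _ fun i _ => IsHardy.const_mul (IsHardy.sum _ fun a _ =>
    IsHardy.const_mul (IsHardy.const_mul ?_ _) _) _
  have h := (isHardy_inv_sub_pow (ν := -p.loc i) (by simpa using hp i) (p.ord i - a)).const_mul
    ((-1) ^ (p.ord i - a + 1))⁻¹
  have e : (fun l => ((-1 : ℂ) ^ (p.ord i - a + 1))⁻¹ * ((l - -p.loc i) ^ (p.ord i - a + 1))⁻¹)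
      = fun l => ((-l - p.loc i) ^ (p.ord i - a + 1))⁻¹ := by
    funext l
    rw [← mul_inv, ← mul_pow]
    congr 2; ring
  rwa [e] at h

/-- Only the terms with `a = p.ord i` are simple poles; all others already decay like `l⁻²`. -/
theorem paired_isBigO (φ : ℝ → ℂ) :
    (fun l => p.paired φ l - -Complex.I * p.pairedZero φ * l⁻¹)
      =O[Bornology.cobounded ℂ] fun l => (l ^ 2)⁻¹ := by
  have h : (fun l => ∑ i, p.coeff i * ∑ a ∈ Finset.range (p.ord i + 1),
      coef φ (p.loc i) a * (-Complex.I * (((l - p.loc i) ^ (p.ord i - a + 1))⁻¹ -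
        (if p.ord i - a = 0 then l⁻¹ else 0)))) =O[Bornology.cobounded ℂ] fun l => (l ^ 2)⁻¹ := by
    refine IsBigO.fun_sum fun i _ => ?_
    refine IsBigO.const_mul_left ?_ _
    refine IsBigO.fun_sum fun a _ => ?_
    exact ((isBigO_inv_sub_pow _ _).const_mul_left _).const_mul_left _
  refine h.congr_left fun l => ?_
  rw [paired, pairedZero, Finset.mul_sum, Finset.sum_mul, ← Finset.sum_sub_distrib]
  refine Finset.sum_congr rfl fun i _ => ?_
  have e2 : ∑ a ∈ Finset.range (p.ord i + 1), coef φ (p.loc i) a *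
      (-Complex.I * (if p.ord i - a = 0 then l⁻¹ else 0))
      = -Complex.I * coef φ (p.loc i) (p.ord i) * l⁻¹ := by
    rw [Finset.sum_eq_single (p.ord i)]
    · simp; ring
    · intro a ha hne
      have : p.ord i - a ≠ 0 := by
        have := Finset.mem_range.1 ha
        omega
      simp [this]
    · simp
  have e3 : -Complex.I * (p.coeff i * coef φ (p.loc i) (p.ord i)) * l⁻¹
      = p.coeff i * (-Complex.I * coef φ (p.loc i) (p.ord i) * l⁻¹) := by ring
  rw [e3, ← e2, ← mul_sub, ← Finset.sum_sub_distrib]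
  congr 1
  exact Finset.sum_congr rfl fun a _ => by ring

/-- The function `paired φ` is minus the polar part of `i · principal · coef φ`. At a pole of order
`κ + 1` the sum is the Taylor remainder of order `κ + 1` of `coef φ` divided by `(l - λ_i) ^ (κ +
1)`, hence bounded. -/
theorem principal_mul_coef_add_paired (hp : ∀ i, 0 < (p.loc i).im) {φ : ℝ → ℂ}
    (hφ : MemLp φ 2 volume) {e : ℂ} (he : 0 < e.im) :
    (fun l => Complex.I * p.principal l * coef φ l 0 + p.paired φ l)
      =O[𝓝[≠] e] fun _ => (1 : ℂ) := by
  have h : (fun l => ∑ i, Complex.I * p.coeff i * ((((l - p.loc i) ^ (p.ord i + 1))⁻¹) *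
      (coef φ l 0 - ∑ a ∈ Finset.range (p.ord i + 1), coef φ (p.loc i) a * (l - p.loc i) ^ a)))
      =O[𝓝[≠] e] fun _ => (1 : ℂ) := by
    refine IsBigO.fun_sum fun i _ => ?_
    refine IsBigO.const_mul_left ?_ _
    by_cases hei : e = p.loc i
    · subst hei
      have h1 := (coef_taylor hφ (hp i) (p.ord i + 1)).mono
        (nhdsWithin_le_nhds (s := {p.loc i}ᶜ))
      refine ((isBigO_refl (fun l : ℂ => ((l - p.loc i) ^ (p.ord i + 1))⁻¹) _).mul h1).trans ?_
      refine IsBigO.of_bound 1 ?_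
      filter_upwards [self_mem_nhdsWithin] with l hl
      have : (l - p.loc i) ^ (p.ord i + 1) ≠ 0 := pow_ne_zero _ (sub_ne_zero.2 hl)
      rw [inv_mul_cancel₀ this]
      simp
    · refine IsBigO.mono ?_ (nhdsWithin_le_nhds (s := {e}ᶜ))
      have hc1 : ContinuousAt (fun l : ℂ => ((l - p.loc i) ^ (p.ord i + 1))⁻¹) e := by
        refine ContinuousAt.inv₀ (by fun_prop) (pow_ne_zero _ (sub_ne_zero.2 hei))
      have h2 : (fun l => coef φ l 0) =O[𝓝 e] fun _ => (1 : ℂ) := by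
        have h3 := coef_taylor hφ he 1
        have h4 : (fun l : ℂ => (l - e) ^ 1) =O[𝓝 e] fun _ => (1 : ℂ) :=
          (show ContinuousAt (fun l : ℂ => (l - e) ^ 1) e by fun_prop).tendsto.isBigO_one ℂ
        have h5 := (h3.trans h4).add
          (isBigO_const_const (coef φ e 0) (one_ne_zero (α := ℂ)) (𝓝 e))
        refine h5.congr_left fun l => ?_
        simp
      have hc2 : ContinuousAt (fun l : ℂ => ∑ a ∈ Finset.range (p.ord i + 1),
          coef φ (p.loc i) a * (l - p.loc i) ^ a) e := by fun_prop
      have := (hc1.tendsto.isBigO_one ℂ).mul (h2.sub (hc2.tendsto.isBigO_one ℂ))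
      simpa using this
  refine h.congr' ?_ EventuallyEq.rfl
  have hne : ∀ᶠ l in 𝓝[≠] e, ∀ i, l ≠ p.loc i := by
    rw [eventually_all]
    intro i
    by_cases hei : e = p.loc i
    · rw [← hei]; exact self_mem_nhdsWithin
    · exact eventually_nhdsWithin_of_eventually_nhds (isOpen_ne.mem_nhds hei)
  filter_upwards [hne] with l hl
  rw [principal, paired, Finset.mul_sum, Finset.sum_mul, ← Finset.sum_add_distrib]
  refine Finset.sum_congr rfl fun i _ => ?_
  have e1 : ∑ a ∈ Finset.range (p.ord i + 1), coef φ (p.loc i) a *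
      (-Complex.I * ((l - p.loc i) ^ (p.ord i - a + 1))⁻¹)
      = -Complex.I * ((l - p.loc i) ^ (p.ord i + 1))⁻¹ *
        ∑ a ∈ Finset.range (p.ord i + 1), coef φ (p.loc i) a * (l - p.loc i) ^ a := by
    rw [Finset.mul_sum]
    refine Finset.sum_congr rfl fun a ha => ?_
    have hle : a ≤ p.ord i := Nat.lt_succ_iff.1 (Finset.mem_range.1 ha)
    have h0 : l - p.loc i ≠ 0 := sub_ne_zero.2 (hl i)
    have : (l - p.loc i) ^ (p.ord i + 1) = (l - p.loc i) ^ (p.ord i - a + 1) * (l - p.loc i) ^ a := by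
      rw [← pow_add]; congr 1; omega
    rw [this]
    field_simp
  rw [e1]
  ring

theorem differentiableOn_paired (φ : ℝ → ℂ) :
    DifferentiableOn ℂ (p.paired φ) (Set.range p.loc)ᶜ := by
  intro l hl
  have h0 : ∀ i, l - p.loc i ≠ 0 := fun i h => hl ⟨i, (sub_eq_zero.1 h).symm⟩
  refine DifferentiableAt.differentiableWithinAt ?_
  unfold paired
  refine DifferentiableAt.fun_sum fun i _ => DifferentiableAt.const_mul
    (DifferentiableAt.fun_sum fun a _ => DifferentiableAt.const_mul
      (DifferentiableAt.const_mul (DifferentiableAt.inv ?_ ?_) _) _) _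
  · fun_prop
  · exact pow_ne_zero _ (h0 i)

end PoleFamily

theorem IsHardy.memLp_neg {h : ℂ → ℂ} (hh : IsHardy h) :
    MemLp (fun ξ : ℝ => h (-(2 * Real.pi * ξ))) 2 volume := by
  have := hh.memLp.comp_measurePreserving (Measure.measurePreserving_neg volume)
  refine (memLp_congr_ae (Eventually.of_forall fun ξ => ?_)).1 this
  simp

/-- One tested Marchenko equation after moving all contours. -/
theorem marchenko_half {ρ k n k' n' : ℝ → ℂ} (h : IsReflection ρ) {p : PoleFamily}
    (hp : ∀ i, 0 < (p.loc i).im) (hk : IsFT k n) (hk0 : ∀ y ≤ 0, k y = 0) (hk' : IsFT k' n')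
    {s : ℂ}
    (heq : ∀ y > 0, k' y + s * (invFour ρ y + p.kernel y) +
      ∫ z in Set.Ioi (0:ℝ), k z * (invFour ρ (z + y) + p.kernel (z + y)) = 0)
    {G G' H : ℂ → ℂ} (hG : IsHardy G) (hG' : IsHardy G') {E : Set ℂ} (hE : E.Finite)
    (hEsub : E ⊆ {l | 0 < l.im}) (hpE : ∀ i, p.loc i ∈ E) {μ : ℂ} (hμ : 0 < μ.im) {ε : ℂ}
    (hεE : ε = 0 ∨ μ ∈ E) (hHd : DifferentiableOn ℂ H ({l | 0 < l.im} \ E))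
    (hHc : ContinuousOn H ({l | 0 ≤ l.im} \ E))
    (hnear : ∀ e ∈ E, (fun l => H l - Complex.I * p.principal l * G l - ε * (l - μ)⁻¹)
      =O[𝓝[≠] e] fun _ => (1 : ℂ))
    {r : ℂ} (hH : (fun l => H l - r * l⁻¹) =O[upInf] fun l => (l ^ 2)⁻¹)
    (hGr : (fun l => G' l + r * l⁻¹) =O[upInf] fun l => (l ^ 2)⁻¹)
    (hjump : ∀ ξ : ℝ, ρ ξ * G (2 * Real.pi * ξ)
      = H (2 * Real.pi * ξ) - G' (-(2 * Real.pi * ξ))) :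
    (∫ ξ : ℝ, G (2 * Real.pi * ξ) * n' (-ξ)) - (∫ ξ : ℝ, n ξ * G' (-(2 * Real.pi * ξ)))
      + ε * (Complex.I * coef k μ 0) + s * (Complex.I * (ε - r)) = 0 := by
  obtain ⟨φ, hφ0, hφ, hφc⟩ := hG.exists_isFT
  have hw := marchenko_weak h p hp hk hk0 hk' hφ hφ0 s heq
  have hlocs : ∀ l ∉ E, l ∈ (Set.range p.loc)ᶜ := by
    rintro l hl ⟨i, rfl⟩; exact hl (hpE i)
  have hεd : ∀ l ∉ E, DifferentiableAt ℂ (fun l : ℂ => ε * (l - μ)⁻¹) l := by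
    intro l hl
    rcases hεE with rfl | hμE
    · simp
    · have : l - μ ≠ 0 := fun h0 => hl (by rw [sub_eq_zero.1 h0]; exact hμE)
      exact ((differentiableAt_id.sub_const μ).inv this).const_mul ε
  have hpd : ∀ l ∉ E, DifferentiableAt ℂ (p.paired φ) l := fun l hl =>
    (p.differentiableOn_paired φ l (hlocs l hl)).differentiableAt
      ((Set.finite_range p.loc).isClosed.isOpen_compl.mem_nhds (hlocs l hl))
  -- All singularities cancel here: the polar part of `H` at a bound state is that of `i · principal
  -- · G`, removed by `paired φ` since `G = coef φ`, and the possible simple pole at `μ` is removed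
  -- by the `ε` term.
  obtain ⟨F, hFd, hFc, hFE⟩ := exists_holomorphic_extension
    (f := fun l => H l + p.paired φ l - ε * (l - μ)⁻¹) hE hEsub
    (fun l hl => ((hHd l hl).add (hpd l hl.2).differentiableWithinAt).sub
      (hεd l hl.2).differentiableWithinAt)
    (fun l hl => ((hHc l hl).add (hpd l hl.2).continuousAt.continuousWithinAt).sub
      (hεd l hl.2).continuousAt.continuousWithinAt)
    (fun e he => by
      have h1 := p.principal_mul_coef_add_paired hp hφ.memLp_left (hEsub he)
      refine ((hnear e he).add h1).congr' ?_ EventuallyEq.rfl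
      filter_upwards [eventually_nhdsWithin_of_eventually_nhds
        (isOpen_upper.mem_nhds (hEsub he))] with l hl
      rw [hφc l hl]; ring)
  have hinf : ∀ᶠ l in upInf, l ∉ E := by
    refine upInf_le ?_
    exact (Bornology.isBounded_def.1 hE.isBounded)
  set c : ℂ := r - Complex.I * p.pairedZero φ - ε with hc
  have hFc' : (fun l => F l - c * l⁻¹) =O[upInf] fun l => (l ^ 2)⁻¹ := by
    have h1 := (p.paired_isBigO φ).mono upInf_le
    have h2 := ((isBigO_inv_sub_sub_inv μ).mono upInf_le).const_mul_left ε
    refine ((hH.add h1).sub h2).congr' ?_ EventuallyEq.rfl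
    filter_upwards [hinf] with l hl
    rw [hFE l hl, hc]; ring
  have hF : IsHardy F := by
    refine IsHardy.of_isBigO hFd hFc ?_
    have h1 := (hFc'.trans isBigO_inv_sq_inv).add
      ((isBigO_refl (fun l : ℂ => l⁻¹) upInf).const_mul_left c)
    refine h1.congr_left fun l => by ring
  have hrealE : ∀ x : ℝ, (x : ℂ) ∉ E := fun x hx => by
    have := hEsub hx
    simp at this
  have hFreal : ∀ ξ : ℝ, F (2 * Real.pi * ξ) = H (2 * Real.pi * ξ)
      + p.paired φ (2 * Real.pi * ξ) - ε * (2 * Real.pi * ξ - μ)⁻¹ := by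
    intro ξ
    have := hFE ((2 * Real.pi * ξ : ℝ) : ℂ) (hrealE _)
    push_cast at this
    exact this
  obtain ⟨ψ, hψ0, hψ, -⟩ := hF.exists_isFT
  -- Both `n` and the boundary values of `F` are transforms of functions supported on the positive
  -- half line, so their bilinear pairing vanishes.
  have o1 : ∫ ξ : ℝ, n ξ * F (2 * Real.pi * ξ) = 0 := hk.integral_mul_eq_zero hψ hk0 hψ0
  have o2 := hk.integral_mul_inv_pow hμ 0
  have hnF : Integrable fun ξ : ℝ => n ξ * F (2 * Real.pi * ξ) :=
    hk.memLp_right.integrable_mul hF.memLp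
  have hnμ : Integrable fun ξ : ℝ => ε * (n ξ * ((2 * Real.pi * ξ - μ) ^ (0 + 1))⁻¹) :=
    (hk.memLp_right.integrable_mul (memLp_inv_pow hμ 0)).const_mul ε
  have hnG' : Integrable fun ξ : ℝ => n ξ * G' (-(2 * Real.pi * ξ)) :=
    hk.memLp_right.integrable_mul hG'.memLp_neg
  have hpm : MemLp (fun ξ : ℝ => p.paired φ (2 * Real.pi * ξ)) 2 volume := by
    have := (p.paired_hardy hp φ).memLp_neg
    simpa using this
  have hnp : Integrable fun ξ : ℝ => n ξ * p.paired φ (2 * Real.pi * ξ) :=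
    hk.memLp_right.integrable_mul hpm
  have hρnG : Integrable fun ξ : ℝ => (ρ ξ * n ξ) * G (2 * Real.pi * ξ) :=
    (h.memLp_mul hk.memLp_right).integrable_mul hG.memLp
  have E1 : (∫ ξ : ℝ, (ρ ξ * n ξ) * G (2 * Real.pi * ξ))
      + ∫ ξ : ℝ, n ξ * p.paired φ (2 * Real.pi * ξ)
      = ε * (Complex.I * coef k μ 0) - ∫ ξ : ℝ, n ξ * G' (-(2 * Real.pi * ξ)) := by
    rw [← integral_add hρnG hnp]
    have e : ∀ ξ : ℝ, (ρ ξ * n ξ) * G (2 * Real.pi * ξ) + n ξ * p.paired φ (2 * Real.pi * ξ)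
        = (n ξ * F (2 * Real.pi * ξ) + ε * (n ξ * ((2 * Real.pi * ξ - μ) ^ (0 + 1))⁻¹))
          - n ξ * G' (-(2 * Real.pi * ξ)) := by
      intro ξ
      rw [hFreal]
      linear_combination n ξ * hjump ξ
    simp_rw [e]
    have a1 := integral_sub (hnF.add hnμ) hnG'
    have a2 := integral_add hnF hnμ
    simp only [Pi.add_apply] at a1
    rw [a1, a2, o1, integral_const_mul, o2, zero_add]
  have hg : IsHardy fun l => G' l + p.paired φ (-l) + ε * (l - -μ)⁻¹ :=
    (hG'.add (p.paired_hardy hp φ)).add ((isHardy_inv_sub (by simpa using hμ)).const_mul ε)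
  have hneg : Tendsto (fun l : ℂ => -l) upInf (Bornology.cobounded ℂ) :=
    tendsto_neg_cobounded.comp (tendsto_id.mono_left upInf_le)
  have hgc : (fun l => (G' l + p.paired φ (-l) + ε * (l - -μ)⁻¹) + c * l⁻¹)
      =O[upInf] fun l => (l ^ 2)⁻¹ := by
    have h1 := (p.paired_isBigO φ).comp_tendsto hneg
    have h1' : (fun l => p.paired φ (-l) - -Complex.I * p.pairedZero φ * (-l)⁻¹)
        =O[upInf] fun l => (l ^ 2)⁻¹ := by
      refine h1.congr_right fun l => ?_
      simp
    have h2 := ((isBigO_inv_sub_sub_inv (-μ)).mono upInf_le).const_mul_left ε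
    refine ((hGr.add h1').add h2).congr_left fun l => ?_
    rw [hc, inv_neg]; ring
  obtain ⟨-, J⟩ := integral_jump hF hg hFc' hgc
  -- On the real line `ρ G` is the jump between `F` and a Hardy function evaluated at `-x`; the
  -- `paired` and `ε` terms cancel between the two. The integral is then read off from the common
  -- tail `c / λ`.
  have E2 : ∫ ξ : ℝ, ρ ξ * G (2 * Real.pi * ξ) = -Complex.I * c := by
    have h1 := two_pi_mul_integral fun x : ℝ => F x -
      (G' (-(x : ℂ)) + p.paired φ (- -(x : ℂ)) + ε * (-(x : ℂ) - -μ)⁻¹)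
    rw [J] at h1
    have h2 : (Real.pi : ℂ) ≠ 0 := by exact_mod_cast Real.pi_ne_zero
    rw [show (2 * Real.pi : ℂ)⁻¹ * (-2 * Real.pi * Complex.I * c) = -Complex.I * c by
      field_simp] at h1
    rw [← h1]
    refine integral_congr_ae (Eventually.of_forall fun ξ => ?_)
    simp only []
    push_cast
    rw [hFreal, hjump, neg_neg, show (-(2 * Real.pi * ξ : ℂ) - -μ) = -(2 * Real.pi * ξ - μ) by ring,
      inv_neg]
    ring
  rw [E2, hc] at hw
  linear_combination hw - E1 - s * p.pairedZero φ * Complex.I_sq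

end

/-! ### Half-plane scattering data and the Laplace transform of a Marchenko solution -/

section

/-- Scattering data on the closed upper half plane: a holomorphic vector `A → (0, 1)` and a
meromorphic vector `P → (1, 0)` whose principal parts are multiples of `A`. -/
structure HalfPlaneData (A₁ A₂ P₁ P₂ : ℂ → ℂ) (p : PoleFamily) : Prop where
  hardy₁ : IsHardy A₁
  hardy₂ : IsHardy fun l => A₂ l - 1
  loc_im : ∀ i, 0 < (p.loc i).im
  diff₁ : DifferentiableOn ℂ P₁ ({l | 0 < l.im} \ Set.range p.loc)
  diff₂ : DifferentiableOn ℂ P₂ ({l | 0 < l.im} \ Set.range p.loc)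
  cont₁ : ContinuousOn P₁ ({l | 0 ≤ l.im} \ Set.range p.loc)
  cont₂ : ContinuousOn P₂ ({l | 0 ≤ l.im} \ Set.range p.loc)
  isBigO₁ : (fun l => P₁ l - 1) =O[upInf] fun l => l⁻¹
  isBigO₂ : P₂ =O[upInf] fun l => l⁻¹
  det : ∀ l, 0 < l.im → l ∉ Set.range p.loc → P₁ l * A₂ l - P₂ l * A₁ l = 1
  near₁ : ∀ i, (fun l => P₁ l - Complex.I * p.principal l * A₁ l)
    =O[𝓝[≠] (p.loc i)] fun _ => (1 : ℂ)
  near₂ : ∀ i, (fun l => P₂ l - Complex.I * p.principal l * A₂ l)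
    =O[𝓝[≠] (p.loc i)] fun _ => (1 : ℂ)

theorem isBigO_mul_inv_sub {f : ℂ → ℂ} {c : ℂ} (hf : (fun l => f l - c) =O[upInf] fun l => l⁻¹)
    (ν : ℂ) : (fun l => f l * (l - ν)⁻¹ - c * l⁻¹) =O[upInf] fun l => (l ^ 2)⁻¹ := by
  have h1 := hf.mul ((isBigO_inv_sub ν).mono upInf_le)
  have h2 := ((isBigO_inv_sub_sub_inv ν).mono upInf_le).const_mul_left c
  have h1' : (fun l => (f l - c) * (l - ν)⁻¹) =O[upInf] fun l => (l ^ 2)⁻¹ :=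
    h1.congr_right fun l => by rw [sq, mul_inv]
  exact (h1'.add h2).congr_left fun l => by ring

theorem isBigO_inv_of_sub {f : ℂ → ℂ} {c : ℂ}
    (hf : (fun l => f l - c * l⁻¹) =O[upInf] fun l => (l ^ 2)⁻¹) : f =O[upInf] fun l => l⁻¹ :=
  ((hf.trans isBigO_inv_sq_inv).add
    ((isBigO_refl (fun l : ℂ => l⁻¹) upInf).const_mul_left c)).congr_left fun l => by ring

theorem isHardy_mul_inv_sub {f : ℂ → ℂ} (hd : DifferentiableOn ℂ f {l | 0 < l.im})
    (hc : ContinuousOn f {l | 0 ≤ l.im}) {c : ℂ}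
    (hf : (fun l => f l - c) =O[upInf] fun l => l⁻¹) {ν : ℂ} (hν : ν.im < 0) :
    IsHardy fun l => f l * (l - ν)⁻¹ :=
  IsHardy.of_isBigO (hd.mul (isHardy_inv_sub hν).diff) (hc.mul (isHardy_inv_sub hν).cont)
    (isBigO_inv_of_sub (isBigO_mul_inv_sub hf ν))

theorem upper_mem_nhds {μ : ℂ} (hμ : 0 < μ.im) : {l : ℂ | 0 < l.im} ∈ 𝓝 μ :=
  isOpen_upper.mem_nhds hμ

theorem isHardy_dslope {f : ℂ → ℂ} (hd : DifferentiableOn ℂ f {l | 0 < l.im})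
    (hc : ContinuousOn f {l | 0 ≤ l.im}) {c : ℂ}
    (hf : (fun l => f l - c) =O[upInf] fun l => l⁻¹) {μ : ℂ} (hμ : 0 < μ.im) (h0 : f μ = 0) :
    IsHardy (dslope f μ) ∧
      (fun l => dslope f μ l - c * l⁻¹) =O[upInf] fun l => (l ^ 2)⁻¹ := by
  have e : ∀ l, l ≠ μ → dslope f μ l = f l * (l - μ)⁻¹ := fun l hl => by
    rw [dslope_of_ne _ hl, slope_def_field, h0, sub_zero, div_eq_mul_inv]
  have hO : (fun l => dslope f μ l - c * l⁻¹) =O[upInf] fun l => (l ^ 2)⁻¹ := by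
    refine (isBigO_mul_inv_sub hf μ).congr' ?_ EventuallyEq.rfl
    filter_upwards [upInf_le (Bornology.isBounded_def.1 (Bornology.isBounded_singleton (x := μ)))]
      with l hl
    rw [e l hl]
  refine ⟨IsHardy.of_isBigO ((Complex.differentiableOn_dslope (upper_mem_nhds hμ)).2 hd) ?_
    (isBigO_inv_of_sub hO), hO⟩
  have hs : {l : ℂ | 0 ≤ l.im} ∈ 𝓝 μ :=
    mem_of_superset (upper_mem_nhds hμ) fun l (hl : 0 < l.im) => le_of_lt hl
  refine (continuousOn_dslope hs).2 ⟨hc, ?_⟩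
  exact (hd μ hμ).differentiableAt (upper_mem_nhds hμ)

theorem PoleFamily.continuousAt_principal (p : PoleFamily) {l : ℂ} (hl : l ∉ Set.range p.loc) :
    ContinuousAt p.principal l := by
  unfold PoleFamily.principal
  refine tendsto_finsetSum _ fun i _ => ?_
  refine Tendsto.const_mul _ ?_
  have : (l - p.loc i) ^ (p.ord i + 1) ≠ 0 :=
    pow_ne_zero _ (sub_ne_zero.2 fun h => hl ⟨i, h.symm⟩)
  exact ContinuousAt.inv₀ (by fun_prop) this

variable {A₁ A₂ P₁ P₂ A₁' A₂' P₁' P₂' : ℂ → ℂ} {p p' : PoleFamily}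

namespace HalfPlaneData

theorem diff_comb (d : HalfPlaneData A₁ A₂ P₁ P₂ p) (r₁ r₂ : ℂ) :
    DifferentiableOn ℂ (fun l => r₁ * A₁ l + r₂ * A₂ l) {l | 0 < l.im} := by
  have h := (d.hardy₁.diff.const_mul r₁).add ((d.hardy₂.diff.add_const 1).const_mul r₂)
  exact h.congr fun l _ => by simp

theorem cont_comb (d : HalfPlaneData A₁ A₂ P₁ P₂ p) (r₁ r₂ : ℂ) :
    ContinuousOn (fun l => r₁ * A₁ l + r₂ * A₂ l) {l | 0 ≤ l.im} := by
  have h := (d.hardy₁.cont.const_mul r₁).add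
    ((d.hardy₂.cont.add (continuousOn_const (c := 1))).const_mul r₂)
  exact h.congr fun l _ => by simp

theorem isBigO_comb (d : HalfPlaneData A₁ A₂ P₁ P₂ p) (r₁ r₂ : ℂ) :
    (fun l => (r₁ * A₁ l + r₂ * A₂ l) - r₂) =O[upInf] fun l => l⁻¹ :=
  ((d.hardy₁.isBigO.const_mul_left r₁).add (d.hardy₂.isBigO.const_mul_left r₂)).congr_left
    fun l => by ring

theorem isBigO_comb' (d : HalfPlaneData A₁ A₂ P₁ P₂ p) (r₁ r₂ : ℂ) :
    (fun l => (r₁ * P₁ l + r₂ * P₂ l) - r₁) =O[upInf] fun l => l⁻¹ :=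
  ((d.isBigO₁.const_mul_left r₁).add (d.isBigO₂.const_mul_left r₂)).congr_left
    fun l => by ring

theorem near_comb (d : HalfPlaneData A₁ A₂ P₁ P₂ p) (r₁ r₂ : ℂ) (i : p.ι) :
    (fun l => (r₁ * P₁ l + r₂ * P₂ l) - Complex.I * p.principal l * (r₁ * A₁ l + r₂ * A₂ l))
      =O[𝓝[≠] (p.loc i)] fun _ => (1 : ℂ) :=
  (((d.near₁ i).const_mul_left r₁).add ((d.near₂ i).const_mul_left r₂)).congr_left
    fun l => by ring

end HalfPlaneData

theorem isBigO_one_inv_sub {e ν : ℂ} (h : e ≠ ν) :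
    (fun l => (l - ν)⁻¹) =O[𝓝[≠] e] fun _ => (1 : ℂ) := by
  have : ContinuousAt (fun l : ℂ => (l - ν)⁻¹) e :=
    ContinuousAt.inv₀ (by fun_prop) (sub_ne_zero.2 h)
  exact (this.tendsto.isBigO_one ℂ).mono nhdsWithin_le_nhds

/-- The Marchenko equation on the half line determines the transform of its solution: it is the
corresponding entry of the holomorphic solution of the Riemann–Hilbert problem. -/
theorem coef_eq_of_marchenko (d : HalfPlaneData A₁ A₂ P₁ P₂ p)
    (d' : HalfPlaneData A₁' A₂' P₁' P₂' p') {ρ ρ' : ℝ → ℂ} (hρ : IsReflection ρ)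
    (hρ' : IsReflection ρ')
    (j₁ : ∀ ξ : ℝ, P₁ (2 * Real.pi * ξ)
      = A₂' (-(2 * Real.pi * ξ)) + ρ ξ * A₁ (2 * Real.pi * ξ))
    (j₂ : ∀ ξ : ℝ, P₂ (2 * Real.pi * ξ)
      = A₁' (-(2 * Real.pi * ξ)) + ρ ξ * A₂ (2 * Real.pi * ξ))
    (j₁' : ∀ ξ : ℝ, P₁' (2 * Real.pi * ξ)
      = A₂ (-(2 * Real.pi * ξ)) + ρ' ξ * A₁' (2 * Real.pi * ξ))
    (j₂' : ∀ ξ : ℝ, P₂' (2 * Real.pi * ξ)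
      = A₁ (-(2 * Real.pi * ξ)) + ρ' ξ * A₂' (2 * Real.pi * ξ))
    {k k' : ℝ → ℂ} (hk : MemLp k 2 volume) (hk' : MemLp k' 2 volume)
    (hk0 : ∀ y ≤ 0, k y = 0) (hk0' : ∀ y ≤ 0, k' y = 0) {s s' : ℂ}
    (eq : ∀ y > 0, k' y + s * (invFour ρ y + p.kernel y) +
      ∫ z in Set.Ioi (0:ℝ), k z * (invFour ρ (z + y) + p.kernel (z + y)) = 0)
    (eq' : ∀ y > 0, k y + s' * (invFour ρ' y + p'.kernel y) +
      ∫ z in Set.Ioi (0:ℝ), k' z * (invFour ρ' (z + y) + p'.kernel (z + y)) = 0)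
    {μ : ℂ} (hμ : 0 < μ.im) (hμp : μ ∉ Set.range p.loc) :
    s + coef k μ 0 = s' * A₁ μ + s * A₂ μ := by
  obtain ⟨n, hn⟩ := exists_isFT hk
  obtain ⟨n', hn'⟩ := exists_isFT hk'
  -- These coefficients make `r₁ A₁ + r₂ A₂` vanish at `μ`, while the determinant relation makes `r₁
  -- P₁ + r₂ P₂` equal to `1` there.
  set r₁ := A₂ μ with hr₁
  set r₂ := -A₁ μ with hr₂
  set N : ℂ → ℂ := fun l => r₁ * A₁ l + r₂ * A₂ l with hN
  set N' : ℂ → ℂ := fun l => -(r₂ * A₁' l + r₁ * A₂' l) with hN'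
  have hNμ : N μ = 0 := by simp only [hN, hr₁, hr₂]; ring
  obtain ⟨hG, hGO⟩ := isHardy_dslope (d.diff_comb r₁ r₂) (d.cont_comb r₁ r₂)
    (d.isBigO_comb r₁ r₂) hμ hNμ
  set G := dslope N μ with hGdef
  have hGe : ∀ l, l ≠ μ → G l = N l * (l - μ)⁻¹ := fun l hl => by
    rw [hGdef, dslope_of_ne _ hl, slope_def_field, hNμ, sub_zero, div_eq_mul_inv]
  have hμ' : (-μ).im < 0 := by simpa using hμ
  have hN'O : (fun l => N' l - -r₁) =O[upInf] fun l => l⁻¹ :=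
    (d'.isBigO_comb r₂ r₁).neg_left.congr_left fun l => by simp only [hN']; ring
  have hG' : IsHardy fun l => N' l * (l - -μ)⁻¹ :=
    isHardy_mul_inv_sub (d'.diff_comb r₂ r₁).neg (d'.cont_comb r₂ r₁).neg hN'O hμ'
  have hreal : ∀ ξ : ℝ, (2 * Real.pi * ξ : ℂ) ≠ μ := fun ξ h => by
    have := congrArg Complex.im h
    rw [show (2 * Real.pi * ξ : ℂ) = ((2 * Real.pi * ξ : ℝ) : ℂ) by push_cast; ring,
      Complex.ofReal_im] at this
    exact hμ.ne this
  have hreal' : ∀ ξ : ℝ, (-(2 * Real.pi * ξ) : ℂ) ≠ μ := fun ξ h => by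
    have := congrArg Complex.im h
    rw [show (-(2 * Real.pi * ξ) : ℂ) = ((-(2 * Real.pi * ξ) : ℝ) : ℂ) by push_cast; ring,
      Complex.ofReal_im] at this
    exact hμ.ne this
  have hE : (insert μ (Set.range p.loc)).Finite := (Set.finite_range p.loc).insert μ
  have hEsub : insert μ (Set.range p.loc) ⊆ {l : ℂ | 0 < l.im} := by
    rintro l (rfl | ⟨i, rfl⟩)
    · exact hμ
    · exact d.loc_im i
  have hinvd : ∀ l, l ≠ μ → DifferentiableAt ℂ (fun l : ℂ => (l - μ)⁻¹) l := fun l hl =>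
    (differentiableAt_id.sub_const μ).inv (sub_ne_zero.2 hl)
  -- The combination of `P₁, P₂` divided by `l - μ` has a simple pole of residue `1` at `μ`, whence
  -- `ε = 1`. This is the term that produces `coef k μ 0`.
  have first := marchenko_half (G := G) (G' := fun l => N' l * (l - -μ)⁻¹)
    (H := fun l => (r₁ * P₁ l + r₂ * P₂ l) * (l - μ)⁻¹) (μ := μ) (ε := 1) (r := r₁)
    (E := insert μ (Set.range p.loc)) hρ d.loc_im hn hk0 hn' eq hG hG' hE hEsub
    (fun i => Or.inr ⟨i, rfl⟩) hμ (Or.inr (Or.inl rfl))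
    (by
      intro l hl
      have h1 : l ≠ μ := fun h => hl.2 (Or.inl h)
      have h2 : l ∉ Set.range p.loc := fun h => hl.2 (Or.inr h)
      refine ((((d.diff₁ l ⟨hl.1, h2⟩).const_mul r₁).add
        ((d.diff₂ l ⟨hl.1, h2⟩).const_mul r₂)).mono ?_).mul (hinvd l h1).differentiableWithinAt
      exact fun z hz => ⟨hz.1, fun h => hz.2 (Or.inr h)⟩)
    (by
      intro l hl
      have h1 : l ≠ μ := fun h => hl.2 (Or.inl h)
      have h2 : l ∉ Set.range p.loc := fun h => hl.2 (Or.inr h)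
      refine ((((d.cont₁ l ⟨hl.1, h2⟩).const_mul r₁).add
        ((d.cont₂ l ⟨hl.1, h2⟩).const_mul r₂)).mono ?_).mul
          (hinvd l h1).continuousAt.continuousWithinAt
      exact fun z hz => ⟨hz.1, fun h => hz.2 (Or.inr h)⟩)
    (by
      rintro e (rfl | ⟨i, rfl⟩)
      · have hopen : IsOpen ({l : ℂ | 0 < l.im} \ Set.range p.loc) :=
          isOpen_upper.sdiff (Set.finite_range p.loc).isClosed
        have hd : DifferentiableAt ℂ (fun l => r₁ * P₁ l + r₂ * P₂ l) e :=
          ((d.diff₁.differentiableAt (hopen.mem_nhds ⟨hμ, hμp⟩)).const_mul r₁).add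
            ((d.diff₂.differentiableAt (hopen.mem_nhds ⟨hμ, hμp⟩)).const_mul r₂)
        have hval : r₁ * P₁ e + r₂ * P₂ e = 1 := by
          rw [hr₁, hr₂]; linear_combination d.det e hμ hμp
        have b1 : (fun l => (r₁ * P₁ l + r₂ * P₂ l - 1) * (l - e)⁻¹)
            =O[𝓝[≠] e] fun _ => (1 : ℂ) := by
          have := hd.hasDerivAt.tendsto_slope.isBigO_one ℂ
          refine this.congr_left fun l => ?_
          rw [slope_def_field, hval, div_eq_mul_inv]
        have b2 : (fun l => Complex.I * p.principal l * G l) =O[𝓝[≠] e] fun _ => (1 : ℂ) := by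
          have hGc : ContinuousAt G e := (hG.diff.differentiableAt (upper_mem_nhds hμ)).continuousAt
          have hpc := p.continuousAt_principal hμp
          have : ContinuousAt (fun l => Complex.I * p.principal l * G l) e := by fun_prop
          exact (this.tendsto.isBigO_one ℂ).mono nhdsWithin_le_nhds
        exact (b1.sub b2).congr_left fun l => by ring
      · have hne : p.loc i ≠ μ := fun h => hμp ⟨i, h⟩
        have b1 := (isBigO_one_inv_sub hne).mul (d.near_comb r₁ r₂ i)
        have b2 := b1.sub ((isBigO_one_inv_sub hne).mul (isBigO_refl (fun _ => (1 : ℂ)) _))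
        refine (b2.congr' ?_ (Eventually.of_forall fun l => by simp))
        filter_upwards [eventually_nhdsWithin_of_eventually_nhds (isOpen_ne.mem_nhds hne)]
          with l hl
        rw [hGe l hl, hN]; ring)
    (isBigO_mul_inv_sub (d.isBigO_comb' r₁ r₂) μ)
    ((isBigO_mul_inv_sub hN'O (-μ)).congr_left fun l => by ring)
    (by
      intro ξ
      rw [hGe _ (hreal ξ), j₁, j₂]
      simp only [hN, hN']
      rw [show (-(2 * Real.pi * ξ : ℂ) - -μ) = -(2 * Real.pi * ξ - μ) by ring, inv_neg]
      ring)
  have hne' : ∀ l : ℂ, 0 ≤ l.im → l ≠ -μ := fun l hl h => by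
    rw [h] at hl; exact absurd hl (not_le.2 hμ')
  have hinvd' : ∀ l : ℂ, 0 ≤ l.im → DifferentiableAt ℂ (fun l : ℂ => (l - -μ)⁻¹) l := fun l hl =>
    (differentiableAt_id.sub_const (-μ)).inv (sub_ne_zero.2 (hne' l hl))
  -- Here the denominator vanishes at `-μ`, outside the half plane, so no extra pole arises and `ε =
  -- 0`.
  have second := marchenko_half (G := fun l => N' l * (l - -μ)⁻¹) (G' := G)
    (H := fun l => -(r₂ * P₁' l + r₁ * P₂' l) * (l - -μ)⁻¹) (μ := μ) (ε := 0) (r := -r₂)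
    (E := Set.range p'.loc) hρ' d'.loc_im hn' hk0' hn eq' hG' hG (Set.finite_range _)
    (by rintro l ⟨i, rfl⟩; exact d'.loc_im i) (fun i => ⟨i, rfl⟩) hμ (Or.inl rfl)
    (fun l hl => ((((d'.diff₁ l hl).const_mul r₂).add
        ((d'.diff₂ l hl).const_mul r₁)).neg).mul
          (hinvd' l (le_of_lt hl.1)).differentiableWithinAt)
    (fun l hl => ((((d'.cont₁ l hl).const_mul r₂).add
        ((d'.cont₂ l hl).const_mul r₁)).neg).mul
          (hinvd' l hl.1).continuousAt.continuousWithinAt)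
    (by
      rintro e ⟨i, rfl⟩
      have b1 := (isBigO_one_inv_sub (hne' _ (le_of_lt (d'.loc_im i)))).mul
        (d'.near_comb r₂ r₁ i).neg_left
      exact b1.congr (fun l => by simp only [hN']; ring) (fun l => by simp))
    (isBigO_mul_inv_sub ((d'.isBigO_comb' r₂ r₁).neg_left.congr_left fun l => by ring) (-μ))
    (hGO.congr_left fun l => by ring)
    (by
      intro ξ
      rw [hGe _ (hreal' ξ), j₁', j₂']
      simp only [hN, hN']
      rw [show (-(2 * Real.pi * ξ : ℂ) - μ) = -(2 * Real.pi * ξ - -μ) by ring, inv_neg]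
      ring)
  -- After `ξ ↦ -ξ` the two integrals in the first identity are the negatives of those in the
  -- second, so the transforms `n` and `n'` drop out of the sum.
  have c1 : ∫ ξ : ℝ, n ξ * (N' (-(2 * Real.pi * ξ)) * (-(2 * Real.pi * ξ : ℂ) - -μ)⁻¹)
      = ∫ ξ : ℝ, (N' (2 * Real.pi * ξ) * ((2 * Real.pi * ξ : ℂ) - -μ)⁻¹) * n (-ξ) := by
    rw [← integral_neg_eq_self]
    refine integral_congr_ae (Eventually.of_forall fun ξ => ?_)
    simp only []
    push_cast
    rw [show (-(2 * Real.pi * -ξ) : ℂ) = 2 * Real.pi * ξ by ring]; ring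
  have c2 : ∫ ξ : ℝ, n' ξ * G (-(2 * Real.pi * ξ))
      = ∫ ξ : ℝ, G (2 * Real.pi * ξ) * n' (-ξ) := by
    rw [← integral_neg_eq_self]
    refine integral_congr_ae (Eventually.of_forall fun ξ => ?_)
    simp only []
    push_cast
    rw [show (-(2 * Real.pi * -ξ) : ℂ) = 2 * Real.pi * ξ by ring]; ring
  rw [c1] at first
  rw [c2] at second
  have tot : Complex.I * (coef k μ 0 + s * (1 - r₁) + s' * r₂) = 0 := by
    linear_combination first + second
  have := (mul_eq_zero.1 tot).resolve_left Complex.I_ne_zero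
  rw [hr₁, hr₂] at this
  linear_combination this

end

/-! ### Boundary values from the large-`μ` behaviour of the Laplace transform -/

section

/-- The kernels `σ e^{-σy}` form an approximate identity at `0+`: their mass on `(0, 1]` tends to
`1`, and they tend to `0` uniformly away from the origin. -/
theorem tendsto_integral_exp_peak {g : ℝ → ℂ} {a : ℂ} (hg : IntegrableOn g (Set.Ioi 0))
    (ha : Tendsto g (𝓝[>] 0) (𝓝 a)) :
    Tendsto (fun σ : ℝ => ∫ y in Set.Ioi (0:ℝ), (σ * Real.exp (-σ * y)) • g y) atTop (𝓝 a) := by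
  refine tendsto_setIntegral_peak_smul_of_integrableOn_of_tendsto (x₀ := (0:ℝ))
    (t := Set.Ioc 0 1) measurableSet_Ioi measurableSet_Ioc Set.Ioc_subset_Ioi_self ?_ (by simp) ?_ ?_
    ?_ ?_ hg ha
  · exact Ioc_mem_nhdsGT one_pos
  · filter_upwards [eventually_ge_atTop 0] with σ hσ y _ using by positivity
  · intro u hu h0
    obtain ⟨δ, hδ, hδu⟩ := Metric.isOpen_iff.1 hu 0 h0
    have hlim : Tendsto (fun σ : ℝ => σ * Real.exp (-σ * δ)) atTop (𝓝 0) := by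
      have h := (Real.tendsto_pow_mul_exp_neg_atTop_nhds_zero 1).comp
        (tendsto_id.atTop_mul_const hδ)
      have h2 := h.const_mul δ⁻¹
      rw [mul_zero] at h2
      refine h2.congr fun σ => ?_
      simp only [Function.comp, id, pow_one]
      rw [neg_mul]
      field_simp
    rw [Metric.tendstoUniformlyOn_iff]
    intro ε hε
    filter_upwards [hlim.eventually (gt_mem_nhds hε), eventually_ge_atTop 0] with σ h1 h2 y hy
    have hyδ : δ ≤ y := by
      by_contra hlt
      apply hy.2
      apply hδu
      have hy0 : (0:ℝ) < y := hy.1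
      rw [Metric.mem_ball, Real.dist_eq, sub_zero, abs_of_pos hy0]
      exact not_le.1 hlt
    simp only [Pi.zero_apply, dist_zero_left]
    rw [Real.norm_of_nonneg (by positivity)]
    refine lt_of_le_of_lt ?_ h1
    gcongr _ * ?_
    rw [Real.exp_le_exp]
    nlinarith
  · have e : ∀ σ : ℝ, ∫ y in Set.Ioc (0:ℝ) 1, σ * Real.exp (-σ * y) = 1 - Real.exp (-σ) := by
      intro σ
      rw [← intervalIntegral.integral_of_le zero_le_one]
      rw [intervalIntegral.integral_eq_sub_of_hasDerivAt (f := fun y => -Real.exp (-σ * y))]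
      · simp; ring
      · intro y _
        have := (((hasDerivAt_id y).const_mul (-σ)).exp).neg
        exact this.congr_deriv (by simp only [id]; ring)
      · exact (by fun_prop : Continuous fun y => σ * Real.exp (-σ * y)).intervalIntegrable _ _
    simp_rw [e]
    have := (Real.tendsto_exp_neg_atTop_nhds_zero).const_sub 1
    simpa using this
  · exact Eventually.of_forall fun σ => (by fun_prop :
      Continuous fun y => σ * Real.exp (-σ * y)).aestronglyMeasurable

/-- The initial value theorem for Laplace transforms. -/
theorem tendsto_mul_coef {k : ℝ → ℂ} {a : ℂ} (hk : MemLp k 2 volume)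
    (ha : Tendsto k (𝓝[>] 0) (𝓝 a)) :
    Tendsto (fun τ : ℝ => (τ : ℂ) * coef k (Complex.I * τ) 0) atTop (𝓝 a) := by
  -- The function `k` is only square integrable, so one unit of exponential decay is set aside to
  -- obtain an integrable function. The peak parameter is then `τ - 1`, corrected by the factor `τ /
  -- (τ - 1) → 1`.
  have hI : IntegrableOn (fun y => k y * expPoly Complex.I 0 y) (Set.Ioi 0) :=
    integrable_mul_expPoly hk (by simp) 0
  have hlim : Tendsto (fun y => k y * expPoly Complex.I 0 y) (𝓝[>] 0) (𝓝 a) := by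
    have h1 : Tendsto (expPoly Complex.I 0) (𝓝[>] 0) (𝓝 1) := by
      have := ((continuous_expPoly Complex.I 0).tendsto 0).mono_left
        (nhdsWithin_le_nhds (s := Set.Ioi 0))
      simpa [expPoly] using this
    simpa using ha.mul h1
  have h := (tendsto_integral_exp_peak hI hlim).comp (tendsto_atTop_add_const_right atTop (-1) tendsto_id)
  have hr : Tendsto (fun τ : ℝ => ((τ / (τ - 1) : ℝ) : ℂ)) atTop (𝓝 1) := by
    have h1 : Tendsto (fun τ : ℝ => 1 + (τ - 1)⁻¹) atTop (𝓝 (1 + 0)) := by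
      refine Tendsto.const_add 1 (tendsto_inv_atTop_zero.comp ?_)
      simpa [sub_eq_add_neg] using tendsto_atTop_add_const_right atTop (-1 : ℝ) tendsto_id
    rw [add_zero] at h1
    have h2 : Tendsto (fun τ : ℝ => τ / (τ - 1)) atTop (𝓝 1) := by
      refine h1.congr' ?_
      filter_upwards [eventually_gt_atTop 1] with τ hτ
      have : τ - 1 ≠ 0 := by linarith
      field_simp; ring
    exact (Complex.continuous_ofReal.tendsto 1).comp h2
  have h3 := hr.mul h
  rw [one_mul] at h3
  refine h3.congr' ?_
  filter_upwards [eventually_gt_atTop 1] with τ hτ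
  have hne : (τ : ℂ) - 1 ≠ 0 := by
    have : τ - 1 ≠ 0 := by linarith
    exact_mod_cast this
  simp only [Function.comp, id]
  have e : ∫ y in Set.Ioi (0:ℝ), ((τ + -1) * Real.exp (-(τ + -1) * y)) • (k y * expPoly Complex.I 0 y)
      = ((τ : ℂ) - 1) * coef k (Complex.I * τ) 0 := by
    rw [coef, ← integral_const_mul]
    refine integral_congr_ae (Eventually.of_forall fun y => ?_)
    simp only [expPoly_zero_left, Complex.real_smul]
    have : Complex.exp (Complex.I * (Complex.I * τ) * y)
        = Complex.exp (((-(τ + -1) * y : ℝ) : ℂ)) * Complex.exp (Complex.I * Complex.I * y) := by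
      rw [← Complex.exp_add]; congr 1; push_cast
      linear_combination (τ * y - y : ℂ) * Complex.I_sq
    rw [this]
    push_cast
    ring
  rw [e]
  push_cast
  field_simp

theorem continuous_invFour {ρ : ℝ → ℂ} (hρ : Integrable ρ) : Continuous (invFour ρ) := by
  refine continuous_of_dominated (bound := fun ξ => ‖ρ ξ‖) (fun y => ?_) (fun y => ?_) hρ.norm ?_
  · exact (Continuous.aestronglyMeasurable (by fun_prop)).mul hρ.1
  · refine Eventually.of_forall fun ξ => ?_
    rw [norm_mul, show (2 * Real.pi * Complex.I * y * ξ : ℂ)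
      = ((2 * Real.pi * y * ξ : ℝ) : ℂ) * Complex.I by push_cast; ring,
      Complex.norm_exp_ofReal_mul_I, one_mul]
  · exact Eventually.of_forall fun ξ => by fun_prop

theorem PoleFamily.continuous_kernel (p : PoleFamily) : Continuous p.kernel :=
  continuous_finsetSum _ fun _ _ => continuous_const.mul (continuous_expPoly _ _)

/-- The equation expresses `k` on `y > 0` through Fourier integrals of the integrable functions `ρ`
and `ρ n'` and through exponential polynomials. These are continuous on the whole line, so the limit
is a value at `0`. -/
theorem exists_tendsto_of_marchenko {ρ k' k : ℝ → ℂ} {p : PoleFamily} (hρ : IsReflection ρ)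
    (hp : ∀ i, 0 < (p.loc i).im) (hk' : MemLp k' 2 volume) (hk0' : ∀ y ≤ 0, k' y = 0) {s : ℂ}
    (eq : ∀ y > 0, k y + s * (invFour ρ y + p.kernel y) +
      ∫ z in Set.Ioi (0:ℝ), k' z * (invFour ρ (z + y) + p.kernel (z + y)) = 0) :
    ∃ a, Tendsto k (𝓝[>] 0) (𝓝 a) := by
  obtain ⟨n', hn'⟩ := exists_isFT hk'
  set F : ℝ → ℂ := fun y => -(s * (invFour ρ y + p.kernel y) +
    (invFour (fun ξ => ρ ξ * n' ξ) y + ∑ i, p.coeff i * ∑ b ∈ Finset.range (p.ord i + 1),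
        coef k' (p.loc i) (p.ord i - b) * expPoly (p.loc i) b y)) with hF
  have hc : Continuous F := by
    have h1 := continuous_invFour hρ.integrable
    have h2 := continuous_invFour (hρ.memLp.integrable_mul hn'.memLp_right)
    have h3 := p.continuous_kernel
    have h4 : Continuous fun y => ∑ i, p.coeff i * ∑ b ∈ Finset.range (p.ord i + 1),
        coef k' (p.loc i) (p.ord i - b) * expPoly (p.loc i) b y :=
      continuous_finsetSum _ fun i _ => continuous_const.mul
        (continuous_finsetSum _ fun b _ => continuous_const.mul (continuous_expPoly _ _))
    exact ((continuous_const.mul (h1.add h3)).add (h2.add h4)).neg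
  refine ⟨F 0, ((hc.tendsto 0).mono_left nhdsWithin_le_nhds).congr' ?_⟩
  filter_upwards [self_mem_nhdsWithin] with y hy
  have := eq y hy
  rw [integral_marchenko_kernel hρ p hp hn' hk0'] at this
  simp only [hF]
  linear_combination -this

theorem tendsto_I_mul_upInf : Tendsto (fun τ : ℝ => Complex.I * τ) atTop upInf := by
  refine tendsto_inf.2 ⟨?_, tendsto_principal.2 ?_⟩
  · rw [← tendsto_norm_atTop_iff_cobounded]
    refine tendsto_abs_atTop_atTop.congr fun τ => ?_
    simp
  · filter_upwards [eventually_ge_atTop 0] with τ hτ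
    simpa using hτ

theorem tendsto_mul_of_isBigO {f : ℂ → ℂ} {α : ℂ}
    (hf : (fun l => f l - α * l⁻¹) =O[upInf] fun l => (l ^ 2)⁻¹) :
    Tendsto (fun τ : ℝ => (τ : ℂ) * f (Complex.I * τ)) atTop (𝓝 (-Complex.I * α)) := by
  have h1 := hf.comp_tendsto tendsto_I_mul_upInf
  have h2 : (fun τ : ℝ => (τ : ℂ) * (f (Complex.I * τ) - α * (Complex.I * τ)⁻¹))
      =O[atTop] fun τ : ℝ => (τ : ℂ)⁻¹ := by
    refine ((isBigO_refl (fun τ : ℝ => (τ : ℂ)) atTop).mul h1).trans ?_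
    refine IsBigO.of_bound 1 ?_
    filter_upwards [eventually_gt_atTop 0] with τ hτ
    simp [abs_of_pos hτ]
    field_simp
    rfl
  have h3 : Tendsto (fun τ : ℝ => (τ : ℂ)⁻¹) atTop (𝓝 0) := by
    have := (Complex.continuous_ofReal.tendsto 0).comp (tendsto_inv_atTop_zero (𝕜 := ℝ))
    simpa [Function.comp_def] using this
  have h4 := (h2.trans_tendsto h3).add_const (-Complex.I * α)
  rw [zero_add] at h4
  refine h4.congr' ?_
  filter_upwards [eventually_gt_atTop 0] with τ hτ
  have : (τ : ℂ) ≠ 0 := by exact_mod_cast hτ.ne'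
  rw [mul_inv, Complex.inv_I]
  field_simp
  ring

variable {A₁ A₂ P₁ P₂ A₁' A₂' P₁' P₂' : ℂ → ℂ} {p p' : PoleFamily}

/-- The boundary value of the solution of the half-line Marchenko system in terms of the leading
asymptotics of the Riemann–Hilbert solution. -/
theorem tendsto_of_marchenko (d : HalfPlaneData A₁ A₂ P₁ P₂ p)
    (d' : HalfPlaneData A₁' A₂' P₁' P₂' p') {ρ ρ' : ℝ → ℂ} (hρ : IsReflection ρ)
    (hρ' : IsReflection ρ')
    (j₁ : ∀ ξ : ℝ, P₁ (2 * Real.pi * ξ)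
      = A₂' (-(2 * Real.pi * ξ)) + ρ ξ * A₁ (2 * Real.pi * ξ))
    (j₂ : ∀ ξ : ℝ, P₂ (2 * Real.pi * ξ)
      = A₁' (-(2 * Real.pi * ξ)) + ρ ξ * A₂ (2 * Real.pi * ξ))
    (j₁' : ∀ ξ : ℝ, P₁' (2 * Real.pi * ξ)
      = A₂ (-(2 * Real.pi * ξ)) + ρ' ξ * A₁' (2 * Real.pi * ξ))
    (j₂' : ∀ ξ : ℝ, P₂' (2 * Real.pi * ξ)
      = A₁ (-(2 * Real.pi * ξ)) + ρ' ξ * A₂' (2 * Real.pi * ξ))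
    {k k' : ℝ → ℂ} (hk : MemLp k 2 volume) (hk' : MemLp k' 2 volume)
    (hk0 : ∀ y ≤ 0, k y = 0) (hk0' : ∀ y ≤ 0, k' y = 0) {s s' : ℂ}
    (eq : ∀ y > 0, k' y + s * (invFour ρ y + p.kernel y) +
      ∫ z in Set.Ioi (0:ℝ), k z * (invFour ρ (z + y) + p.kernel (z + y)) = 0)
    (eq' : ∀ y > 0, k y + s' * (invFour ρ' y + p'.kernel y) +
      ∫ z in Set.Ioi (0:ℝ), k' z * (invFour ρ' (z + y) + p'.kernel (z + y)) = 0)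
    {α₁ α₂ : ℂ} (h₁ : (fun l => A₁ l - α₁ * l⁻¹) =O[upInf] fun l => (l ^ 2)⁻¹)
    (h₂ : (fun l => A₂ l - 1 - α₂ * l⁻¹) =O[upInf] fun l => (l ^ 2)⁻¹) :
    Tendsto k (𝓝[>] 0) (𝓝 (-Complex.I * (s' * α₁ + s * α₂))) := by
  obtain ⟨a, ha⟩ := exists_tendsto_of_marchenko hρ' d'.loc_im hk' hk0' eq'
  have h3 := tendsto_mul_coef hk ha
  have h4 := ((tendsto_mul_of_isBigO h₁).const_mul s').add ((tendsto_mul_of_isBigO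
    (f := fun l => A₂ l - 1) h₂).const_mul s)
  have hE : ∀ᶠ l in upInf, l ∉ Set.range p.loc :=
    upInf_le (Bornology.isBounded_def.1 (Set.finite_range p.loc).isBounded)
  have h5 : ∀ᶠ τ : ℝ in atTop, (τ : ℂ) * coef k (Complex.I * τ) 0
      = s' * ((τ : ℂ) * A₁ (Complex.I * τ)) + s * ((τ : ℂ) * (A₂ (Complex.I * τ) - 1)) := by
    filter_upwards [tendsto_I_mul_upInf.eventually hE, eventually_gt_atTop 0] with τ h1 h2
    have := coef_eq_of_marchenko d d' hρ hρ' j₁ j₂ j₁' j₂' hk hk' hk0 hk0' eq eq'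
      (μ := Complex.I * τ) (by simpa using h2) h1
    linear_combination (τ : ℂ) * this
  have h6 := tendsto_nhds_unique (h3.congr' h5) h4
  rw [h6] at ha
  convert ha using 2
  ring

end

/-! ### Volterra operators on the half line -/

/-- A continuous integrable function. -/
structure IsWeight (w : ℝ → ℂ) : Prop where
  cont : Continuous w
  int : Integrable w

/-- A function that is bounded and continuous. -/
structure IsBddCont (F : ℝ → ℂ) : Prop where
  cont : Continuous F
  bound : ∃ C, ∀ y, ‖F y‖ ≤ C

theorem IsWeight.mul {w F : ℝ → ℂ} (hw : IsWeight w) (hF : IsBddCont F) :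
    IsWeight fun y => w y * F y := by
  obtain ⟨C, hC⟩ := hF.bound
  exact ⟨hw.cont.mul hF.cont,
    hw.int.mul_bdd (c := C) hF.cont.aestronglyMeasurable (Eventually.of_forall hC)⟩

def phase (κ : ℂ) (x y : ℝ) : ℂ := Complex.exp (2 * Complex.I * κ * (y - x))

theorem norm_phase_le {κ : ℂ} (hκ : 0 ≤ κ.im) {x y : ℝ} (h : x ≤ y) : ‖phase κ x y‖ ≤ 1 := by
  rw [phase, Complex.norm_exp, Real.exp_le_one_iff]
  have : (2 * Complex.I * κ * (y - x)).re = -(2 * κ.im * (y - x)) := by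
    simp [Complex.mul_re, Complex.mul_im]
  rw [this]
  have : 0 ≤ y - x := sub_nonneg.2 h
  have : 0 ≤ 2 * κ.im * (y - x) := by positivity
  linarith

theorem continuous_phase (κ : ℂ) (x : ℝ) : Continuous (phase κ x) := by
  unfold phase; fun_prop

/-- `∫_x^∞ e^{2iκ(y-x)} w(y) F(y) dy`. -/
def volt (w : ℝ → ℂ) (κ : ℂ) (F : ℝ → ℂ) (x : ℝ) : ℂ :=
  ∫ y in Set.Ioi x, phase κ x y * (w y * F y)

theorem integrableOn_phase_mul {g : ℝ → ℂ} (hg : IsWeight g) {κ : ℂ} (hκ : 0 ≤ κ.im) (x z : ℝ)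
    (hxz : x ≤ z) : IntegrableOn (fun y => phase κ x y * g y) (Set.Ioi z) := by
  refine hg.int.norm.integrableOn.mono'
    ((continuous_phase κ x).mul hg.cont).aestronglyMeasurable ?_
  refine (ae_restrict_iff' measurableSet_Ioi).2 (Eventually.of_forall fun y hy => ?_)
  rw [norm_mul]
  exact mul_le_of_le_one_left (norm_nonneg _) (norm_phase_le hκ (hxz.trans (le_of_lt hy)))

theorem hasDerivAt_integral_Ioi {V : Type*} [NormedAddCommGroup V] [NormedSpace ℝ V]
    [CompleteSpace V] {f : ℝ → V} (hf : Continuous f)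
    (hi : ∀ a, IntegrableOn f (Set.Ioi a)) (x : ℝ) :
    HasDerivAt (fun x => ∫ y in Set.Ioi x, f y) (-f x) x := by
  have h1 : (fun x => ∫ y in Set.Ioi x, f y)
      = fun x => (∫ y in Set.Ioi (0:ℝ), f y) - ∫ y in (0:ℝ)..x, f y := by
    funext x
    rw [← intervalIntegral.integral_Ioi_sub_Ioi' (hi 0) (hi x)]
    abel
  rw [h1]
  have := (intervalIntegral.integral_hasDerivAt_right (hf.intervalIntegrable 0 x)
    (hf.stronglyMeasurableAtFilter _ _) hf.continuousAt).const_sub (∫ y in Set.Ioi (0:ℝ), f y)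
  exact this

/-- The phase splits into a factor depending on `x` and one depending on `y`, which reduces the
claim to the product rule and the fundamental theorem of calculus. -/
theorem hasDerivAt_volt {w F : ℝ → ℂ} (hw : IsWeight w) (hF : IsBddCont F) {κ : ℂ}
    (hκ : 0 ≤ κ.im) (x : ℝ) :
    HasDerivAt (volt w κ F) (-(2 * Complex.I * κ) * volt w κ F x - w x * F x) x := by
  have hg := hw.mul hF
  have hsplit : ∀ a y : ℝ, phase κ a y = phase κ a 0 * phase κ 0 y := by
    intro a y
    rw [phase, phase, phase, ← Complex.exp_add]; congr 1; push_cast; ring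
  have hcont : Continuous fun y => phase κ 0 y * (w y * F y) := (continuous_phase κ 0).mul hg.cont
  have hi : ∀ a, IntegrableOn (fun y => phase κ 0 y * (w y * F y)) (Set.Ioi a) := by
    intro a
    have h1 := (integrableOn_phase_mul hg hκ a a le_rfl).const_mul (phase κ 0 a)
    refine h1.congr (Eventually.of_forall fun y => ?_)
    simp only [← mul_assoc]
    congr 2
    rw [phase, phase, phase, ← Complex.exp_add]; congr 1; push_cast; ring
  have e : volt w κ F = fun x => phase κ x 0 * ∫ y in Set.Ioi x, phase κ 0 y * (w y * F y) := by
    funext a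
    rw [volt, ← integral_const_mul]
    refine integral_congr_ae (Eventually.of_forall fun y => ?_)
    simp only []
    rw [hsplit a y]; ring
  have hd1 : HasDerivAt (fun x : ℝ => phase κ x 0) (phase κ x 0 * (-(2 * Complex.I * κ))) x := by
    have h := ((((Complex.ofRealCLM.hasDerivAt (x := x)).const_sub ((0:ℝ) : ℂ)).const_mul
      (2 * Complex.I * κ))).cexp
    refine h.congr_deriv ?_
    simp [phase]
  have := hd1.mul (hasDerivAt_integral_Ioi hcont hi x)
  rw [e]
  refine this.congr_deriv ?_
  have h0 : phase κ x 0 * phase κ 0 x = 1 := by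
    rw [phase, phase, ← Complex.exp_add, ← Complex.exp_zero]; congr 1; push_cast; ring
  linear_combination -(w x * F x) * h0

theorem norm_volt_le {w F : ℝ → ℂ} {κ : ℂ} (hκ : 0 ≤ κ.im) {x : ℝ}
    {B : ℝ → ℝ} (hB : ∀ y, ‖F y‖ ≤ B y) (hi : IntegrableOn (fun y => ‖w y‖ * B y) (Set.Ioi x)) :
    ‖volt w κ F x‖ ≤ ∫ y in Set.Ioi x, ‖w y‖ * B y := by
  refine norm_integral_le_of_norm_le hi
    ((ae_restrict_iff' measurableSet_Ioi).2 (Eventually.of_forall fun y hy => ?_))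
  rw [norm_mul, norm_mul]
  calc ‖phase κ x y‖ * (‖w y‖ * ‖F y‖) ≤ 1 * (‖w y‖ * B y) := by
        gcongr
        · exact norm_phase_le hκ (le_of_lt hy)
        · exact hB y
    _ = _ := one_mul _

theorem norm_volt_le_const {w F : ℝ → ℂ} (hw : IsWeight w) {κ : ℂ} (hκ : 0 ≤ κ.im) (x : ℝ)
    {C : ℝ} (hC : ∀ y, ‖F y‖ ≤ C) : ‖volt w κ F x‖ ≤ (∫ y, ‖w y‖) * C := by
  have h0 : 0 ≤ C := (norm_nonneg _).trans (hC 0)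
  refine (norm_volt_le hκ hC (hw.int.norm.mul_const C).integrableOn).trans ?_
  rw [← integral_mul_const]
  exact setIntegral_le_integral (hw.int.norm.mul_const C)
    (Eventually.of_forall fun y => by positivity)

theorem isBddCont_volt {w F : ℝ → ℂ} (hw : IsWeight w) (hF : IsBddCont F) {κ : ℂ}
    (hκ : 0 ≤ κ.im) : IsBddCont (volt w κ F) := by
  obtain ⟨C, hC⟩ := hF.bound
  exact ⟨continuous_iff_continuousAt.2 fun x => (hasDerivAt_volt hw hF hκ x).continuousAt,
    _, fun x => norm_volt_le_const hw hκ x hC⟩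

theorem tendsto_integral_Ioi_atTop {V : Type*} [NormedAddCommGroup V] [NormedSpace ℝ V]
    {f : ℝ → V} (hf : Integrable f) :
    Tendsto (fun x => ∫ y in Set.Ioi x, f y) atTop (𝓝 0) := by
  have h1 := intervalIntegral_tendsto_integral_Ioi 0 hf.integrableOn tendsto_id
  have h2 := h1.const_sub (∫ y in Set.Ioi (0:ℝ), f y)
  rw [sub_self] at h2
  refine h2.congr fun x => ?_
  rw [← intervalIntegral.integral_Ioi_sub_Ioi' hf.integrableOn hf.integrableOn]
  simp

theorem tendsto_volt {w F : ℝ → ℂ} (hw : IsWeight w) (hF : IsBddCont F) {κ : ℂ}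
    (hκ : 0 ≤ κ.im) : Tendsto (volt w κ F) atTop (𝓝 0) := by
  have hg := (hw.mul hF)
  have h := tendsto_integral_Ioi_atTop (f := fun y => ((‖w y‖ * ‖F y‖ : ℝ) : ℂ))
    (by simpa using hg.int.norm.ofReal (𝕜 := ℂ))
  have hn := h.norm
  rw [norm_zero] at hn
  refine squeeze_zero_norm (fun x => ?_) hn
  refine (norm_volt_le hκ (fun y => le_rfl) ?_).trans ?_
  · simpa using hg.int.norm.integrableOn
  · rw [integral_complex_ofReal, Complex.norm_real]
    exact le_abs_self _

/-- Integration by parts in a Volterra operator. -/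
theorem two_I_mul_volt {w w' F F' : ℝ → ℂ} (hw : IsWeight w) (hw' : IsWeight w')
    (hwd : ∀ y, HasDerivAt w (w' y) y) (hw0 : Tendsto w atTop (𝓝 0)) (hF : IsBddCont F)
    (hF' : IsBddCont F') (hFd : ∀ y, HasDerivAt F (F' y) y) {κ : ℂ} (hκ : 0 ≤ κ.im) (x : ℝ) :
    2 * Complex.I * κ * volt w κ F x = -(w x * F x) - volt w' κ F x - volt w κ F' x := by
  have i1 := integrableOn_phase_mul (hw.mul hF) hκ x x le_rfl
  have i2 := integrableOn_phase_mul (hw'.mul hF) hκ x x le_rfl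
  have i3 := integrableOn_phase_mul (hw.mul hF') hκ x x le_rfl
  have hd : ∀ y ∈ Set.Ici x, HasDerivAt (fun y => phase κ x y * (w y * F y))
      (2 * Complex.I * κ * (phase κ x y * (w y * F y)) + phase κ x y * (w' y * F y)
        + phase κ x y * (w y * F' y)) y := by
    intro y _
    have hd1 : HasDerivAt (phase κ x) (phase κ x y * (2 * Complex.I * κ)) y := by
      have h := ((((Complex.ofRealCLM.hasDerivAt (x := y)).sub_const (x : ℂ)).const_mul
        (2 * Complex.I * κ))).cexp
      refine h.congr_deriv ?_
      simp [phase]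
    refine (hd1.mul ((hwd y).mul (hFd y))).congr_deriv ?_
    rw [Pi.mul_apply]
    ring
  have hlim : Tendsto (fun y => phase κ x y * (w y * F y)) atTop (𝓝 0) := by
    obtain ⟨C, hC⟩ := hF.bound
    have := hw0.norm.mul_const C
    rw [norm_zero, zero_mul] at this
    refine squeeze_zero_norm' ?_ this
    filter_upwards [eventually_ge_atTop x] with y hy
    rw [norm_mul, norm_mul]
    calc _ ≤ 1 * (‖w y‖ * C) := by
          gcongr
          · exact norm_phase_le hκ hy
          · exact hC y
      _ = _ := one_mul _
  have h := integral_Ioi_of_hasDerivAt_of_tendsto' hd (((i1.const_mul _).add i2).add i3) hlim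
  have a1 := integral_add ((i1.const_mul (2 * Complex.I * κ)).add i2) i3
  have a2 := integral_add (i1.const_mul (2 * Complex.I * κ)) i2
  simp only [Pi.add_apply] at a1
  rw [a1, a2, integral_const_mul] at h
  have hx : phase κ x x = 1 := by simp [phase]
  rw [hx] at h
  simp only [volt]
  linear_combination h

theorem volt_hasSum {w : ℝ → ℂ} (hw : IsWeight w) {κ : ℂ} (hκ : 0 ≤ κ.im) {F : ℕ → ℝ → ℂ}
    (hF : ∀ n, Continuous (F n)) {B : ℕ → ℝ} (hB : Summable B) (hFB : ∀ n y, ‖F n y‖ ≤ B n)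
    (x : ℝ) : HasSum (fun n => volt w κ (F n) x) (volt w κ (fun y => ∑' n, F n y) x) := by
  have hi : ∀ n, Integrable (fun y => phase κ x y * (w y * F n y))
      (volume.restrict (Set.Ioi x)) := fun n =>
    integrableOn_phase_mul (hw.mul ⟨hF n, B n, hFB n⟩) hκ x x le_rfl
  have hB0 : ∀ n, 0 ≤ B n := fun n => (norm_nonneg _).trans (hFB n 0)
  have hs : Summable fun n => ∫ y in Set.Ioi x, ‖phase κ x y * (w y * F n y)‖ := by
    refine Summable.of_nonneg_of_le (fun n => integral_nonneg fun y => norm_nonneg _) (fun n => ?_)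
      (hB.mul_left (∫ y in Set.Ioi x, ‖w y‖))
    rw [← integral_mul_const]
    refine integral_mono_ae (hi n).norm (hw.int.norm.mul_const _).integrableOn
      ((ae_restrict_iff' measurableSet_Ioi).2 (Eventually.of_forall fun y hy => ?_))
    simp only [norm_mul]
    calc _ ≤ 1 * (‖w y‖ * B n) := by
          gcongr
          · exact norm_phase_le hκ (le_of_lt hy)
          · exact hFB n y
      _ = _ := one_mul _
  have h := hasSum_integral_of_summable_integral_norm hi hs
  have e : volt w κ (fun y => ∑' n, F n y) x
      = ∫ y in Set.Ioi x, ∑' n, phase κ x y * (w y * F n y) := by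
    rw [volt]
    refine integral_congr_ae (Eventually.of_forall fun y => ?_)
    simp only [tsum_mul_left]
  rw [e]
  exact h

/-- Holomorphic dependence of a dominated integral on a parameter. -/
theorem differentiableOn_integral {α : Type*} [MeasurableSpace α] {m : Measure α}
    {f : ℂ → α → ℂ} {U : Set ℂ} (hU : IsOpen U)
    (hm : ∀ l ∈ U, AEStronglyMeasurable (f l) m)
    (hd : ∀ᵐ t ∂m, DifferentiableOn ℂ (fun l => f l t) U) {b : α → ℝ} (hb : Integrable b m)
    (hfb : ∀ᵐ t ∂m, ∀ l ∈ U, ‖f l t‖ ≤ b t) :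
    DifferentiableOn ℂ (fun l => ∫ t, f l t ∂m) U := by
  intro l₀ hl₀
  obtain ⟨R, hR, hRU⟩ := Metric.isOpen_iff.1 hU l₀ hl₀
  have hR2 : 0 < R / 2 := by positivity
  have hball : ∀ l ∈ Metric.ball l₀ (R / 2), Metric.closedBall l (R / 4) ⊆ U := by
    intro l hl z hz
    apply hRU
    rw [Metric.mem_ball] at hl ⊢
    rw [Metric.mem_closedBall] at hz
    linarith [dist_triangle z l l₀]
  have hsub : Metric.ball l₀ (R / 2) ⊆ U := fun l hl =>
    hball l hl (Metric.mem_closedBall_self (by positivity))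
  have hdl : ∀ᵐ t ∂m, ∀ l ∈ Metric.ball l₀ (R / 2),
      HasDerivAt (fun l => f l t) (deriv (fun l => f l t) l) l := by
    filter_upwards [hd] with t ht l hl
    exact (ht.differentiableAt (hU.mem_nhds (hsub hl))).hasDerivAt
  refine (hasDerivAt_integral_of_dominated_loc_of_deriv_le (μ := m) (𝕜 := ℂ)
    (F' := fun l t => deriv (fun l => f l t) l) (bound := fun t => b t / (R / 4))
    (Metric.ball_mem_nhds l₀ hR2) ?_ ?_ ?_ ?_ (hb.div_const _) hdl).2.differentiableAt.differentiableWithinAt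
  · filter_upwards [hU.mem_nhds hl₀] with l hl using hm l hl
  · refine hb.mono' (hm l₀ hl₀) ?_
    filter_upwards [hfb] with t ht using ht l₀ hl₀
  · have hseq : Tendsto (fun n : ℕ => l₀ + ((R / 4) * ((n : ℝ) + 1)⁻¹ : ℝ)) atTop (𝓝[≠] l₀) := by
      refine tendsto_nhdsWithin_iff.2 ⟨?_, Eventually.of_forall fun n => ?_⟩
      · have h1 : Tendsto (fun n : ℕ => (R / 4) * ((n : ℝ) + 1)⁻¹) atTop (𝓝 0) := by
          have := (tendsto_one_div_add_atTop_nhds_zero_nat (𝕜 := ℝ)).const_mul (R / 4)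
          simpa using this
        have h2 := ((Complex.continuous_ofReal.tendsto 0).comp h1).const_add l₀
        simpa using h2
      · have : (R / 4) * ((n : ℝ) + 1)⁻¹ ≠ 0 := by positivity
        simp only [Set.mem_compl_iff, Set.mem_singleton_iff, add_eq_left]
        exact_mod_cast this
    have hU' : ∀ n : ℕ, l₀ + ((R / 4) * ((n : ℝ) + 1)⁻¹ : ℝ) ∈ U := by
      intro n
      apply hRU
      rw [Metric.mem_ball, dist_eq_norm, add_sub_cancel_left, Complex.norm_real,
        Real.norm_of_nonneg (by positivity)]
      have : ((n : ℝ) + 1)⁻¹ ≤ 1 := inv_le_one_of_one_le₀ (by linarith [n.cast_nonneg (α := ℝ)])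
      nlinarith
    refine aestronglyMeasurable_of_tendsto_ae atTop
      (f := fun (n : ℕ) t => slope (fun l => f l t) l₀ (l₀ + ((R / 4) * ((n : ℝ) + 1)⁻¹ : ℝ)))
      (fun n => ?_) ?_
    · simp only [slope_def_field]
      exact ((hm _ (hU' n)).sub (hm _ hl₀)).mul_const _
    · filter_upwards [hdl] with t ht
      exact (ht l₀ (Metric.mem_ball_self hR2)).tendsto_slope.comp hseq
  · filter_upwards [hd, hfb] with t ht htb l hl
    refine Complex.norm_deriv_le_of_forall_mem_sphere_norm_le (by positivity)
      (ht.diffContOnCl_ball (hball l hl)) (fun z hz => htb z ?_)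
    exact hball l hl (Metric.sphere_subset_closedBall hz)

/-! ### Jost functions of the Zakharov–Shabat system by Picard iteration -/

section

theorem continuousOn_volt {w : ℝ → ℂ} (hw : IsWeight w) {κ : ℂ → ℂ} (hκ : Continuous κ)
    (hκ0 : ∀ l : ℂ, 0 ≤ l.im → 0 ≤ (κ l).im) {F : ℂ → ℝ → ℂ}
    (hFc : ∀ l : ℂ, 0 ≤ l.im → Continuous (F l))
    (hFl : ∀ y, ContinuousOn (fun l => F l y) {l : ℂ | 0 ≤ l.im}) {C : ℝ}
    (hC : ∀ l : ℂ, 0 ≤ l.im → ∀ y, ‖F l y‖ ≤ C) (x : ℝ) :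
    ContinuousOn (fun l => volt w (κ l) (F l) x) {l : ℂ | 0 ≤ l.im} := by
  refine continuousOn_of_dominated (bound := fun y => ‖w y‖ * C) (fun l hl => ?_) (fun l hl => ?_)
    (hw.int.norm.mul_const C).integrableOn (Eventually.of_forall fun y => ?_)
  · exact ((continuous_phase (κ l) x).mul (hw.cont.mul (hFc l hl))).aestronglyMeasurable
  · refine (ae_restrict_iff' measurableSet_Ioi).2 (Eventually.of_forall fun y hy => ?_)
    rw [norm_mul, norm_mul]
    calc _ ≤ 1 * (‖w y‖ * C) := by
          gcongr
          · exact norm_phase_le (hκ0 l hl) (le_of_lt hy)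
          · exact hC l hl y
      _ = _ := one_mul _
  · refine ContinuousOn.mul ?_ (continuousOn_const.mul (hFl y))
    have : Continuous fun l => phase (κ l) x y := by unfold phase; fun_prop
    exact this.continuousOn

theorem differentiableOn_volt {w : ℝ → ℂ} (hw : IsWeight w) {κ : ℂ → ℂ} (hκ : Differentiable ℂ κ)
    (hκ0 : ∀ l : ℂ, 0 < l.im → 0 ≤ (κ l).im) {F : ℂ → ℝ → ℂ}
    (hFc : ∀ l : ℂ, 0 < l.im → Continuous (F l))
    (hFl : ∀ y, DifferentiableOn ℂ (fun l => F l y) {l : ℂ | 0 < l.im}) {C : ℝ}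
    (hC : ∀ l : ℂ, 0 < l.im → ∀ y, ‖F l y‖ ≤ C) (x : ℝ) :
    DifferentiableOn ℂ (fun l => volt w (κ l) (F l) x) {l : ℂ | 0 < l.im} := by
  refine differentiableOn_integral isOpen_upper (b := fun y => ‖w y‖ * C) (fun l hl => ?_)
    (Eventually.of_forall fun y => ?_) (hw.int.norm.mul_const C).integrableOn ?_
  · exact ((continuous_phase (κ l) x).mul (hw.cont.mul (hFc l hl))).aestronglyMeasurable
  · refine DifferentiableOn.mul ?_ ((hFl y).const_mul _)
    have : Differentiable ℂ fun l => phase (κ l) x y := by unfold phase; fun_prop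
    exact this.differentiableOn
  · refine (ae_restrict_iff' measurableSet_Ioi).2 (Eventually.of_forall fun y hy l hl => ?_)
    rw [norm_mul, norm_mul]
    calc _ ≤ 1 * (‖w y‖ * C) := by
          gcongr
          · exact norm_phase_le (hκ0 l hl) (le_of_lt hy)
          · exact hC l hl y
      _ = _ := one_mul _

theorem isWeight_schwartz (w : 𝓢(ℝ, ℂ)) : IsWeight w := ⟨w.continuous, w.integrable⟩

theorem isBddCont_schwartz (w : 𝓢(ℝ, ℂ)) : IsBddCont w :=
  ⟨w.continuous, _, SchwartzMap.norm_le_seminorm ℝ w⟩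

theorem IsBddCont.mul {F G : ℝ → ℂ} (hF : IsBddCont F) (hG : IsBddCont G) :
    IsBddCont fun y => F y * G y := by
  obtain ⟨C, hC⟩ := hF.bound
  obtain ⟨D, hD⟩ := hG.bound
  refine ⟨hF.cont.mul hG.cont, C * D, fun y => ?_⟩
  rw [norm_mul]
  exact mul_le_mul (hC y) (hD y) (norm_nonneg _) ((norm_nonneg _).trans (hC y))

theorem tendsto_schwartz_atTop (w : 𝓢(ℝ, ℂ)) : Tendsto w atTop (𝓝 0) :=
  w.tendsto_cocompact.mono_left atTop_le_cocompact

/-- `(m₁, m₂)` is `e^{-iλx}` times the solution of `α' = -iλα + uβ`, `β' = iλβ + vα` that behaves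
like `(0, e^{iλx})` at `+∞`, for `Im λ ≥ 0`. -/
structure IsJost (u v : ℝ → ℂ) (m₁ m₂ : ℂ → ℝ → ℂ) : Prop where
  cont₁ : ∀ l : ℂ, 0 ≤ l.im → Continuous (m₁ l)
  cont₂ : ∀ l : ℂ, 0 ≤ l.im → Continuous (m₂ l)
  contOn₁ : ∀ x, ContinuousOn (fun l => m₁ l x) {l : ℂ | 0 ≤ l.im}
  contOn₂ : ∀ x, ContinuousOn (fun l => m₂ l x) {l : ℂ | 0 ≤ l.im}
  diffOn₁ : ∀ x, DifferentiableOn ℂ (fun l => m₁ l x) {l : ℂ | 0 < l.im}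
  diffOn₂ : ∀ x, DifferentiableOn ℂ (fun l => m₂ l x) {l : ℂ | 0 < l.im}
  bound : ∃ C, ∀ l : ℂ, 0 ≤ l.im → ∀ x, ‖m₁ l x‖ ≤ C ∧ ‖m₂ l x‖ ≤ C
  eq₁ : ∀ l : ℂ, 0 ≤ l.im → ∀ x, m₁ l x = -volt u l (m₂ l) x
  eq₂ : ∀ l : ℂ, 0 ≤ l.im → ∀ x, m₂ l x = 1 - volt v 0 (m₁ l) x

section Construction

variable (u v : 𝓢(ℝ, ℂ))

/-- The Picard iterates. -/
def jostTerm : ℕ → (ℂ → ℝ → ℂ) × (ℂ → ℝ → ℂ)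
  | 0 => (fun _ _ => 0, fun _ _ => 1)
  | n + 1 => (fun l x => -volt u l ((jostTerm n).2 l) x, fun l x => -volt v 0 ((jostTerm n).1 l) x)

/-- A weight adapted to the Volterra operators. Since `(‖u‖ + ‖v‖) · tailExp` is `-1/2` times the
derivative of `tailExp`, one Picard step contracts the weighted norm by `1/2`. The series is
therefore geometric, uniformly in `l` and `x`, with no smallness assumption on the potentials. -/
def tailExp (x : ℝ) : ℝ := Real.exp (2 * ∫ y in Set.Ioi x, (‖u y‖ + ‖v y‖))

theorem integrable_norm_add : Integrable fun y => ‖u y‖ + ‖v y‖ := u.integrable.norm.add v.integrable.norm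

theorem continuous_norm_add : Continuous fun y => ‖u y‖ + ‖v y‖ :=
  u.continuous.norm.add v.continuous.norm

theorem hasDerivAt_tailExp (x : ℝ) :
    HasDerivAt (tailExp u v) (-2 * ((‖u x‖ + ‖v x‖) * tailExp u v x)) x := by
  have h := ((hasDerivAt_integral_Ioi (continuous_norm_add u v)
    (fun a => (integrable_norm_add u v).integrableOn) x).const_mul 2).exp
  refine h.congr_deriv ?_
  rw [tailExp]; ring

theorem one_le_tailExp (x : ℝ) : 1 ≤ tailExp u v x :=
  Real.one_le_exp (mul_nonneg zero_le_two (integral_nonneg fun y => by positivity))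

theorem tailExp_le (x : ℝ) : tailExp u v x ≤ Real.exp (2 * ∫ y, (‖u y‖ + ‖v y‖)) := by
  refine Real.exp_le_exp.2 (mul_le_mul_of_nonneg_left ?_ zero_le_two)
  exact setIntegral_le_integral (integrable_norm_add u v) (Eventually.of_forall fun y => by positivity)

theorem continuous_tailExp : Continuous (tailExp u v) :=
  continuous_iff_continuousAt.2 fun x => (hasDerivAt_tailExp u v x).continuousAt

theorem integrable_mul_tailExp {w : ℝ → ℝ} (hw : Integrable w) :
    Integrable fun y => w y * tailExp u v y := by
  refine hw.mul_bdd (c := Real.exp (2 * ∫ y, (‖u y‖ + ‖v y‖)))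
    (continuous_tailExp u v).aestronglyMeasurable (Eventually.of_forall fun y => ?_)
  rw [Real.norm_of_nonneg (zero_le_one.trans (one_le_tailExp u v y))]
  exact tailExp_le u v y

/-- The integrand is an exact derivative up to the factor `-1/2`, and the weight tends to `1` at
`+∞`; the integral is in fact `(tailExp x - 1) / 2`. -/
theorem integral_mul_tailExp_le (x : ℝ) :
    ∫ y in Set.Ioi x, (‖u y‖ + ‖v y‖) * tailExp u v y ≤ tailExp u v x / 2 := by
  have hlim : Tendsto (tailExp u v) atTop (𝓝 1) := by
    have h := (tendsto_integral_Ioi_atTop (integrable_norm_add u v)).const_mul 2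
    rw [mul_zero] at h
    have := (Real.continuous_exp.tendsto 0).comp h
    rwa [Real.exp_zero] at this
  have h := integral_Ioi_of_hasDerivAt_of_tendsto' (a := x)
    (fun y _ => hasDerivAt_tailExp u v y)
    ((integrable_mul_tailExp u v (integrable_norm_add u v)).const_mul (-2)).integrableOn hlim
  rw [integral_const_mul] at h
  linarith

theorem continuous_jostTerm (n : ℕ) (l : ℂ) (hl : 0 ≤ l.im) :
    IsBddCont ((jostTerm u v n).1 l) ∧ IsBddCont ((jostTerm u v n).2 l) := by
  induction n with
  | zero => exact ⟨⟨continuous_const, 0, by simp [jostTerm]⟩, ⟨continuous_const, 1, by simp [jostTerm]⟩⟩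
  | succ n ih =>
    have h1 := isBddCont_volt (isWeight_schwartz u) ih.2 hl
    have h2 := isBddCont_volt (isWeight_schwartz v) ih.1 (κ := 0) le_rfl
    refine ⟨⟨h1.cont.neg, ?_⟩, ⟨h2.cont.neg, ?_⟩⟩
    · obtain ⟨C, hC⟩ := h1.bound
      exact ⟨C, fun y => by simpa [jostTerm] using hC y⟩
    · obtain ⟨C, hC⟩ := h2.bound
      exact ⟨C, fun y => by simpa [jostTerm] using hC y⟩

theorem norm_volt_tail_le {w : 𝓢(ℝ, ℂ)} (hw : ∀ y, ‖w y‖ ≤ ‖u y‖ + ‖v y‖) {κ : ℂ} (hκ : 0 ≤ κ.im)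
    {F : ℝ → ℂ} {c : ℝ} (hc : 0 ≤ c) (hF : ∀ y, ‖F y‖ ≤ c * tailExp u v y) (x : ℝ) :
    ‖volt w κ F x‖ ≤ c * (1 / 2) * tailExp u v x := by
  have hi : Integrable fun y => ‖w y‖ * (c * tailExp u v y) := by
    refine ((integrable_mul_tailExp u v w.integrable.norm).const_mul c).congr
      (Eventually.of_forall fun y => ?_)
    simp only []; ring
  refine (norm_volt_le hκ hF hi.integrableOn).trans ?_
  calc ∫ y in Set.Ioi x, ‖w y‖ * (c * tailExp u v y)
      ≤ ∫ y in Set.Ioi x, c * ((‖u y‖ + ‖v y‖) * tailExp u v y) := by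
        refine integral_mono hi.integrableOn
          ((integrable_mul_tailExp u v (integrable_norm_add u v)).const_mul c).integrableOn
          fun y => ?_
        simp only []
        rw [mul_left_comm]
        gcongr
        · exact zero_le_one.trans (one_le_tailExp u v y)
        · exact hw y
    _ ≤ c * (tailExp u v x / 2) := by
        rw [integral_const_mul]
        gcongr
        exact integral_mul_tailExp_le u v x
    _ = _ := by ring

theorem norm_jostTerm_le (n : ℕ) (l : ℂ) (hl : 0 ≤ l.im) (x : ℝ) :
    ‖(jostTerm u v n).1 l x‖ ≤ (1 / 2) ^ n * tailExp u v x ∧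
      ‖(jostTerm u v n).2 l x‖ ≤ (1 / 2) ^ n * tailExp u v x := by
  induction n generalizing x with
  | zero =>
    have := one_le_tailExp u v x
    simp only [jostTerm, norm_zero, pow_zero, one_mul, norm_one]
    exact ⟨by linarith, this⟩
  | succ n ih =>
    simp only [jostTerm, norm_neg, pow_succ]
    exact ⟨norm_volt_tail_le u v (fun y => by simp) hl (by positivity) (fun y => (ih y).2) x,
      norm_volt_tail_le u v (fun y => by simp) (κ := 0) le_rfl (by positivity)
        (fun y => (ih y).1) x⟩

theorem norm_jostTerm_le' (n : ℕ) (l : ℂ) (hl : 0 ≤ l.im) (x : ℝ) :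
    ‖(jostTerm u v n).1 l x‖ ≤ (1 / 2) ^ n * Real.exp (2 * ∫ y, (‖u y‖ + ‖v y‖)) ∧
      ‖(jostTerm u v n).2 l x‖ ≤ (1 / 2) ^ n * Real.exp (2 * ∫ y, (‖u y‖ + ‖v y‖)) := by
  have h := norm_jostTerm_le u v n l hl x
  have h2 := mul_le_mul_of_nonneg_left (tailExp_le u v x) (show (0:ℝ) ≤ (1 / 2) ^ n by positivity)
  exact ⟨h.1.trans h2, h.2.trans h2⟩

theorem continuousOn_jostTerm (n : ℕ) (x : ℝ) :
    ContinuousOn (fun l => (jostTerm u v n).1 l x) {l : ℂ | 0 ≤ l.im} ∧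
      ContinuousOn (fun l => (jostTerm u v n).2 l x) {l : ℂ | 0 ≤ l.im} := by
  induction n generalizing x with
  | zero => exact ⟨continuousOn_const, continuousOn_const⟩
  | succ n ih =>
    exact ⟨(continuousOn_volt (isWeight_schwartz u) continuous_id (fun l hl => hl)
        (fun l hl => (continuous_jostTerm u v n l hl).2.cont) (fun y => (ih y).2)
        (fun l hl y => (norm_jostTerm_le' u v n l hl y).2) x).neg,
      (continuousOn_volt (isWeight_schwartz v) (κ := fun _ => 0) continuous_const
        (fun l hl => le_rfl)
        (fun l hl => (continuous_jostTerm u v n l hl).1.cont) (fun y => (ih y).1)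
        (fun l hl y => (norm_jostTerm_le' u v n l hl y).1) x).neg⟩

theorem differentiableOn_jostTerm (n : ℕ) (x : ℝ) :
    DifferentiableOn ℂ (fun l => (jostTerm u v n).1 l x) {l : ℂ | 0 < l.im} ∧
      DifferentiableOn ℂ (fun l => (jostTerm u v n).2 l x) {l : ℂ | 0 < l.im} := by
  induction n generalizing x with
  | zero => exact ⟨differentiableOn_const _, differentiableOn_const _⟩
  | succ n ih =>
    exact ⟨(differentiableOn_volt (isWeight_schwartz u) differentiable_id (fun l hl => le_of_lt hl)
        (fun l hl => (continuous_jostTerm u v n l (le_of_lt hl)).2.cont) (fun y => (ih y).2)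
        (fun l hl y => (norm_jostTerm_le' u v n l (le_of_lt hl) y).2) x).neg,
      (differentiableOn_volt (isWeight_schwartz v) (κ := fun _ => 0) (differentiable_const _)
        (fun l hl => le_rfl)
        (fun l hl => (continuous_jostTerm u v n l (le_of_lt hl)).1.cont) (fun y => (ih y).1)
        (fun l hl y => (norm_jostTerm_le' u v n l (le_of_lt hl) y).1) x).neg⟩

theorem summable_jost_bound :
    Summable fun n : ℕ => (1 / 2 : ℝ) ^ n * Real.exp (2 * ∫ y, (‖u y‖ + ‖v y‖)) :=
  summable_geometric_two.mul_right _

/-- The Picard series has a summable majorant independent of `l` and `x`. Continuity, holomorphy and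
the Volterra equations therefore pass to the sum term by term. -/
theorem exists_isJost : ∃ m₁ m₂, IsJost u v m₁ m₂ := by
  have hB := summable_jost_bound u v
  have s1 : ∀ l : ℂ, 0 ≤ l.im → ∀ x, Summable fun n => (jostTerm u v n).1 l x := fun l hl x =>
    hB.of_norm_bounded fun n => (norm_jostTerm_le' u v n l hl x).1
  have s2 : ∀ l : ℂ, 0 ≤ l.im → ∀ x, Summable fun n => (jostTerm u v n).2 l x := fun l hl x =>
    hB.of_norm_bounded fun n => (norm_jostTerm_le' u v n l hl x).2
  refine ⟨fun l x => ∑' n, (jostTerm u v n).1 l x, fun l x => ∑' n, (jostTerm u v n).2 l x, ?_⟩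
  constructor
  · exact fun l hl => continuous_tsum (fun n => (continuous_jostTerm u v n l hl).1.cont) hB
      fun n x => (norm_jostTerm_le' u v n l hl x).1
  · exact fun l hl => continuous_tsum (fun n => (continuous_jostTerm u v n l hl).2.cont) hB
      fun n x => (norm_jostTerm_le' u v n l hl x).2
  · exact fun x => continuousOn_tsum (fun n => (continuousOn_jostTerm u v n x).1) hB
      fun n l hl => (norm_jostTerm_le' u v n l hl x).1
  · exact fun x => continuousOn_tsum (fun n => (continuousOn_jostTerm u v n x).2) hB
      fun n l hl => (norm_jostTerm_le' u v n l hl x).2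
  · exact fun x => Complex.differentiableOn_tsum_of_summable_norm hB
      (fun n => (differentiableOn_jostTerm u v n x).1) isOpen_upper
      fun n l hl => (norm_jostTerm_le' u v n l (le_of_lt hl) x).1
  · exact fun x => Complex.differentiableOn_tsum_of_summable_norm hB
      (fun n => (differentiableOn_jostTerm u v n x).2) isOpen_upper
      fun n l hl => (norm_jostTerm_le' u v n l (le_of_lt hl) x).2
  · exact ⟨_, fun l hl x => ⟨tsum_of_norm_bounded hB.hasSum
      fun n => (norm_jostTerm_le' u v n l hl x).1, tsum_of_norm_bounded hB.hasSum
      fun n => (norm_jostTerm_le' u v n l hl x).2⟩⟩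
  · intro l hl x
    have h := volt_hasSum (isWeight_schwartz u) hl
      (fun n => (continuous_jostTerm u v n l hl).2.cont) hB
      (fun n y => (norm_jostTerm_le' u v n l hl y).2) x
    rw [(s1 l hl x).tsum_eq_zero_add, ← h.tsum_eq, ← tsum_neg]
    simp [jostTerm]
  · intro l hl x
    have h := volt_hasSum (isWeight_schwartz v) (κ := 0) le_rfl
      (fun n => (continuous_jostTerm u v n l hl).1.cont) hB
      (fun n y => (norm_jostTerm_le' u v n l hl y).1) x
    rw [(s2 l hl x).tsum_eq_zero_add, ← h.tsum_eq, sub_eq_add_neg, ← tsum_neg]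
    simp [jostTerm]

end Construction

end

/-! ### Large-`λ` asymptotics of the Jost functions -/

section

namespace IsJost

variable {u v : 𝓢(ℝ, ℂ)} {m₁ m₂ : ℂ → ℝ → ℂ}

theorem bdd₁ (h : IsJost u v m₁ m₂) {l : ℂ} (hl : 0 ≤ l.im) : IsBddCont (m₁ l) :=
  ⟨h.cont₁ l hl, h.bound.imp fun _ hC x => (hC l hl x).1⟩

theorem bdd₂ (h : IsJost u v m₁ m₂) {l : ℂ} (hl : 0 ≤ l.im) : IsBddCont (m₂ l) :=
  ⟨h.cont₂ l hl, h.bound.imp fun _ hC x => (hC l hl x).2⟩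

theorem hasDerivAt₁ (h : IsJost u v m₁ m₂) {l : ℂ} (hl : 0 ≤ l.im) (x : ℝ) :
    HasDerivAt (m₁ l) (-2 * Complex.I * l * m₁ l x + u x * m₂ l x) x := by
  have h1 := (hasDerivAt_volt (isWeight_schwartz u) (h.bdd₂ hl) hl x).neg
  rw [show m₁ l = -volt u l (m₂ l) from funext fun y => h.eq₁ l hl y]
  refine h1.congr_deriv ?_
  rw [Pi.neg_apply]; ring

theorem hasDerivAt₂ (h : IsJost u v m₁ m₂) {l : ℂ} (hl : 0 ≤ l.im) (x : ℝ) :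
    HasDerivAt (m₂ l) (v x * m₁ l x) x := by
  have h1 := (hasDerivAt_volt (isWeight_schwartz v) (h.bdd₁ hl) (κ := 0) le_rfl x).const_sub 1
  rw [show m₂ l = fun y => 1 - volt v 0 (m₁ l) y from funext fun y => h.eq₂ l hl y]
  refine h1.congr_deriv ?_
  ring

theorem tendsto₁ (h : IsJost u v m₁ m₂) {l : ℂ} (hl : 0 ≤ l.im) :
    Tendsto (m₁ l) atTop (𝓝 0) := by
  have h1 := (tendsto_volt (isWeight_schwartz u) (h.bdd₂ hl) hl).neg
  rw [neg_zero] at h1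
  exact h1.congr fun y => (h.eq₁ l hl y).symm

theorem tendsto₂ (h : IsJost u v m₁ m₂) {l : ℂ} (hl : 0 ≤ l.im) :
    Tendsto (m₂ l) atTop (𝓝 1) := by
  have h1 := (tendsto_volt (isWeight_schwartz v) (h.bdd₁ hl) (κ := 0) le_rfl).const_sub 1
  rw [sub_zero] at h1
  exact h1.congr fun y => (h.eq₂ l hl y).symm

/-- Integrating by parts against the phase gains a factor `1 / l`, and nothing is lost, because `m₂'
= v m₁` contains no factor `l`. This is the source of all the decay estimates below. -/
theorem two_I_mul_volt_m₂ (h : IsJost u v m₁ m₂) (w : 𝓢(ℝ, ℂ)) {l : ℂ} (hl : 0 ≤ l.im) (x : ℝ) :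
    2 * Complex.I * l * volt w l (m₂ l) x = -(w x * m₂ l x)
      - volt (SchwartzMap.derivCLM ℂ ℂ w) l (m₂ l) x - volt w l (fun y => v y * m₁ l y) x := by
  refine two_I_mul_volt (isWeight_schwartz w) (isWeight_schwartz _) (fun y => ?_)
    (tendsto_schwartz_atTop w) (h.bdd₂ hl) ((isBddCont_schwartz v).mul (h.bdd₁ hl))
    (fun y => h.hasDerivAt₂ hl y) hl x
  simpa using w.hasDerivAt y

theorem norm_volt_m₂_le (h : IsJost u v m₁ m₂) (w : 𝓢(ℝ, ℂ)) :
    ∃ C, ∀ l : ℂ, 0 ≤ l.im → l ≠ 0 → ∀ x, ‖volt w l (m₂ l) x‖ ≤ C / ‖l‖ := by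
  obtain ⟨M, hM⟩ := h.bound
  obtain ⟨W, hW⟩ := (isBddCont_schwartz w).bound
  obtain ⟨V, hV⟩ := (isBddCont_schwartz v).bound
  have hM0 : 0 ≤ M := (norm_nonneg _).trans (hM 0 (by simp) 0).1
  have hW0 : 0 ≤ W := (norm_nonneg _).trans (hW 0)
  have hV0 : 0 ≤ V := (norm_nonneg _).trans (hV 0)
  set w' := SchwartzMap.derivCLM ℂ ℂ w
  refine ⟨(W * M + (∫ y, ‖w' y‖) * M + (∫ y, ‖w y‖) * (V * M)) / 2, fun l hl hl0 x => ?_⟩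
  have e := h.two_I_mul_volt_m₂ w hl x
  have b1 : ‖w x * m₂ l x‖ ≤ W * M := by
    rw [norm_mul]; exact mul_le_mul (hW x) (hM l hl x).2 (norm_nonneg _) hW0
  have b2 : ‖volt w' l (m₂ l) x‖ ≤ (∫ y, ‖w' y‖) * M :=
    norm_volt_le_const (isWeight_schwartz w') hl x fun y => (hM l hl y).2
  have b3 : ‖volt w l (fun y => v y * m₁ l y) x‖ ≤ (∫ y, ‖w y‖) * (V * M) :=
    norm_volt_le_const (isWeight_schwartz w) hl x fun y => by
      rw [norm_mul]; exact mul_le_mul (hV y) (hM l hl y).1 (norm_nonneg _) hV0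
  have hn : 2 * ‖l‖ * ‖volt w l (m₂ l) x‖
      ≤ W * M + (∫ y, ‖w' y‖) * M + (∫ y, ‖w y‖) * (V * M) := by
    have : ‖2 * Complex.I * l * volt w l (m₂ l) x‖ = 2 * ‖l‖ * ‖volt w l (m₂ l) x‖ := by
      simp
    rw [← this, e]
    refine (norm_sub_le _ _).trans (add_le_add ((norm_sub_le _ _).trans (add_le_add ?_ b2)) b3)
    rwa [norm_neg]
  rw [le_div_iff₀ (norm_pos_iff.2 hl0)]
  linarith

theorem norm_m₁_le (h : IsJost u v m₁ m₂) :
    ∃ C, ∀ l : ℂ, 0 ≤ l.im → l ≠ 0 → ∀ x, ‖m₁ l x‖ ≤ C / ‖l‖ := by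
  obtain ⟨C, hC⟩ := h.norm_volt_m₂_le u
  exact ⟨C, fun l hl hl0 x => by rw [h.eq₁ l hl, norm_neg]; exact hC l hl hl0 x⟩

theorem norm_m₂_sub_le (h : IsJost u v m₁ m₂) :
    ∃ C, ∀ l : ℂ, 0 ≤ l.im → l ≠ 0 → ∀ x, ‖m₂ l x - 1‖ ≤ C / ‖l‖ := by
  obtain ⟨C, hC⟩ := h.norm_m₁_le
  refine ⟨(∫ y, ‖v y‖) * C, fun l hl hl0 x => ?_⟩
  rw [h.eq₂ l hl, sub_sub_cancel_left, norm_neg, mul_div_assoc]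
  exact norm_volt_le_const (isWeight_schwartz v) (κ := 0) le_rfl x (hC l hl hl0)

/-- The boundary term of the integration by parts is `u m₂`. Replacing `m₂` by `1` there, and using
the `O(1/l)` bounds for `m₁`, `m₂ - 1` and the remaining Volterra integrals, leaves an error of
second order. -/
theorem norm_m₁_sub_le (h : IsJost u v m₁ m₂) :
    ∃ C, ∀ l : ℂ, 0 ≤ l.im → l ≠ 0 → ∀ x,
      ‖m₁ l x - u x / (2 * Complex.I) * l⁻¹‖ ≤ C / ‖l‖ ^ 2 := by
  obtain ⟨C₁, hC₁⟩ := h.norm_m₁_le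
  obtain ⟨C₂, hC₂⟩ := h.norm_m₂_sub_le
  obtain ⟨C₃, hC₃⟩ := h.norm_volt_m₂_le (SchwartzMap.derivCLM ℂ ℂ u)
  obtain ⟨U, hU⟩ := (isBddCont_schwartz u).bound
  obtain ⟨V, hV⟩ := (isBddCont_schwartz v).bound
  have hU0 : 0 ≤ U := (norm_nonneg _).trans (hU 0)
  have hV0 : 0 ≤ V := (norm_nonneg _).trans (hV 0)
  refine ⟨(U * C₂ + C₃ + (∫ y, ‖u y‖) * (V * C₁)) / 2, fun l hl hl0 x => ?_⟩
  have hlpos : 0 < ‖l‖ := norm_pos_iff.2 hl0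
  have e := h.two_I_mul_volt_m₂ u hl x
  have b1 : ‖u x * (m₂ l x - 1)‖ ≤ U * C₂ / ‖l‖ := by
    rw [norm_mul, mul_div_assoc]
    exact mul_le_mul (hU x) (hC₂ l hl hl0 x) (norm_nonneg _) hU0
  have b3 : ‖volt u l (fun y => v y * m₁ l y) x‖ ≤ (∫ y, ‖u y‖) * (V * C₁) / ‖l‖ := by
    rw [mul_div_assoc, mul_div_assoc]
    refine norm_volt_le_const (isWeight_schwartz u) hl x fun y => ?_
    rw [norm_mul]; exact mul_le_mul (hV y) (hC₁ l hl hl0 y) (norm_nonneg _) hV0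
  have e2 : 2 * Complex.I * l * (m₁ l x - u x / (2 * Complex.I) * l⁻¹) = u x * (m₂ l x - 1)
      + volt (SchwartzMap.derivCLM ℂ ℂ u) l (m₂ l) x + volt u l (fun y => v y * m₁ l y) x := by
    have : 2 * Complex.I * l * (u x / (2 * Complex.I) * l⁻¹) = u x := by
      have := Complex.I_ne_zero
      field_simp
    rw [mul_sub, this, h.eq₁ l hl]
    linear_combination -e
  have hn : 2 * ‖l‖ * ‖m₁ l x - u x / (2 * Complex.I) * l⁻¹‖
      ≤ U * C₂ / ‖l‖ + C₃ / ‖l‖ + (∫ y, ‖u y‖) * (V * C₁) / ‖l‖ := by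
    have : ‖2 * Complex.I * l * (m₁ l x - u x / (2 * Complex.I) * l⁻¹)‖
        = 2 * ‖l‖ * ‖m₁ l x - u x / (2 * Complex.I) * l⁻¹‖ := by
      simp
    rw [← this, e2]
    exact (norm_add_le _ _).trans (add_le_add ((norm_add_le _ _).trans
      (add_le_add b1 (hC₃ l hl hl0 x))) b3)
  rw [← add_div, ← add_div, le_div_iff₀ hlpos] at hn
  rw [le_div_iff₀ (by positivity)]
  nlinarith

/-- The expansion of `m₁` is inserted into `m₂ = 1 - ∫ v m₁`; it is uniform in `x`, so integration
against `v` preserves the order of the error. -/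
theorem norm_m₂_sub_sub_le (h : IsJost u v m₁ m₂) :
    ∃ C, ∀ l : ℂ, 0 ≤ l.im → l ≠ 0 → ∀ x,
      ‖m₂ l x - 1 - Complex.I / 2 * (∫ y in Set.Ioi x, u y * v y) * l⁻¹‖ ≤ C / ‖l‖ ^ 2 := by
  obtain ⟨C, hC⟩ := h.norm_m₁_sub_le
  refine ⟨(∫ y, ‖v y‖) * C, fun l hl hl0 x => ?_⟩
  have hw := isWeight_schwartz v
  have e1 : volt v 0 (fun y => u y / (2 * Complex.I) * l⁻¹) x
      = -(Complex.I / 2 * (∫ y in Set.Ioi x, u y * v y) * l⁻¹) := by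
    rw [volt, ← integral_const_mul, ← integral_mul_const, ← integral_neg]
    refine integral_congr_ae (Eventually.of_forall fun y => ?_)
    simp only [phase, mul_zero, zero_mul, Complex.exp_zero, one_mul]
    rw [div_eq_mul_inv, mul_inv, Complex.inv_I]
    ring
  have i1 := integrableOn_phase_mul (hw.mul (h.bdd₁ hl)) (κ := 0) le_rfl x x le_rfl
  have hub : IsBddCont fun y => u y / (2 * Complex.I) * l⁻¹ := by
    obtain ⟨U, hU⟩ := (isBddCont_schwartz u).bound
    refine ⟨by have := u.continuous; fun_prop, U * (‖(2 * Complex.I)⁻¹‖ * ‖l⁻¹‖), fun y => ?_⟩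
    rw [norm_mul, div_eq_mul_inv, norm_mul, mul_assoc]
    gcongr
    exact hU y
  have i2 := integrableOn_phase_mul (hw.mul hub) (κ := 0) le_rfl x x le_rfl
  have e2 : volt v 0 (fun y => m₁ l y - u y / (2 * Complex.I) * l⁻¹) x
      = volt v 0 (m₁ l) x - volt v 0 (fun y => u y / (2 * Complex.I) * l⁻¹) x := by
    rw [volt, volt, volt, ← integral_sub i1 i2]
    refine integral_congr_ae (Eventually.of_forall fun y => ?_)
    simp only []; ring
  have e3 : m₂ l x - 1 - Complex.I / 2 * (∫ y in Set.Ioi x, u y * v y) * l⁻¹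
      = -volt v 0 (fun y => m₁ l y - u y / (2 * Complex.I) * l⁻¹) x := by
    rw [e2, e1, h.eq₂ l hl]; ring
  rw [e3, norm_neg, mul_div_assoc]
  exact norm_volt_le_const hw (κ := 0) le_rfl x (hC l hl hl0)

end IsJost

theorem isBigO_upInf_of_bound {f : ℂ → ℂ} {C : ℝ} (n : ℕ)
    (h : ∀ l : ℂ, 0 ≤ l.im → l ≠ 0 → ‖f l‖ ≤ C / ‖l‖ ^ n) : f =O[upInf] fun l => (l ^ n)⁻¹ := by
  refine IsBigO.of_bound C ?_
  have h1 : ∀ᶠ l : ℂ in upInf, l ≠ 0 :=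
    upInf_le (Bornology.isBounded_def.1 (Bornology.isBounded_singleton (x := (0:ℂ))))
  have h2 : ∀ᶠ l : ℂ in upInf, 0 ≤ l.im := mem_inf_of_right (mem_principal_self _)
  filter_upwards [h1, h2] with l h3 h4
  rw [norm_inv, norm_pow, ← div_eq_mul_inv]
  exact h l h4 h3

namespace IsJost

variable {u v : 𝓢(ℝ, ℂ)} {m₁ m₂ : ℂ → ℝ → ℂ}

theorem isBigO₁ (h : IsJost u v m₁ m₂) (x : ℝ) :
    (fun l => m₁ l x - u x / (2 * Complex.I) * l⁻¹) =O[upInf] fun l => (l ^ 2)⁻¹ := by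
  obtain ⟨C, hC⟩ := h.norm_m₁_sub_le
  exact isBigO_upInf_of_bound 2 fun l hl hl0 => hC l hl hl0 x

theorem isBigO₂ (h : IsJost u v m₁ m₂) (x : ℝ) :
    (fun l => m₂ l x - 1 - Complex.I / 2 * (∫ y in Set.Ioi x, u y * v y) * l⁻¹)
      =O[upInf] fun l => (l ^ 2)⁻¹ := by
  obtain ⟨C, hC⟩ := h.norm_m₂_sub_sub_le
  exact isBigO_upInf_of_bound 2 fun l hl hl0 => hC l hl hl0 x

theorem isHardy₁ (h : IsJost u v m₁ m₂) (x : ℝ) : IsHardy fun l => m₁ l x :=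
  IsHardy.of_isBigO (h.diffOn₁ x) (h.contOn₁ x) (isBigO_inv_of_sub (h.isBigO₁ x))

theorem isHardy₂ (h : IsJost u v m₁ m₂) (x : ℝ) : IsHardy fun l => m₂ l x - 1 :=
  IsHardy.of_isBigO ((h.diffOn₂ x).sub_const 1) ((h.contOn₂ x).sub continuousOn_const)
    (isBigO_inv_of_sub (h.isBigO₂ x))

end IsJost

/-- The potential `-w(-·)`. -/
def negRefl (w : 𝓢(ℝ, ℂ)) : 𝓢(ℝ, ℂ) :=
  -(SchwartzMap.compCLMOfContinuousLinearEquiv ℂ (ContinuousLinearEquiv.neg ℝ) w)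

theorem negRefl_apply (w : 𝓢(ℝ, ℂ)) (x : ℝ) : negRefl w x = -w (-x) := rfl

end

/-! ### Scattering data of the Zakharov–Shabat system -/

section

section AKNS

variable (u v : 𝓢(ℝ, ℂ))

def mR₁ : ℂ → ℝ → ℂ := (exists_isJost u v).choose
def mR₂ : ℂ → ℝ → ℂ := (exists_isJost u v).choose_spec.choose

theorem isJost_mR : IsJost u v (mR₁ u v) (mR₂ u v) := (exists_isJost u v).choose_spec.choose_spec

/-- `e^{iλx}` times the first component of the solution that behaves like `(e^{-iλx}, 0)` at
`-∞`. -/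
def mL₁ (l : ℂ) (x : ℝ) : ℂ := mR₂ (negRefl v) (negRefl u) l (-x)
-- Reflection `x ↦ -x` combined with exchange of the components turns the system of `(u, v)` into
-- that of `(-v(-·), -u(-·))`, so the theory at `-∞` is a copy of the theory at `+∞`.
def mL₂ (l : ℂ) (x : ℝ) : ℂ := mR₁ (negRefl v) (negRefl u) l (-x)

variable {u v}

theorem hasDerivAt_mL₁ {l : ℂ} (hl : 0 ≤ l.im) (x : ℝ) :
    HasDerivAt (mL₁ u v l) (u x * mL₂ u v l x) x := by
  have h := ((isJost_mR (negRefl v) (negRefl u)).hasDerivAt₂ hl (-x)).scomp x (hasDerivAt_neg x)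
  refine h.congr_deriv ?_
  rw [negRefl_apply, neg_neg, mL₂]; simp

theorem hasDerivAt_mL₂ {l : ℂ} (hl : 0 ≤ l.im) (x : ℝ) :
    HasDerivAt (mL₂ u v l) (2 * Complex.I * l * mL₂ u v l x + v x * mL₁ u v l x) x := by
  have h := ((isJost_mR (negRefl v) (negRefl u)).hasDerivAt₁ hl (-x)).scomp x (hasDerivAt_neg x)
  refine h.congr_deriv ?_
  rw [negRefl_apply, neg_neg, mL₂, mL₁]; simp

theorem tendsto_mL₁ {l : ℂ} (hl : 0 ≤ l.im) : Tendsto (mL₁ u v l) atBot (𝓝 1) :=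
  ((isJost_mR (negRefl v) (negRefl u)).tendsto₂ hl).comp tendsto_neg_atBot_atTop

theorem tendsto_mL₂ {l : ℂ} (hl : 0 ≤ l.im) : Tendsto (mL₂ u v l) atBot (𝓝 0) :=
  ((isJost_mR (negRefl v) (negRefl u)).tendsto₁ hl).comp tendsto_neg_atBot_atTop

theorem diffOn_mL₁ (x : ℝ) : DifferentiableOn ℂ (fun l => mL₁ u v l x) {l : ℂ | 0 < l.im} :=
  (isJost_mR (negRefl v) (negRefl u)).diffOn₂ (-x)

theorem diffOn_mL₂ (x : ℝ) : DifferentiableOn ℂ (fun l => mL₂ u v l x) {l : ℂ | 0 < l.im} :=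
  (isJost_mR (negRefl v) (negRefl u)).diffOn₁ (-x)

theorem contOn_mL₁ (x : ℝ) : ContinuousOn (fun l => mL₁ u v l x) {l : ℂ | 0 ≤ l.im} :=
  (isJost_mR (negRefl v) (negRefl u)).contOn₂ (-x)

theorem contOn_mL₂ (x : ℝ) : ContinuousOn (fun l => mL₂ u v l x) {l : ℂ | 0 ≤ l.im} :=
  (isJost_mR (negRefl v) (negRefl u)).contOn₁ (-x)

theorem isBigO_mL₁ (x : ℝ) : (fun l => mL₁ u v l x - 1) =O[upInf] fun l => l⁻¹ :=
  isBigO_inv_of_sub ((isJost_mR (negRefl v) (negRefl u)).isBigO₂ (-x))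

theorem isBigO_mL₂_sub (x : ℝ) :
    (fun l => mL₂ u v l x - -(v x / (2 * Complex.I)) * l⁻¹) =O[upInf] fun l => (l ^ 2)⁻¹ := by
  have h := (isJost_mR (negRefl v) (negRefl u)).isBigO₁ (-x)
  refine h.congr_left fun l => ?_
  rw [negRefl_apply, neg_neg, mL₂, neg_div]

theorem isBigO_mL₂ (x : ℝ) : (fun l => mL₂ u v l x) =O[upInf] fun l => l⁻¹ :=
  isBigO_inv_of_sub (isBigO_mL₂_sub x)

theorem eq_of_hasDerivAt_zero {f : ℝ → ℂ} (h : ∀ x, HasDerivAt f 0 x) (x y : ℝ) : f x = f y :=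
  is_const_of_deriv_eq_zero (fun x => (h x).differentiableAt) (fun x => (h x).deriv) x y

variable (u v)

/-- The Wronskian of the two Jost solutions, that is the reciprocal transmission coefficient. -/
def aCoef (l : ℂ) : ℂ := mL₁ u v l 0 * mR₂ u v l 0 - mL₂ u v l 0 * mR₁ u v l 0

variable {u v}

theorem aCoef_eq {l : ℂ} (hl : 0 ≤ l.im) (x : ℝ) :
    mL₁ u v l x * mR₂ u v l x - mL₂ u v l x * mR₁ u v l x = aCoef u v l := by
  have hR := isJost_mR u v
  refine eq_of_hasDerivAt_zero
    (f := fun x => mL₁ u v l x * mR₂ u v l x - mL₂ u v l x * mR₁ u v l x) (fun x => ?_) x 0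
  have h := ((hasDerivAt_mL₁ (u := u) (v := v) hl x).mul (hR.hasDerivAt₂ hl x)).sub
    ((hasDerivAt_mL₂ (u := u) (v := v) hl x).mul (hR.hasDerivAt₁ hl x))
  refine h.congr_deriv ?_
  ring

/-- For real `l` the Jost functions of `(v, u)` at `-l`, with components exchanged, give the second
solution normalised at `+∞`. The Wronskian of the two is constant and is evaluated in the limit `x →
+∞`. -/
theorem det_mR {l : ℂ} (hl : l.im = 0) (x : ℝ) :
    mR₂ v u (-l) x * mR₂ u v l x - mR₁ v u (-l) x * mR₁ u v l x = 1 := by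
  have hR := isJost_mR u v
  have hR' := isJost_mR v u
  have hl1 : 0 ≤ l.im := hl.ge
  have hl2 : 0 ≤ (-l).im := by simp [hl]
  have hd : ∀ x, HasDerivAt
      (fun x => mR₂ v u (-l) x * mR₂ u v l x - mR₁ v u (-l) x * mR₁ u v l x) 0 x := fun x => by
    have h := ((hR'.hasDerivAt₂ hl2 x).mul (hR.hasDerivAt₂ hl1 x)).sub
      ((hR'.hasDerivAt₁ hl2 x).mul (hR.hasDerivAt₁ hl1 x))
    refine h.congr_deriv ?_
    ring
  have hlim := ((hR'.tendsto₂ hl2).mul (hR.tendsto₂ hl1)).sub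
    ((hR'.tendsto₁ hl2).mul (hR.tendsto₁ hl1))
  simp only [one_mul, zero_mul, sub_zero] at hlim
  refine tendsto_nhds_unique (tendsto_const_nhds (f := atTop (α := ℝ))) (hlim.congr fun y => ?_)
  exact eq_of_hasDerivAt_zero hd y x

theorem diffOn_aCoef : DifferentiableOn ℂ (aCoef u v) {l : ℂ | 0 < l.im} :=
  ((diffOn_mL₁ 0).mul ((isJost_mR u v).diffOn₂ 0)).sub
    ((diffOn_mL₂ 0).mul ((isJost_mR u v).diffOn₁ 0))

theorem contOn_aCoef : ContinuousOn (aCoef u v) {l : ℂ | 0 ≤ l.im} :=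
  ((contOn_mL₁ 0).mul ((isJost_mR u v).contOn₂ 0)).sub
    ((contOn_mL₂ 0).mul ((isJost_mR u v).contOn₁ 0))

theorem tendsto_inv_upInf : Tendsto (fun l : ℂ => l⁻¹) upInf (𝓝 0) :=
  tendsto_inv₀_cobounded.mono_left upInf_le

theorem isBigO_one_of_inv {f : ℂ → ℂ} {c : ℂ} (h : (fun l => f l - c) =O[upInf] fun l => l⁻¹) :
    f =O[upInf] fun _ => (1 : ℂ) := by
  have h1 := (h.trans_tendsto tendsto_inv_upInf).add_const c
  simp only [sub_add_cancel] at h1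
  exact h1.isBigO_one ℂ

theorem isBigO_aCoef : (fun l => aCoef u v l - 1) =O[upInf] fun l => l⁻¹ := by
  have hR := isJost_mR u v
  have h1 := (isBigO_mL₁ (u := u) (v := v) 0).mul (isBigO_one_of_inv (hR.isHardy₂ 0).isBigO)
  have h2 := (isBigO_mL₂ (u := u) (v := v) 0).mul
    (isBigO_one_of_inv (c := 0) ((hR.isHardy₁ 0).isBigO.congr_left fun l => (sub_zero _).symm))
  simp only [mul_one] at h1 h2
  refine ((h1.add (hR.isHardy₂ 0).isBigO).sub h2).congr_left fun l => ?_
  rw [aCoef]; ring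

theorem tendsto_aCoef : Tendsto (aCoef u v) upInf (𝓝 1) := by
  have h := (isBigO_aCoef (u := u) (v := v)).trans_tendsto tendsto_inv_upInf |>.add_const 1
  simpa using h

theorem isBigO_inv_aCoef : (fun l => (aCoef u v l)⁻¹ - 1) =O[upInf] fun l => l⁻¹ := by
  have h1 : (fun l => (aCoef u v l)⁻¹) =O[upInf] fun _ => (1 : ℂ) :=
    (tendsto_aCoef.inv₀ one_ne_zero).isBigO_one ℂ
  have h2 := (isBigO_aCoef (u := u) (v := v)).neg_left.mul h1
  simp only [mul_one] at h2
  refine h2.congr' ?_ EventuallyEq.rfl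
  filter_upwards [tendsto_aCoef.eventually_ne one_ne_zero] with l hl
  field_simp
  ring

theorem halfPlaneData (x : ℝ) {p : PoleFamily} (hp : ∀ i, 0 < (p.loc i).im)
    (hreal : ∀ l : ℂ, l.im = 0 → aCoef u v l ≠ 0)
    (hzero : ∀ l : ℂ, 0 < l.im → aCoef u v l = 0 → l ∈ Set.range p.loc)
    (near₁ : ∀ i, (fun l => mL₁ u v l x / aCoef u v l - Complex.I * p.principal l * mR₁ u v l x)
      =O[𝓝[≠] (p.loc i)] fun _ => (1 : ℂ))
    (near₂ : ∀ i, (fun l => mL₂ u v l x / aCoef u v l - Complex.I * p.principal l * mR₂ u v l x)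
      =O[𝓝[≠] (p.loc i)] fun _ => (1 : ℂ)) :
    HalfPlaneData (fun l => mR₁ u v l x) (fun l => mR₂ u v l x)
      (fun l => mL₁ u v l x / aCoef u v l) (fun l => mL₂ u v l x / aCoef u v l) p where
  hardy₁ := (isJost_mR u v).isHardy₁ x
  hardy₂ := (isJost_mR u v).isHardy₂ x
  loc_im := hp
  diff₁ := ((diffOn_mL₁ x).mono Set.sdiff_subset).div (diffOn_aCoef.mono Set.sdiff_subset)
    fun l hl h0 => hl.2 (hzero l hl.1 h0)
  diff₂ := ((diffOn_mL₂ x).mono Set.sdiff_subset).div (diffOn_aCoef.mono Set.sdiff_subset)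
    fun l hl h0 => hl.2 (hzero l hl.1 h0)
  cont₁ := ((contOn_mL₁ x).mono Set.sdiff_subset).div (contOn_aCoef.mono Set.sdiff_subset)
    fun l hl h0 => (lt_or_eq_of_le hl.1).elim (fun h => hl.2 (hzero l h h0))
      fun h => hreal l h.symm h0
  cont₂ := ((contOn_mL₂ x).mono Set.sdiff_subset).div (contOn_aCoef.mono Set.sdiff_subset)
    fun l hl h0 => (lt_or_eq_of_le hl.1).elim (fun h => hl.2 (hzero l h h0))
      fun h => hreal l h.symm h0
  isBigO₁ := by
    have h1 := (isBigO_mL₁ (u := u) (v := v) x).mul (isBigO_one_of_inv (isBigO_inv_aCoef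
      (u := u) (v := v)))
    simp only [mul_one] at h1
    refine (h1.add (isBigO_inv_aCoef (u := u) (v := v))).congr_left fun l => ?_
    rw [div_eq_mul_inv]; ring
  isBigO₂ := by
    have h1 := (isBigO_mL₂ (u := u) (v := v) x).mul (isBigO_one_of_inv (isBigO_inv_aCoef
      (u := u) (v := v)))
    simp only [mul_one] at h1
    exact h1.congr_left fun l => (div_eq_mul_inv _ _).symm
  det l hl hlp := by
    have h0 : aCoef u v l ≠ 0 := fun h => hlp (hzero l hl h)
    have := aCoef_eq (u := u) (v := v) (le_of_lt hl) x
    field_simp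
    exact this
  near₁ := near₁
  near₂ := near₂

variable (u v)

/-- The reflection coefficient as seen from `x`, as a function of `λ`. -/
def reflAt (x : ℝ) (l : ℂ) : ℂ :=
  (mL₂ u v l x * mR₂ v u (-l) x - mL₁ u v l x * mR₁ v u (-l) x) / aCoef u v l

variable {u v}

/-- The solution normalised at `-∞` is expanded in the basis of the two solutions normalised at
`+∞`. By Cramer's rule the coefficients are Wronskians, evaluated by `aCoef_eq` and `det_mR`. -/
theorem jump₁ {l : ℂ} (hl : l.im = 0) (ha : aCoef u v l ≠ 0) (x : ℝ) :
    mL₁ u v l x / aCoef u v l = mR₂ v u (-l) x + reflAt u v x l * mR₁ u v l x := by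
  have h1 := aCoef_eq (u := u) (v := v) hl.ge x
  have h2 := det_mR (u := u) (v := v) hl x
  rw [reflAt]
  field_simp
  linear_combination -mL₁ u v l x * h2 + mR₂ v u (-l) x * h1

theorem jump₂ {l : ℂ} (hl : l.im = 0) (ha : aCoef u v l ≠ 0) (x : ℝ) :
    mL₂ u v l x / aCoef u v l = mR₁ v u (-l) x + reflAt u v x l * mR₂ u v l x := by
  have h1 := aCoef_eq (u := u) (v := v) hl.ge x
  have h2 := det_mR (u := u) (v := v) hl x
  rw [reflAt]
  field_simp
  linear_combination -mL₂ u v l x * h2 + mR₁ v u (-l) x * h1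

theorem tendsto_two_pi_upInf :
    Tendsto (fun ξ : ℝ => (2 * Real.pi * ξ : ℂ)) (Bornology.cobounded ℝ) upInf := by
  refine tendsto_inf.2 ⟨?_, tendsto_principal.2 (Eventually.of_forall fun ξ => ?_)⟩
  · rw [← tendsto_norm_atTop_iff_cobounded]
    have := (tendsto_norm_cobounded_atTop (E := ℝ)).const_mul_atTop (Real.two_pi_pos)
    refine this.congr fun ξ => ?_
    simp [abs_of_pos Real.pi_pos]
  · simp

theorem tendsto_neg_two_pi_upInf :
    Tendsto (fun ξ : ℝ => (-(2 * Real.pi * ξ) : ℂ)) (Bornology.cobounded ℝ) upInf := by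
  refine (tendsto_two_pi_upInf.comp tendsto_neg_cobounded).congr fun ξ => ?_
  simp

theorem isReflection_of_isBigO {f : ℝ → ℂ} (hf : Continuous f)
    (hO : f =O[Bornology.cobounded ℝ] fun ξ => (ξ ^ 2)⁻¹) : IsReflection f := by
  refine ⟨hf, ?_⟩
  obtain ⟨c, hc⟩ := hO.bound
  obtain ⟨R, -, hR⟩ := (Metric.hasBasis_cobounded_compl_closedBall (0 : ℝ)).eventually_iff.1 hc
  obtain ⟨D, hD⟩ := (isCompact_closedBall (0 : ℝ) (max R 1)).exists_bound_of_continuousOn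
    hf.continuousOn
  have hc0 : 0 ≤ |c| := abs_nonneg c
  have hD0 : 0 ≤ D := (norm_nonneg _).trans (hD 0 (by simp))
  refine ⟨D * (1 + max R 1) ^ 2 + 4 * |c|, fun ξ => ?_⟩
  rw [le_div_iff₀ (by positivity)]
  by_cases h : ξ ∈ Metric.closedBall (0:ℝ) (max R 1)
  · have h1 : ‖ξ‖ ≤ max R 1 := by simpa using h
    have h2 := hD ξ h
    have : (1 + ‖ξ‖) ^ 2 ≤ (1 + max R 1) ^ 2 := by gcongr
    have h3 := mul_le_mul h2 this (by positivity) hD0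
    linarith
  · have h1 : max R 1 < ‖ξ‖ := by
      rw [Metric.mem_closedBall, dist_zero_right] at h
      exact not_le.1 h
    have h1' : 1 < ‖ξ‖ := (le_max_right _ _).trans_lt h1
    have h2 : ‖f ξ‖ ≤ c * ‖(ξ ^ 2)⁻¹‖ := hR (by
      rw [Set.mem_compl_iff, Metric.mem_closedBall, dist_zero_right]
      exact not_le.2 ((le_max_left R 1).trans_lt h1))
    have h4 : ‖f ξ‖ * ‖ξ‖ ^ 2 ≤ |c| := by
      have hpos : 0 < ‖ξ‖ ^ 2 := by positivity
      rw [norm_inv, norm_pow, ← div_eq_mul_inv, le_div_iff₀ hpos] at h2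
      exact h2.trans (le_abs_self c)
    have h5 : (1 + ‖ξ‖) ^ 2 ≤ 4 * ‖ξ‖ ^ 2 := by nlinarith
    have h6 : 0 ≤ D * (1 + max R 1) ^ 2 := by positivity
    nlinarith [norm_nonneg (f ξ)]

theorem continuous_comp_two_pi {f : ℂ → ℂ} (hf : ContinuousOn f {l : ℂ | 0 ≤ l.im}) :
    Continuous fun ξ : ℝ => f (2 * Real.pi * ξ) :=
  hf.comp_continuous (by fun_prop) fun ξ => by simp

theorem continuous_comp_neg_two_pi {f : ℂ → ℂ} (hf : ContinuousOn f {l : ℂ | 0 ≤ l.im}) :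
    Continuous fun ξ : ℝ => f (-(2 * Real.pi * ξ)) :=
  hf.comp_continuous (by fun_prop) fun ξ => by simp

/-- At fixed `x` both products in the numerator have leading term `-v(x) / (2iλ)`, so these cancel
in the difference. Quadratic decay follows without any higher-order expansion. -/
theorem isReflection_reflAt (hreal : ∀ l : ℂ, l.im = 0 → aCoef u v l ≠ 0) (x : ℝ) :
    IsReflection fun ξ : ℝ => reflAt u v x (2 * Real.pi * ξ) := by
  have hR := isJost_mR v u
  refine isReflection_of_isBigO ?_ ?_
  · exact (((continuous_comp_two_pi (contOn_mL₂ x)).mul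
      (continuous_comp_neg_two_pi (hR.contOn₂ x))).sub ((continuous_comp_two_pi (contOn_mL₁ x)).mul
      (continuous_comp_neg_two_pi (hR.contOn₁ x)))).div
      (continuous_comp_two_pi contOn_aCoef) fun ξ => hreal _ (by simp)
  · have e1 : ∀ ξ : ℝ, ((2 * Real.pi * ξ : ℂ) ^ 2)⁻¹ = ((2 * Real.pi : ℂ) ^ 2)⁻¹ * ((ξ : ℂ) ^ 2)⁻¹ :=
      fun ξ => by rw [← mul_inv, ← mul_pow]
    have key : (fun ξ : ℝ => ((2 * Real.pi * ξ : ℂ) ^ 2)⁻¹)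
        =O[Bornology.cobounded ℝ] fun ξ : ℝ => (ξ ^ 2)⁻¹ := by
      simp_rw [e1]
      refine IsBigO.const_mul_left (IsBigO.of_norm_left ?_) _
      refine (isBigO_refl (fun ξ : ℝ => (ξ ^ 2)⁻¹) _).norm_left.congr_left fun ξ => ?_
      simp
    refine IsBigO.trans ?_ key
    set c := -(v x / (2 * Complex.I)) with hc
    have l1 := (isBigO_mL₁ (u := u) (v := v) x).comp_tendsto tendsto_two_pi_upInf
    have l2 := (isBigO_mL₂_sub (u := u) (v := v) x).comp_tendsto tendsto_two_pi_upInf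
    have n1 := (hR.isBigO₁ x).comp_tendsto tendsto_neg_two_pi_upInf
    have n1' := (hR.isHardy₁ x).isBigO.comp_tendsto tendsto_neg_two_pi_upInf
    have n2 := (hR.isHardy₂ x).isBigO.comp_tendsto tendsto_neg_two_pi_upInf
    have n2' := (isBigO_one_of_inv (hR.isHardy₂ x).isBigO).comp_tendsto tendsto_neg_two_pi_upInf
    have a1 := (isBigO_one_of_inv (isBigO_inv_aCoef (u := u) (v := v))).comp_tendsto
      tendsto_two_pi_upInf
    simp only [Function.comp_def] at l1 l2 n1 n1' n2 n2' a1
    have t1 := l2.mul n2'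
    have t2 := (((isBigO_refl (fun ξ : ℝ => (2 * Real.pi * ξ : ℂ)⁻¹)
      (Bornology.cobounded ℝ)).const_mul_left c).mul n2)
    have t3 := l1.mul n1'
    have e2 : ∀ ξ : ℝ, (2 * Real.pi * ξ : ℂ)⁻¹ * (-(2 * Real.pi * ξ : ℂ))⁻¹
        = -((2 * Real.pi * ξ : ℂ) ^ 2)⁻¹ := fun ξ => by rw [inv_neg, sq, mul_inv]; ring
    have e3 : ∀ ξ : ℝ, ((-(2 * Real.pi * ξ : ℂ)) ^ 2)⁻¹ = ((2 * Real.pi * ξ : ℂ) ^ 2)⁻¹ :=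
      fun ξ => by rw [neg_sq]
    simp only [e2, e3, mul_one, isBigO_neg_right] at t1 t2 t3 n1
    have tot := (((t1.add t2).sub t3).sub n1).mul a1
    simp only [mul_one] at tot
    refine tot.congr_left fun ξ => ?_
    rw [reflAt, div_eq_mul_inv, inv_neg]
    ring

end AKNS

end

section

/-! ### Uniqueness of the Jost solutions -/

theorem exists_lipschitz_coeffMatrix (q r : 𝓢(ℝ, ℂ)) (ζ : ℂ) :
    ∃ K, ∀ x, LipschitzWith K fun w : Fin 2 → ℂ => Matrix.mulVec (coeffMatrix q r ζ x) w := by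
  obtain ⟨Q, hQ⟩ := (isBddCont_schwartz q).bound
  obtain ⟨R, hR⟩ := (isBddCont_schwartz r).bound
  have hQ0 : 0 ≤ Q := (norm_nonneg _).trans (hQ 0)
  have hR0 : 0 ≤ R := (norm_nonneg _).trans (hR 0)
  set K : ℝ := ‖ζ‖ ^ 2 + Q * R + ‖ζ‖ * Q + ‖ζ‖ * R
  have hK : 0 ≤ K := by positivity
  have hK2 : 0 ≤ 2 * K := by linarith
  refine ⟨(2 * K).toNNReal, fun x => LipschitzWith.of_dist_le_mul fun w z => ?_⟩
  rw [Real.coe_toNNReal _ hK2]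
  have hqr : ‖q x * r x‖ ≤ Q * R := by
    rw [norm_mul]; exact mul_le_mul (hQ x) (hR x) (norm_nonneg _) hQ0
  have hζQ : ‖ζ * q x‖ ≤ ‖ζ‖ * Q := by rw [norm_mul]; gcongr; exact hQ x
  have hζR : ‖ζ * r x‖ ≤ ‖ζ‖ * R := by rw [norm_mul]; gcongr; exact hR x
  have hd : ‖Complex.I * ζ ^ 2 + Complex.I / 2 * (q x * r x)‖ ≤ ‖ζ‖ ^ 2 + Q * R := by
    refine (norm_add_le _ _).trans (add_le_add (by simp) ?_)
    rw [norm_mul]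
    have : ‖Complex.I / 2‖ ≤ 1 := by simp; norm_num
    calc _ ≤ 1 * (Q * R) := by gcongr
      _ = _ := one_mul _
  have hent : ∀ i j, ‖coeffMatrix q r ζ x i j‖ ≤ K := by
    have p1 : 0 ≤ ‖ζ‖ ^ 2 := by positivity
    have p2 : 0 ≤ Q * R := by positivity
    have p3 : 0 ≤ ‖ζ‖ * Q := by positivity
    have p4 : 0 ≤ ‖ζ‖ * R := by positivity
    intro i j
    fin_cases i <;> fin_cases j <;> simp only [coeffMatrix, Fin.zero_eta, Fin.mk_one, Fin.isValue,
      Matrix.of_apply, Matrix.cons_val', Matrix.cons_val_zero, Matrix.cons_val_one,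
      Matrix.cons_val_fin_one]
    · rw [show -Complex.I * ζ ^ 2 - Complex.I / 2 * (q x * r x)
        = -(Complex.I * ζ ^ 2 + Complex.I / 2 * (q x * r x)) by ring, norm_neg]
      linarith
    · linarith
    · linarith
    · linarith
  rw [dist_eq_norm, dist_eq_norm, ← Matrix.mulVec_sub]
  refine (pi_norm_le_iff_of_nonneg (mul_nonneg hK2 (norm_nonneg _))).2 fun i => ?_
  rw [Matrix.mulVec, dotProduct, Fin.sum_univ_two]
  refine (norm_add_le _ _).trans ?_
  rw [norm_mul, norm_mul]
  have h0 := mul_le_mul (hent i 0) (norm_le_pi_norm (w - z) 0) (norm_nonneg _) hK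
  have h1 := mul_le_mul (hent i 1) (norm_le_pi_norm (w - z) 1) (norm_nonneg _) hK
  linarith

section Uniqueness

variable {q r : 𝓢(ℝ, ℂ)} {ζ : ℂ} {f g : ℝ → Fin 2 → ℂ}

theorem IsSolution.unique (hf : IsSolution q r ζ f) (hg : IsSolution q r ζ g) {x₀ : ℝ}
    (h : f x₀ = g x₀) : f = g := by
  obtain ⟨K, hK⟩ := exists_lipschitz_coeffMatrix q r ζ
  exact ODE_solution_unique_univ (v := fun x w => Matrix.mulVec (coeffMatrix q r ζ x) w)
    (s := fun _ => Set.univ) (K := K) (t₀ := x₀) (fun x => (hK x).lipschitzOnWith)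
    (fun x => ⟨hf x, trivial⟩) (fun x => ⟨hg x, trivial⟩) h

theorem IsSolution.smul (hf : IsSolution q r ζ f) (c : ℂ) : IsSolution q r ζ fun x => c • f x :=
  fun x => ((hf x).const_smul c).congr_deriv (Matrix.mulVec_smul _ _ _).symm

theorem IsSolution.hasDerivAt_zero (hf : IsSolution q r ζ f) (x : ℝ) :
    HasDerivAt (fun x => f x 0)
      ((-Complex.I * ζ ^ 2 - Complex.I / 2 * (q x * r x)) * f x 0 + ζ * q x * f x 1) x := by
  have := hasDerivAt_pi.1 (hf x) 0
  refine this.congr_deriv ?_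
  simp [Matrix.mulVec, dotProduct, Fin.sum_univ_two, coeffMatrix]

theorem IsSolution.hasDerivAt_one (hf : IsSolution q r ζ f) (x : ℝ) :
    HasDerivAt (fun x => f x 1)
      (ζ * r x * f x 0 + (Complex.I * ζ ^ 2 + Complex.I / 2 * (q x * r x)) * f x 1) x := by
  have := hasDerivAt_pi.1 (hf x) 1
  refine this.congr_deriv ?_
  simp [Matrix.mulVec, dotProduct, Fin.sum_univ_two, coeffMatrix]

theorem IsSolution.wronskian_const (hf : IsSolution q r ζ f) (hg : IsSolution q r ζ g) (x y : ℝ) :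
    f x 0 * g x 1 - g x 0 * f x 1 = f y 0 * g y 1 - g y 0 * f y 1 := by
  refine eq_of_hasDerivAt_zero (f := fun x => f x 0 * g x 1 - g x 0 * f x 1) (fun x => ?_) x y
  refine (((hf.hasDerivAt_zero x).mul (hg.hasDerivAt_one x)).sub
    ((hg.hasDerivAt_zero x).mul (hf.hasDerivAt_one x))).congr_deriv ?_
  ring

theorem tendsto_zero_of_mul {F : Filter ℝ} {E α : ℝ → ℂ} (hE : ∀ᶠ x in F, 1 ≤ ‖E x‖)
    (h : Tendsto (fun x => α x * E x) F (𝓝 0)) : Tendsto α F (𝓝 0) := by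
  refine squeeze_zero_norm' ?_ (tendsto_zero_iff_norm_tendsto_zero.1 h)
  filter_upwards [hE] with x hx
  rw [norm_mul]
  exact le_mul_of_one_le_right (norm_nonneg _) hx

/-- A solution that dominates in the component `i` is determined by its normalisation. -/
theorem IsSolution.eq_of_tendsto (hf : IsSolution q r ζ f) (hg : IsSolution q r ζ g)
    {F : Filter ℝ} [F.NeBot] {E : ℝ → ℂ} (hE : ∀ᶠ x in F, 1 ≤ ‖E x‖) {i j : Fin 2} (hij : i ≠ j)
    (hfi : Tendsto (fun x => f x i * E x) F (𝓝 1)) (hfj : Tendsto (fun x => f x j) F (𝓝 0))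
    (hgi : Tendsto (fun x => g x i * E x) F (𝓝 1)) (hgj : Tendsto (fun x => g x j) F (𝓝 0)) :
    f = g := by
  have hw : ∀ x, f x i * g x j = g x i * f x j := by
    have hconst : ∀ x y, f x i * g x j - g x i * f x j = f y i * g y j - g y i * f y j := by
      intro x y
      have := hf.wronskian_const hg x y
      fin_cases i <;> fin_cases j
      · exact absurd rfl hij
      · exact this
      · simp only [Fin.mk_one, Fin.zero_eta]; linear_combination -this
      · exact absurd rfl hij
    -- The Wronskian multiplied by `E` tends to `0`, and `‖E‖ ≥ 1` eventually, so the Wronskian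
    -- itself tends to `0`. Being constant it vanishes, and the two solutions are proportional.
    have hlim : Tendsto (fun x => f x i * g x j - g x i * f x j) F (𝓝 0) := by
      refine tendsto_zero_of_mul hE ?_
      have := (hfi.mul hgj).sub (hgi.mul hfj)
      simp only [mul_zero, sub_zero] at this
      exact this.congr fun x => by ring
    intro x
    have h0 : f x i * g x j - g x i * f x j = 0 :=
      tendsto_nhds_unique (tendsto_const_nhds.congr fun y => hconst x y) hlim
    linear_combination h0
  obtain ⟨x₀, hx₀⟩ := (hgi.eventually_ne one_ne_zero).exists
  have hg0 : g x₀ i ≠ 0 := left_ne_zero_of_mul hx₀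
  set c := f x₀ i / g x₀ i
  have hcg : f = fun x => c • g x := by
    refine hf.unique (hg.smul c) (x₀ := x₀) (funext fun k => ?_)
    have hk : k = i ∨ k = j := by
      fin_cases i <;> fin_cases j <;> fin_cases k <;> simp_all
    rw [Pi.smul_apply, smul_eq_mul]
    rcases hk with rfl | rfl
    · exact (div_mul_cancel₀ _ hg0).symm
    · rw [div_mul_eq_mul_div, eq_div_iff hg0]
      linear_combination -hw x₀
  have hc : Tendsto (fun x => f x i * E x) F (𝓝 (c * 1)) := by
    refine (hgi.const_mul c).congr fun x => ?_
    simp only [hcg, Pi.smul_apply, smul_eq_mul, mul_assoc]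
  have : c = 1 := by simpa using tendsto_nhds_unique hc hfi
  rw [hcg, this]
  simp

theorem one_le_norm_exp {w : ℂ} {x : ℝ} (h : 0 ≤ (w * x).re) : 1 ≤ ‖Complex.exp (w * x)‖ := by
  rw [Complex.norm_exp]; exact Real.one_le_exp h

theorem eventually_exp_atTop {w : ℂ} (h : 0 ≤ w.re) :
    ∀ᶠ x : ℝ in atTop, 1 ≤ ‖Complex.exp (w * x)‖ := by
  filter_upwards [eventually_ge_atTop 0] with x hx
  refine one_le_norm_exp ?_
  simpa using mul_nonneg h hx

theorem eventually_exp_atBot {w : ℂ} (h : w.re ≤ 0) :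
    ∀ᶠ x : ℝ in atBot, 1 ≤ ‖Complex.exp (w * x)‖ := by
  filter_upwards [eventually_le_atBot 0] with x hx
  refine one_le_norm_exp ?_
  simpa using mul_nonneg_of_nonpos_of_nonpos h hx

/-- The Jost solutions are selected by choice, so an explicit solution is identified with the
selected one by uniqueness. The decay of the subdominant component is assumed here in the stronger
form with the exponential, which is what the gauge transformations deliver. The same holds for the
three companions below. -/
theorem jostPsi_eq (hζ : 0 ≤ (ζ ^ 2).im) (hf : IsSolution q r ζ f)
    (h0 : Tendsto (fun x : ℝ => f x 0 * Complex.exp (-Complex.I * ζ ^ 2 * x)) atTop (𝓝 0))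
    (h1 : Tendsto (fun x : ℝ => f x 1 * Complex.exp (-Complex.I * ζ ^ 2 * x)) atTop (𝓝 1)) :
    jostPsi q r ζ = f := by
  have hE := eventually_exp_atTop (w := -Complex.I * ζ ^ 2) (by simpa using hζ)
  have hJ : IsJostPsi q r ζ f := ⟨hf, tendsto_zero_of_mul hE h0, h1⟩
  have hJ' : IsJostPsi q r ζ (jostPsi q r ζ) := Classical.epsilon_spec ⟨f, hJ⟩
  exact hJ'.sol.eq_of_tendsto hf hE (i := 1) (j := 0) (by decide) hJ'.snd hJ'.fst hJ.snd hJ.fst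

theorem jostPsiBar_eq (hζ : (ζ ^ 2).im ≤ 0) (hf : IsSolution q r ζ f)
    (h0 : Tendsto (fun x : ℝ => f x 0 * Complex.exp (Complex.I * ζ ^ 2 * x)) atTop (𝓝 1))
    (h1 : Tendsto (fun x : ℝ => f x 1 * Complex.exp (Complex.I * ζ ^ 2 * x)) atTop (𝓝 0)) :
    jostPsiBar q r ζ = f := by
  have hE := eventually_exp_atTop (w := Complex.I * ζ ^ 2) (by simpa using hζ)
  have hJ : IsJostPsiBar q r ζ f := ⟨hf, h0, tendsto_zero_of_mul hE h1⟩
  have hJ' : IsJostPsiBar q r ζ (jostPsiBar q r ζ) := Classical.epsilon_spec ⟨f, hJ⟩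
  exact hJ'.sol.eq_of_tendsto hf hE (i := 0) (j := 1) (by decide) hJ'.fst hJ'.snd hJ.fst hJ.snd

theorem jostPhi_eq (hζ : 0 ≤ (ζ ^ 2).im) (hf : IsSolution q r ζ f)
    (h0 : Tendsto (fun x : ℝ => f x 0 * Complex.exp (Complex.I * ζ ^ 2 * x)) atBot (𝓝 1))
    (h1 : Tendsto (fun x : ℝ => f x 1 * Complex.exp (Complex.I * ζ ^ 2 * x)) atBot (𝓝 0)) :
    jostPhi q r ζ = f := by
  have hE := eventually_exp_atBot (w := Complex.I * ζ ^ 2) (by simpa using hζ)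
  have hJ : IsJostPhi q r ζ f := ⟨hf, h0, tendsto_zero_of_mul hE h1⟩
  have hJ' : IsJostPhi q r ζ (jostPhi q r ζ) := Classical.epsilon_spec ⟨f, hJ⟩
  exact hJ'.sol.eq_of_tendsto hf hE (i := 0) (j := 1) (by decide) hJ'.fst hJ'.snd hJ.fst hJ.snd

theorem jostPhiBar_eq (hζ : (ζ ^ 2).im ≤ 0) (hf : IsSolution q r ζ f)
    (h0 : Tendsto (fun x : ℝ => f x 0 * Complex.exp (-Complex.I * ζ ^ 2 * x)) atBot (𝓝 0))
    (h1 : Tendsto (fun x : ℝ => f x 1 * Complex.exp (-Complex.I * ζ ^ 2 * x)) atBot (𝓝 1)) :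
    jostPhiBar q r ζ = f := by
  have hE := eventually_exp_atBot (w := -Complex.I * ζ ^ 2) (by simpa using hζ)
  have hJ : IsJostPhiBar q r ζ f := ⟨hf, tendsto_zero_of_mul hE h0, h1⟩
  have hJ' : IsJostPhiBar q r ζ (jostPhiBar q r ζ) := Classical.epsilon_spec ⟨f, hJ⟩
  exact hJ'.sol.eq_of_tendsto hf hE (i := 1) (j := 0) (by decide) hJ'.snd hJ'.fst hJ.snd hJ.fst

end Uniqueness

end

section

/-! ### The gauge transformations to the Zakharov–Shabat system -/

def schwartzMul (f g : 𝓢(ℝ, ℂ)) : 𝓢(ℝ, ℂ) := SchwartzMap.pairing (ContinuousLinearMap.mul ℂ ℂ) f g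

theorem schwartzMul_apply (f g : 𝓢(ℝ, ℂ)) (x : ℝ) : schwartzMul f g x = f x * g x := rfl

/-- `-(i/2) r' - (1/4) q r²`. -/
def potV (q r : 𝓢(ℝ, ℂ)) : 𝓢(ℝ, ℂ) :=
  (-(Complex.I / 2)) • SchwartzMap.derivCLM ℂ ℂ r - (1 / 4 : ℂ) • schwartzMul q (schwartzMul r r)

/-- `(i/2) q' - (1/4) q² r`. -/
def potU (q r : 𝓢(ℝ, ℂ)) : 𝓢(ℝ, ℂ) :=
  (Complex.I / 2) • SchwartzMap.derivCLM ℂ ℂ q - (1 / 4 : ℂ) • schwartzMul r (schwartzMul q q)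

theorem potV_apply (q r : 𝓢(ℝ, ℂ)) (x : ℝ) :
    potV q r x = -(Complex.I / 2) * deriv r x - 1 / 4 * (q x * (r x * r x)) := rfl

theorem potU_apply (q r : 𝓢(ℝ, ℂ)) (x : ℝ) :
    potU q r x = Complex.I / 2 * deriv q x - 1 / 4 * (r x * (q x * q x)) := rfl

/-- Solutions of the Zakharov–Shabat system. -/
structure IsAKNS (u v : ℝ → ℂ) (l : ℂ) (α β : ℝ → ℂ) : Prop where
  fst : ∀ x, HasDerivAt α (-Complex.I * l * α x + u x * β x) x
  snd : ∀ x, HasDerivAt β (Complex.I * l * β x + v x * α x) x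

/-- The shear `(i/2) r α` absorbs the diagonal term `(i/2) q r`, and the scaling by `ζ` moves the
energy dependence of the potentials into the gauge. What remains is a Zakharov–Shabat system with
potentials independent of `ζ`. -/
def gaugeV (ζ : ℂ) (r α β : ℝ → ℂ) (x : ℝ) : Fin 2 → ℂ :=
  ![ζ * α x, β x + Complex.I / 2 * r x * α x]

def gaugeU (ζ : ℂ) (q α β : ℝ → ℂ) (x : ℝ) : Fin 2 → ℂ :=
  ![α x - Complex.I / 2 * q x * β x, ζ * β x]

variable {q r u v : 𝓢(ℝ, ℂ)} {ζ : ℂ} {α β : ℝ → ℂ}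

theorem isSolution_gaugeV (h : IsAKNS q (potV q r) (ζ ^ 2) α β) :
    IsSolution q r ζ (gaugeV ζ r α β) := by
  intro x
  rw [hasDerivAt_pi]
  intro i
  fin_cases i
  · refine ((h.fst x).const_mul ζ).congr_deriv ?_
    simp [Matrix.mulVec, dotProduct, Fin.sum_univ_two, coeffMatrix, gaugeV]
    ring
  · refine ((h.snd x).add (((r.hasDerivAt x).const_mul (Complex.I / 2)).mul (h.fst x))).congr_deriv ?_
    simp [Matrix.mulVec, dotProduct, Fin.sum_univ_two, coeffMatrix, gaugeV, potV_apply]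
    linear_combination (-(ζ ^ 2 * r x * α x) - q x * r x ^ 2 * α x / 4) * Complex.I_sq

theorem isSolution_gaugeU (h : IsAKNS (potU q r) r (ζ ^ 2) α β) :
    IsSolution q r ζ (gaugeU ζ q α β) := by
  intro x
  rw [hasDerivAt_pi]
  intro i
  fin_cases i
  · refine ((h.fst x).sub (((q.hasDerivAt x).const_mul (Complex.I / 2)).mul (h.snd x))).congr_deriv ?_
    simp [Matrix.mulVec, dotProduct, Fin.sum_univ_two, coeffMatrix, gaugeU, potU_apply]
    linear_combination (-(ζ ^ 2 * q x * β x) - q x ^ 2 * r x * β x / 4) * Complex.I_sq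
  · refine ((h.snd x).const_mul ζ).congr_deriv ?_
    simp [Matrix.mulVec, dotProduct, Fin.sum_univ_two, coeffMatrix, gaugeU]
    ring

variable {F : Filter ℝ} {E : ℝ → ℂ} {a b : ℂ}

theorem tendsto_gaugeV (hr : Tendsto r F (𝓝 0)) (hα : Tendsto (fun x => α x * E x) F (𝓝 a))
    (hβ : Tendsto (fun x => β x * E x) F (𝓝 b)) :
    Tendsto (fun x => gaugeV ζ r α β x 0 * E x) F (𝓝 (ζ * a)) ∧
      Tendsto (fun x => gaugeV ζ r α β x 1 * E x) F (𝓝 b) := by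
  constructor
  · refine (hα.const_mul ζ).congr fun x => ?_
    simp [gaugeV, mul_assoc]
  · have := hβ.add ((hr.mul hα).const_mul (Complex.I / 2))
    simp only [zero_mul, mul_zero, add_zero] at this
    refine this.congr fun x => ?_
    simp [gaugeV]; ring

theorem tendsto_gaugeU (hq : Tendsto q F (𝓝 0)) (hα : Tendsto (fun x => α x * E x) F (𝓝 a))
    (hβ : Tendsto (fun x => β x * E x) F (𝓝 b)) :
    Tendsto (fun x => gaugeU ζ q α β x 0 * E x) F (𝓝 a) ∧
      Tendsto (fun x => gaugeU ζ q α β x 1 * E x) F (𝓝 (ζ * b)) := by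
  constructor
  · have := hα.sub ((hq.mul hβ).const_mul (Complex.I / 2))
    simp only [zero_mul, mul_zero, sub_zero] at this
    refine this.congr fun x => ?_
    simp [gaugeU]; ring
  · refine (hβ.const_mul ζ).congr fun x => ?_
    simp [gaugeU, mul_assoc]

/-! The Jost solutions of the Zakharov–Shabat system. -/

variable (u v)

def psiA (l : ℂ) (x : ℝ) : ℂ := Complex.exp (Complex.I * l * x) * mR₁ u v l x
def psiB (l : ℂ) (x : ℝ) : ℂ := Complex.exp (Complex.I * l * x) * mR₂ u v l x
def phiA (l : ℂ) (x : ℝ) : ℂ := Complex.exp (-Complex.I * l * x) * mL₁ u v l x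
def phiB (l : ℂ) (x : ℝ) : ℂ := Complex.exp (-Complex.I * l * x) * mL₂ u v l x

variable {u v}

theorem hasDerivAt_exp_mul {f : ℝ → ℂ} {f' w : ℂ} {x : ℝ} (hf : HasDerivAt f f' x) :
    HasDerivAt (fun x : ℝ => Complex.exp (w * x) * f x)
      (Complex.exp (w * x) * (w * f x + f')) x := by
  have h := (((Complex.ofRealCLM.hasDerivAt (x := x)).const_mul w).cexp).mul hf
  refine h.congr_deriv ?_
  simp; ring

theorem isAKNS_psi {l : ℂ} (hl : 0 ≤ l.im) : IsAKNS u v l (psiA u v l) (psiB u v l) := by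
  have hR := isJost_mR u v
  constructor
  · intro x
    refine (hasDerivAt_exp_mul (hR.hasDerivAt₁ hl x)).congr_deriv ?_
    rw [psiA, psiB]; ring
  · intro x
    refine (hasDerivAt_exp_mul (hR.hasDerivAt₂ hl x)).congr_deriv ?_
    rw [psiA, psiB]; ring

theorem isAKNS_phi {l : ℂ} (hl : 0 ≤ l.im) : IsAKNS u v l (phiA u v l) (phiB u v l) := by
  constructor
  · intro x
    refine (hasDerivAt_exp_mul (hasDerivAt_mL₁ hl x)).congr_deriv ?_
    rw [phiA, phiB]; ring
  · intro x
    refine (hasDerivAt_exp_mul (hasDerivAt_mL₂ hl x)).congr_deriv ?_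
    rw [phiA, phiB]; ring

theorem IsAKNS.swap {u v : ℝ → ℂ} {l : ℂ} (h : IsAKNS u v (-l) α β) : IsAKNS v u l β α :=
  ⟨fun x => (h.snd x).congr_deriv (by ring), fun x => (h.fst x).congr_deriv (by ring)⟩

theorem exp_mul_mul_exp (w m : ℂ) (x : ℝ) :
    Complex.exp (w * x) * m * Complex.exp (-w * x) = m := by
  rw [mul_right_comm, ← Complex.exp_add, show w * x + -w * x = 0 by ring, Complex.exp_zero, one_mul]

theorem tendsto_psi {l : ℂ} (hl : 0 ≤ l.im) :
    Tendsto (fun x : ℝ => psiA u v l x * Complex.exp (-Complex.I * l * x)) atTop (𝓝 0) ∧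
      Tendsto (fun x : ℝ => psiB u v l x * Complex.exp (-Complex.I * l * x)) atTop (𝓝 1) := by
  have hR := isJost_mR u v
  refine ⟨(hR.tendsto₁ hl).congr fun x => ?_, (hR.tendsto₂ hl).congr fun x => ?_⟩
  · rw [psiA, neg_mul, exp_mul_mul_exp]
  · rw [psiB, neg_mul, exp_mul_mul_exp]

theorem tendsto_phi {l : ℂ} (hl : 0 ≤ l.im) :
    Tendsto (fun x : ℝ => phiA u v l x * Complex.exp (Complex.I * l * x)) atBot (𝓝 1) ∧
      Tendsto (fun x : ℝ => phiB u v l x * Complex.exp (Complex.I * l * x)) atBot (𝓝 0) := by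
  have e : Complex.I * l = -(-Complex.I * l) := by ring
  refine ⟨(tendsto_mL₁ (u := u) (v := v) hl).congr fun x => ?_,
    (tendsto_mL₂ (u := u) (v := v) hl).congr fun x => ?_⟩
  · rw [phiA, e, exp_mul_mul_exp]
  · rw [phiB, e, exp_mul_mul_exp]

theorem tendsto_schwartz_atBot (w : 𝓢(ℝ, ℂ)) : Tendsto w atBot (𝓝 0) :=
  w.tendsto_cocompact.mono_left atBot_le_cocompact

/-! The four Jost solutions of the original system through both gauges. -/

/-- In this gauge the second component is not rescaled, so `ψ` and `φ̄`, normalised there, need no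
factor `ζ⁻¹` and the formulas persist at `ζ = 0`; `φ` and `ψ̄` need it. In the other gauge the roles
are exchanged. The barred solutions use the exchange of components together with `λ ↦ -λ`, so that
only the closed upper half plane occurs. -/
theorem jostPsi_gaugeV (hζ : 0 ≤ (ζ ^ 2).im) : jostPsi q r ζ
    = gaugeV ζ r (psiA q (potV q r) (ζ ^ 2)) (psiB q (potV q r) (ζ ^ 2)) := by
  have t := tendsto_psi (u := q) (v := potV q r) hζ
  have h := tendsto_gaugeV (ζ := ζ) (tendsto_schwartz_atTop r) t.1 t.2
  rw [mul_zero] at h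
  exact jostPsi_eq hζ (isSolution_gaugeV (isAKNS_psi hζ)) h.1 h.2

theorem jostPhiBar_gaugeV (hζ : (ζ ^ 2).im ≤ 0) : jostPhiBar q r ζ
    = gaugeV ζ r (phiB (potV q r) q (-ζ ^ 2)) (phiA (potV q r) q (-ζ ^ 2)) := by
  have hζ' : 0 ≤ (-ζ ^ 2).im := by simpa using hζ
  have t := tendsto_phi (u := potV q r) (v := q) hζ'
  simp only [mul_neg, ← neg_mul] at t
  have h := tendsto_gaugeV (ζ := ζ) (tendsto_schwartz_atBot r) t.2 t.1
  rw [mul_zero] at h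
  exact jostPhiBar_eq hζ (isSolution_gaugeV (isAKNS_phi hζ').swap) h.1 h.2

theorem jostPhi_gaugeU (hζ : 0 ≤ (ζ ^ 2).im) : jostPhi q r ζ
    = gaugeU ζ q (phiA (potU q r) r (ζ ^ 2)) (phiB (potU q r) r (ζ ^ 2)) := by
  have t := tendsto_phi (u := potU q r) (v := r) hζ
  have h := tendsto_gaugeU (ζ := ζ) (tendsto_schwartz_atBot q) t.1 t.2
  rw [mul_zero] at h
  exact jostPhi_eq hζ (isSolution_gaugeU (isAKNS_phi hζ)) h.1 h.2

theorem jostPsiBar_gaugeU (hζ : (ζ ^ 2).im ≤ 0) : jostPsiBar q r ζ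
    = gaugeU ζ q (psiB r (potU q r) (-ζ ^ 2)) (psiA r (potU q r) (-ζ ^ 2)) := by
  have hζ' : 0 ≤ (-ζ ^ 2).im := by simpa using hζ
  have t := tendsto_psi (u := r) (v := potU q r) hζ'
  simp only [mul_neg, neg_mul, neg_neg] at t
  have h := tendsto_gaugeU (ζ := ζ) (tendsto_schwartz_atTop q) t.2 t.1
  rw [mul_zero] at h
  exact jostPsiBar_eq hζ (isSolution_gaugeU (isAKNS_psi hζ').swap) h.1 h.2

theorem tendsto_inv_smul {f : ℝ → Fin 2 → ℂ} {i : Fin 2} (hζ0 : ζ ≠ 0)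
    (h : Tendsto (fun x => f x i * E x) F (𝓝 (ζ * a))) :
    Tendsto (fun x => (ζ⁻¹ • f x) i * E x) F (𝓝 a) := by
  have := h.const_mul ζ⁻¹
  rw [inv_mul_cancel_left₀ hζ0] at this
  exact this.congr fun x => by rw [Pi.smul_apply, smul_eq_mul, mul_assoc]

theorem jostPsi_gaugeU (hζ : 0 ≤ (ζ ^ 2).im) (hζ0 : ζ ≠ 0) : jostPsi q r ζ = fun x =>
    ζ⁻¹ • gaugeU ζ q (psiA (potU q r) r (ζ ^ 2)) (psiB (potU q r) r (ζ ^ 2)) x := by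
  have t := tendsto_psi (u := potU q r) (v := r) hζ
  have h := tendsto_gaugeU (ζ := ζ) (tendsto_schwartz_atTop q) t.1 t.2
  exact jostPsi_eq hζ ((isSolution_gaugeU (isAKNS_psi hζ)).smul _)
    (tendsto_inv_smul hζ0 (by rw [mul_zero]; exact h.1)) (tendsto_inv_smul hζ0 h.2)

theorem jostPhi_gaugeV (hζ : 0 ≤ (ζ ^ 2).im) (hζ0 : ζ ≠ 0) : jostPhi q r ζ = fun x =>
    ζ⁻¹ • gaugeV ζ r (phiA q (potV q r) (ζ ^ 2)) (phiB q (potV q r) (ζ ^ 2)) x := by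
  have t := tendsto_phi (u := q) (v := potV q r) hζ
  have h := tendsto_gaugeV (ζ := ζ) (tendsto_schwartz_atBot r) t.1 t.2
  exact jostPhi_eq hζ ((isSolution_gaugeV (isAKNS_phi hζ)).smul _)
    (tendsto_inv_smul hζ0 h.1) (tendsto_inv_smul hζ0 (by rw [mul_zero]; exact h.2))

theorem jostPsiBar_gaugeV (hζ : (ζ ^ 2).im ≤ 0) (hζ0 : ζ ≠ 0) : jostPsiBar q r ζ = fun x =>
    ζ⁻¹ • gaugeV ζ r (psiB (potV q r) q (-ζ ^ 2)) (psiA (potV q r) q (-ζ ^ 2)) x := by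
  have hζ' : 0 ≤ (-ζ ^ 2).im := by simpa using hζ
  have t := tendsto_psi (u := potV q r) (v := q) hζ'
  simp only [mul_neg, neg_mul, neg_neg] at t
  have h := tendsto_gaugeV (ζ := ζ) (tendsto_schwartz_atTop r) t.2 t.1
  exact jostPsiBar_eq hζ ((isSolution_gaugeV (isAKNS_psi hζ').swap).smul _)
    (tendsto_inv_smul hζ0 h.1) (tendsto_inv_smul hζ0 (by rw [mul_zero]; exact h.2))

theorem jostPhiBar_gaugeU (hζ : (ζ ^ 2).im ≤ 0) (hζ0 : ζ ≠ 0) : jostPhiBar q r ζ = fun x =>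
    ζ⁻¹ • gaugeU ζ q (phiB r (potU q r) (-ζ ^ 2)) (phiA r (potU q r) (-ζ ^ 2)) x := by
  have hζ' : 0 ≤ (-ζ ^ 2).im := by simpa using hζ
  have t := tendsto_phi (u := r) (v := potU q r) hζ'
  simp only [mul_neg, ← neg_mul] at t
  have h := tendsto_gaugeU (ζ := ζ) (tendsto_schwartz_atBot q) t.2 t.1
  exact jostPhiBar_eq hζ ((isSolution_gaugeU (isAKNS_phi hζ').swap).smul _)
    (tendsto_inv_smul hζ0 (by rw [mul_zero]; exact h.1)) (tendsto_inv_smul hζ0 h.2)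

end

section

/-! ### Scattering coefficients in the two gauges -/

theorem zetaOf_sq (l : ℂ) : zetaOf l ^ 2 = l := by
  have := Complex.cpow_nat_inv_pow l (n := 2) two_ne_zero
  rw [zetaOf, one_div]
  exact_mod_cast this

theorem zetaOf_ne_zero {l : ℂ} (hl : l ≠ 0) : zetaOf l ≠ 0 := fun h => hl (by
  rw [← zetaOf_sq l, h, zero_pow two_ne_zero])

variable {q r : 𝓢(ℝ, ℂ)} {ζ : ℂ}

theorem wronskian_phi_psi_gaugeV (hζ : 0 ≤ (ζ ^ 2).im) (hζ0 : ζ ≠ 0) :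
    wronskian (jostPhi q r ζ) (jostPsi q r ζ) = aCoef q (potV q r) (ζ ^ 2) := by
  rw [jostPhi_gaugeV hζ hζ0, jostPsi_gaugeV hζ]
  simp [wronskian, gaugeV, psiA, psiB, phiA, phiB, aCoef]
  field_simp
  ring

theorem wronskian_phi_psi_gaugeU (hζ : 0 ≤ (ζ ^ 2).im) (hζ0 : ζ ≠ 0) :
    wronskian (jostPhi q r ζ) (jostPsi q r ζ) = aCoef (potU q r) r (ζ ^ 2) := by
  rw [jostPhi_gaugeU hζ, jostPsi_gaugeU hζ hζ0]
  simp [wronskian, gaugeU, psiA, psiB, phiA, phiB, aCoef]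
  field_simp
  ring

theorem wronskian_bar_gaugeV (hζ : (ζ ^ 2).im ≤ 0) (hζ0 : ζ ≠ 0) :
    wronskian (jostPsiBar q r ζ) (jostPhiBar q r ζ) = aCoef (potV q r) q (-ζ ^ 2) := by
  rw [jostPhiBar_gaugeV hζ, jostPsiBar_gaugeV hζ hζ0]
  simp [wronskian, gaugeV, psiA, psiB, phiA, phiB, aCoef]
  field_simp
  ring

theorem wronskian_bar_gaugeU (hζ : (ζ ^ 2).im ≤ 0) (hζ0 : ζ ≠ 0) :
    wronskian (jostPsiBar q r ζ) (jostPhiBar q r ζ) = aCoef r (potU q r) (-ζ ^ 2) := by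
  rw [jostPhiBar_gaugeU hζ hζ0, jostPsiBar_gaugeU hζ]
  simp [wronskian, gaugeU, psiA, psiB, phiA, phiB, aCoef]
  field_simp
  ring

theorem wronskian_swap (f g : ℝ → Fin 2 → ℂ) : wronskian f g = -wronskian g f := by
  rw [wronskian, wronskian]; ring

/-- The same `R` enters as `ζR` in this gauge and as `R/ζ` in the other. Their quotient `ζ² = λ` is
why one row of the Marchenko system carries `Ω'` and the other `Ω`. -/
theorem reflR_gaugeV (hζ : (ζ ^ 2).im = 0) (hζ0 : ζ ≠ 0) :
    ζ * reflR q r ζ = reflAt q (potV q r) 0 (ζ ^ 2) := by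
  rw [reflR, wronskian_swap (jostPsi q r ζ), wronskian_phi_psi_gaugeV hζ.ge hζ0,
    jostPhi_gaugeV hζ.ge hζ0, jostPsiBar_gaugeV hζ.le hζ0]
  simp [wronskian, gaugeV, psiA, psiB, phiA, phiB, reflAt]
  field_simp
  ring

theorem reflR_gaugeU (hζ : (ζ ^ 2).im = 0) (hζ0 : ζ ≠ 0) :
    reflR q r ζ / ζ = reflAt (potU q r) r 0 (ζ ^ 2) := by
  rw [reflR, wronskian_swap (jostPsi q r ζ), wronskian_phi_psi_gaugeU hζ.ge hζ0,
    jostPhi_gaugeU hζ.ge, jostPsiBar_gaugeU hζ.le]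
  simp [wronskian, gaugeU, psiA, psiB, phiA, phiB, reflAt]
  field_simp
  ring

theorem reflRBar_gaugeV (hζ : (ζ ^ 2).im = 0) (hζ0 : ζ ≠ 0) :
    reflRBar q r ζ / ζ = reflAt (potV q r) q 0 (-ζ ^ 2) := by
  rw [reflRBar, wronskian_bar_gaugeV hζ.le hζ0,
    jostPhiBar_gaugeV hζ.le, jostPsi_gaugeV hζ.ge]
  simp [wronskian, gaugeV, psiA, psiB, phiA, phiB, reflAt]
  field_simp
  ring

theorem reflRBar_gaugeU (hζ : (ζ ^ 2).im = 0) (hζ0 : ζ ≠ 0) :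
    ζ * reflRBar q r ζ = reflAt r (potU q r) 0 (-ζ ^ 2) := by
  rw [reflRBar, wronskian_bar_gaugeU hζ.le hζ0,
    jostPhiBar_gaugeU hζ.le hζ0, jostPsi_gaugeU hζ.ge hζ0]
  simp [wronskian, gaugeU, psiA, psiB, phiA, phiB, reflAt]
  field_simp
  ring

theorem ContinuousOn.comp_ofReal {f : ℂ → ℂ} (hf : ContinuousOn f {l : ℂ | 0 ≤ l.im}) :
    Continuous fun t : ℝ => f t :=
  hf.comp_continuous Complex.continuous_ofReal fun t => by simp

theorem ContinuousOn.comp_neg_ofReal {f : ℂ → ℂ} (hf : ContinuousOn f {l : ℂ | 0 ≤ l.im}) :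
    Continuous fun t : ℝ => f (-t) :=
  hf.comp_continuous Complex.continuous_ofReal.neg fun t => by simp

/-- Each single-gauge formula contains `ζ⁻¹` and excludes `t = 0`. Writing `φ` in one gauge and `ψ`
in the other gives an expression free of `ζ⁻¹` and continuous in `t`, so both identities extend to
`t = 0` by density. -/
theorem wronskian_phi_psi_real (t : ℝ) :
    wronskian (jostPhi q r (zetaOf t)) (jostPsi q r (zetaOf t)) = aCoef q (potV q r) t ∧
      wronskian (jostPhi q r (zetaOf t)) (jostPsi q r (zetaOf t)) = aCoef (potU q r) r t := by
  have hV := isJost_mR q (potV q r)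
  have e : ∀ t : ℝ, wronskian (jostPhi q r (zetaOf t)) (jostPsi q r (zetaOf t))
      = (mL₁ (potU q r) r t 0 - Complex.I / 2 * q 0 * mL₂ (potU q r) r t 0)
        * (mR₂ q (potV q r) t 0 + Complex.I / 2 * r 0 * mR₁ q (potV q r) t 0)
        - t * (mR₁ q (potV q r) t 0 * mL₂ (potU q r) r t 0) := by
    intro t
    have h0 : (zetaOf t ^ 2).im = 0 := by rw [zetaOf_sq]; simp
    rw [jostPhi_gaugeU h0.ge, jostPsi_gaugeV h0.ge]
    simp [wronskian, gaugeU, gaugeV, psiA, psiB, phiA, phiB]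
    rw [zetaOf_sq]
    linear_combination (-(mR₁ q (potV q r) t 0 * mL₂ (potU q r) r t 0)) * zetaOf_sq t
  have hc : Continuous fun t : ℝ =>
      wronskian (jostPhi q r (zetaOf t)) (jostPsi q r (zetaOf t)) := by
    simp_rw [e]
    have c1 := ContinuousOn.comp_ofReal (contOn_mL₁ (u := potU q r) (v := r) 0)
    have c2 := ContinuousOn.comp_ofReal (contOn_mL₂ (u := potU q r) (v := r) 0)
    have c3 := ContinuousOn.comp_ofReal (hV.contOn₁ 0)
    have c4 := ContinuousOn.comp_ofReal (hV.contOn₂ 0)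
    fun_prop
  have h0 : ∀ t : ℝ, 0 ≤ (zetaOf t ^ 2).im := fun t => by rw [zetaOf_sq]; simp
  have hne : ∀ t : ℝ, t ≠ 0 → zetaOf t ≠ 0 := fun t ht => zetaOf_ne_zero (by exact_mod_cast ht)
  constructor
  · refine congrFun (Continuous.ext_on (dense_compl_singleton (0 : ℝ)) hc
      (ContinuousOn.comp_ofReal contOn_aCoef) fun t ht => ?_) t
    rw [wronskian_phi_psi_gaugeV (h0 t) (hne t ht), zetaOf_sq]
  · refine congrFun (Continuous.ext_on (dense_compl_singleton (0 : ℝ)) hc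
      (ContinuousOn.comp_ofReal contOn_aCoef) fun t ht => ?_) t
    rw [wronskian_phi_psi_gaugeU (h0 t) (hne t ht), zetaOf_sq]

theorem wronskian_bar_real (t : ℝ) :
    wronskian (jostPsiBar q r (zetaOf t)) (jostPhiBar q r (zetaOf t)) = aCoef (potV q r) q (-t) ∧
      wronskian (jostPsiBar q r (zetaOf t)) (jostPhiBar q r (zetaOf t))
        = aCoef r (potU q r) (-t) := by
  have hU := isJost_mR r (potU q r)
  have e : ∀ t : ℝ, wronskian (jostPsiBar q r (zetaOf t)) (jostPhiBar q r (zetaOf t))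
      = (mR₂ r (potU q r) (-t) 0 - Complex.I / 2 * q 0 * mR₁ r (potU q r) (-t) 0)
        * (mL₁ (potV q r) q (-t) 0 + Complex.I / 2 * r 0 * mL₂ (potV q r) q (-t) 0)
        - t * (mL₂ (potV q r) q (-t) 0 * mR₁ r (potU q r) (-t) 0) := by
    intro t
    have h0 : (zetaOf t ^ 2).im = 0 := by rw [zetaOf_sq]; simp
    rw [jostPsiBar_gaugeU h0.le, jostPhiBar_gaugeV h0.le]
    simp [wronskian, gaugeU, gaugeV, psiA, psiB, phiA, phiB]
    rw [zetaOf_sq]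
    linear_combination (-(mL₂ (potV q r) q (-t) 0 * mR₁ r (potU q r) (-t) 0)) * zetaOf_sq t
  have hc : Continuous fun t : ℝ =>
      wronskian (jostPsiBar q r (zetaOf t)) (jostPhiBar q r (zetaOf t)) := by
    simp_rw [e]
    have c1 := ContinuousOn.comp_neg_ofReal (contOn_mL₁ (u := potV q r) (v := q) 0)
    have c2 := ContinuousOn.comp_neg_ofReal (contOn_mL₂ (u := potV q r) (v := q) 0)
    have c3 := ContinuousOn.comp_neg_ofReal (hU.contOn₁ 0)
    have c4 := ContinuousOn.comp_neg_ofReal (hU.contOn₂ 0)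
    fun_prop
  have h0 : ∀ t : ℝ, (zetaOf t ^ 2).im ≤ 0 := fun t => by rw [zetaOf_sq]; simp
  have hne : ∀ t : ℝ, t ≠ 0 → zetaOf t ≠ 0 := fun t ht => zetaOf_ne_zero (by exact_mod_cast ht)
  constructor
  · refine congrFun (Continuous.ext_on (dense_compl_singleton (0 : ℝ)) hc
      (ContinuousOn.comp_neg_ofReal contOn_aCoef) fun t ht => ?_) t
    rw [wronskian_bar_gaugeV (h0 t) (hne t ht), zetaOf_sq]
  · refine congrFun (Continuous.ext_on (dense_compl_singleton (0 : ℝ)) hc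
      (ContinuousOn.comp_neg_ofReal contOn_aCoef) fun t ht => ?_) t
    rw [wronskian_bar_gaugeU (h0 t) (hne t ht), zetaOf_sq]

theorem aCoef_real_ne_zero (h : NoRealSingularity q r) {l : ℂ} (hl : l.im = 0) :
    aCoef q (potV q r) l ≠ 0 ∧ aCoef (potU q r) r l ≠ 0 ∧
      aCoef (potV q r) q l ≠ 0 ∧ aCoef r (potU q r) l ≠ 0 := by
  have hre : l = (l.re : ℂ) := Complex.ext rfl (by simpa using hl)
  have h1 := (h l.re).1
  have h2 := (h (-l.re)).2
  have w1 := wronskian_phi_psi_real (q := q) (r := r) l.re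
  have w2 := wronskian_bar_real (q := q) (r := r) (-l.re)
  rw [Complex.ofReal_neg, neg_neg] at w2
  rw [Complex.ofReal_neg] at h2
  rw [hre]
  exact ⟨w1.1 ▸ h1, w1.2 ▸ h1, w2.1 ▸ h2, w2.2 ▸ h2⟩

/-! ### Zeros of the Wronskian and poles of the transmission coefficient -/

variable {u v : 𝓢(ℝ, ℂ)}

/-- By the identity theorem a non-isolated zero would make the function vanish on the whole half
plane, contrary to its limit `1` at infinity. -/
theorem aCoef_eventually_ne_zero {l : ℂ} (hl : 0 < l.im) :
    ∀ᶠ z in 𝓝[≠] l, aCoef u v z ≠ 0 := by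
  have han : AnalyticOnNhd ℂ (aCoef u v) {l : ℂ | 0 < l.im} :=
    diffOn_aCoef.analyticOnNhd isOpen_upper
  refine (han l hl).eventually_eq_zero_or_eventually_ne_zero.resolve_left fun h0 => ?_
  have hz := han.eqOn_zero_of_preconnected_of_eventuallyEq_zero
    (convex_halfSpace_im_gt 0).isPreconnected hl h0
  have h1 := (tendsto_aCoef (u := u) (v := v)).comp tendsto_I_mul_upInf
  have h2 : Tendsto (aCoef u v ∘ fun τ : ℝ => Complex.I * τ) atTop (𝓝 0) := by
    refine tendsto_const_nhds.congr' ?_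
    filter_upwards [eventually_gt_atTop 0] with τ hτ
    exact (hz (show 0 < (Complex.I * τ).im by simpa using hτ)).symm
  exact one_ne_zero (tendsto_nhds_unique h1 h2)

theorem meromorphicOrderAt_neg_of_zero {h : ℂ → ℂ} {T : ℂ → ℂ} {l : ℂ} (hd : AnalyticAt ℂ h l)
    (hne : ∀ᶠ z in 𝓝[≠] l, h z ≠ 0) (h0 : h l = 0) (hT : ∀ᶠ z in 𝓝[≠] l, T z = 1 / h z) :
    meromorphicOrderAt T l < 0 := by
  have hT' : T =ᶠ[𝓝[≠] l] h⁻¹ := by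
    filter_upwards [hT] with z hz
    rw [hz, Pi.inv_apply, one_div]
  rw [meromorphicOrderAt_congr hT', ← tendsto_cobounded_iff_meromorphicOrderAt_neg
    hd.meromorphicAt.inv]
  refine tendsto_inv₀_nhdsNE_zero.comp (tendsto_nhdsWithin_iff.2 ⟨?_, hne⟩)
  have := hd.continuousAt.tendsto.mono_left (nhdsWithin_le_nhds (s := {l}ᶜ))
  rwa [h0] at this

end

section

/-! ### Operations on pole families -/

namespace PoleFamily

theorem eventually_ne_nhdsNE (e μ : ℂ) : ∀ᶠ l in 𝓝[≠] e, l ≠ μ := by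
  by_cases h : e = μ
  · subst h; exact eventually_mem_nhdsWithin
  · exact eventually_nhdsWithin_of_eventually_nhds (isOpen_ne.mem_nhds h)

theorem isBigO_sum_one {ι : Type*} {s : Finset ι} {F : Filter ℂ} {f : ι → ℂ → ℂ}
    (h : ∀ i ∈ s, f i =O[F] fun _ => (1 : ℂ)) :
    (fun l => ∑ i ∈ s, f i l) =O[F] fun _ => (1 : ℂ) :=
  (IsBigO.sum h).congr_left fun _ => Finset.sum_apply _ _ _

theorem isBigO_pow_inv_of_ne {e μ : ℂ} (h : e ≠ μ) (a : ℕ) :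
    (fun l : ℂ => ((l - μ) ^ a)⁻¹) =O[𝓝[≠] e] fun _ => (1 : ℂ) := by
  have : ContinuousAt (fun l : ℂ => ((l - μ) ^ a)⁻¹) e :=
    ContinuousAt.inv₀ (by fun_prop) (pow_ne_zero _ (sub_ne_zero.2 h))
  exact (this.tendsto.isBigO_one ℂ).mono nhdsWithin_le_nhds

/-- The family whose kernel is `c` times the kernel of `p`. -/
def smul (c : ℂ) (p : PoleFamily) : PoleFamily := { p with coeff := fun i => c * p.coeff i }

theorem kernel_smul (c : ℂ) (p : PoleFamily) (y : ℝ) : (p.smul c).kernel y = c * p.kernel y := by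
  simp only [kernel, Finset.mul_sum]
  exact Finset.sum_congr rfl fun i _ => mul_assoc _ _ _

theorem principal_smul (c : ℂ) (p : PoleFamily) (l : ℂ) :
    (p.smul c).principal l = c * p.principal l := by
  simp only [principal, Finset.mul_sum]
  exact Finset.sum_congr rfl fun i _ => mul_assoc _ _ _

/-- The family whose kernel is `y ↦ p.kernel (t + y)`. -/
def shift (p : PoleFamily) (t : ℝ) : PoleFamily where
  ι := Σ i : p.ι, Fin (p.ord i + 1)
  fin := inferInstance
  loc i := p.loc i.1
  ord i := i.2
  coeff i := p.coeff i.1 * expPoly (p.loc i.1) (p.ord i.1 - i.2) t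

theorem range_loc_shift (p : PoleFamily) (t : ℝ) : Set.range (p.shift t).loc = Set.range p.loc := by
  ext l
  constructor
  · rintro ⟨i, rfl⟩; exact ⟨i.1, rfl⟩
  · rintro ⟨i, rfl⟩; exact ⟨⟨i, 0⟩, rfl⟩

theorem kernel_shift (p : PoleFamily) (t y : ℝ) : (p.shift t).kernel y = p.kernel (t + y) := by
  have e : (p.shift t).kernel y = ∑ i : Σ i : p.ι, Fin (p.ord i + 1),
      p.coeff i.1 * expPoly (p.loc i.1) (p.ord i.1 - i.2) t * expPoly (p.loc i.1) i.2 y := rfl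
  rw [e, Fintype.sum_sigma, kernel]
  refine Finset.sum_congr rfl fun i _ => ?_
  rw [expPoly_add, Finset.mul_sum, Finset.sum_range]
  exact Finset.sum_congr rfl fun b _ => by ring

/-- The sum is the polar part at `μ` of `e^{ilt} / (l - μ) ^ (a + 1)`: after factoring out `e^{iμt}`
the difference is a Taylor remainder of the exponential divided by the matching power. -/
theorem isBigO_shift_term (μ : ℂ) (a : ℕ) (t : ℝ) (e : ℂ) :
    (fun l : ℂ => (∑ b ∈ Finset.range (a + 1), expPoly μ (a - b) t * ((l - μ) ^ (b + 1))⁻¹) -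
      Complex.exp (Complex.I * l * t) * ((l - μ) ^ (a + 1))⁻¹) =O[𝓝[≠] e] fun _ => (1 : ℂ) := by
  by_cases h : e = μ
  · subst h
    have h0 : Tendsto (fun l : ℂ => Complex.I * t * (l - e)) (𝓝[≠] e) (𝓝 0) := by
      have : ContinuousAt (fun l : ℂ => Complex.I * t * (l - e)) e := by fun_prop
      simpa using this.tendsto.mono_left nhdsWithin_le_nhds
    have h1 := (Complex.exp_sub_sum_range_isBigO_pow (a + 1)).comp_tendsto h0
    simp only [Function.comp_def] at h1
    have h2 : (fun l : ℂ => (Complex.I * t * (l - e)) ^ (a + 1)) =O[𝓝[≠] e]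
        fun l => (l - e) ^ (a + 1) :=
      ((isBigO_refl _ _).const_mul_left ((Complex.I * t) ^ (a + 1))).congr_left fun l =>
        (mul_pow _ _ _).symm
    have h3 := ((h1.trans h2).mul
      (isBigO_refl (fun l : ℂ => ((l - e) ^ (a + 1))⁻¹) (𝓝[≠] e))).const_mul_left
      (-Complex.exp (Complex.I * e * t))
    refine h3.congr' ?_ ?_
    · filter_upwards [eventually_ne_nhdsNE e e] with l hl
      have hl' : l - e ≠ 0 := sub_ne_zero.2 hl
      have e1 : Complex.exp (Complex.I * l * t)
          = Complex.exp (Complex.I * e * t) * Complex.exp (Complex.I * t * (l - e)) := by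
        rw [← Complex.exp_add]; congr 1; ring
      rw [e1, sub_mul, Finset.sum_mul,
        ← Finset.sum_range_reflect fun b => expPoly e (a - b) t * ((l - e) ^ (b + 1))⁻¹]
      have e2 : ∀ b ∈ Finset.range (a + 1),
          expPoly e (a - (a + 1 - 1 - b)) t * ((l - e) ^ (a + 1 - 1 - b + 1))⁻¹ =
          Complex.exp (Complex.I * e * t) *
            ((Complex.I * t * (l - e)) ^ b / (b.factorial : ℂ) * ((l - e) ^ (a + 1))⁻¹) := by
        intro b hb
        have hb' : b ≤ a := Nat.lt_succ_iff.1 (Finset.mem_range.1 hb)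
        obtain ⟨c, rfl⟩ := Nat.exists_eq_add_of_le hb'
        rw [show b + c - (b + c + 1 - 1 - b) = b by omega,
          show b + c + 1 - 1 - b + 1 = c + 1 by omega, expPoly, mul_pow,
          show (l - e) ^ (b + c + 1) = (l - e) ^ b * (l - e) ^ (c + 1) by ring]
        have := pow_ne_zero b hl'
        have := pow_ne_zero (c + 1) hl'
        field_simp
        rw [mul_pow, mul_pow]
      rw [Finset.sum_congr rfl e2, ← Finset.mul_sum]
      ring
    · filter_upwards [eventually_ne_nhdsNE e e] with l hl
      exact mul_inv_cancel₀ (pow_ne_zero _ (sub_ne_zero.2 hl))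
  · have hE : (fun l : ℂ => Complex.exp (Complex.I * l * t)) =O[𝓝[≠] e] fun _ => (1 : ℂ) := by
      have : ContinuousAt (fun l : ℂ => Complex.exp (Complex.I * l * t)) e := by fun_prop
      exact (this.tendsto.isBigO_one ℂ).mono nhdsWithin_le_nhds
    have h2 := hE.mul (isBigO_pow_inv_of_ne h (a + 1))
    simp only [mul_one] at h2
    exact (isBigO_sum_one fun b _ => (isBigO_pow_inv_of_ne h (b + 1)).const_mul_left _).sub h2

theorem isBigO_principal_shift (p : PoleFamily) (t : ℝ) (e : ℂ) :
    (fun l => (p.shift t).principal l - Complex.exp (Complex.I * l * t) * p.principal l)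
      =O[𝓝[≠] e] fun _ => (1 : ℂ) := by
  have h := isBigO_sum_one (s := Finset.univ) fun (i : p.ι) _ =>
    (isBigO_shift_term (p.loc i) (p.ord i) t e).const_mul_left (p.coeff i)
  refine h.congr_left fun l => ?_
  have e1 : (p.shift t).principal l = ∑ i : Σ i : p.ι, Fin (p.ord i + 1),
      p.coeff i.1 * expPoly (p.loc i.1) (p.ord i.1 - i.2) t *
        ((l - p.loc i.1) ^ ((i.2 : ℕ) + 1))⁻¹ := rfl
  rw [e1, Fintype.sum_sigma, principal, Finset.mul_sum, ← Finset.sum_sub_distrib]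
  refine Finset.sum_congr rfl fun i _ => ?_
  rw [mul_sub, Finset.mul_sum, Finset.sum_range]
  congr 1
  · exact Finset.sum_congr rfl fun b _ => by ring
  · ring

/-- The family whose kernel is `-i` times the derivative of the kernel of `p`. -/
def deriv (p : PoleFamily) : PoleFamily where
  ι := p.ι ⊕ p.ι
  fin := inferInstance
  loc := Sum.elim p.loc p.loc
  ord := Sum.elim p.ord fun i => p.ord i - 1
  -- At order `0` truncated subtraction keeps the order `0`, although differentiation produces no
  -- second term; the zero coefficient discards it.
  coeff := Sum.elim (fun i => p.coeff i * p.loc i) fun i => if p.ord i = 0 then 0 else p.coeff i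

theorem range_loc_deriv (p : PoleFamily) : Set.range p.deriv.loc = Set.range p.loc := by
  show Set.range (Sum.elim p.loc p.loc) = _
  rw [Set.Sum.elim_range, Set.union_self]

theorem hasDerivAt_kernel (p : PoleFamily) (y : ℝ) :
    HasDerivAt p.kernel (Complex.I * p.deriv.kernel y) y := by
  have e : p.deriv.kernel y = ∑ i : p.ι ⊕ p.ι,
      p.deriv.coeff i * expPoly (p.deriv.loc i) (p.deriv.ord i) y := rfl
  rw [e, Fintype.sum_sum_type, ← Finset.sum_add_distrib, Finset.mul_sum]
  unfold kernel
  refine HasDerivAt.fun_sum fun i _ => ?_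
  simp only [deriv, Sum.elim_inl, Sum.elim_inr]
  rcases hn : p.ord i with _ | a
  · refine ((hasDerivAt_expPoly_zero (p.loc i) y).const_mul (p.coeff i)).congr_deriv ?_
    simp; ring
  · refine ((hasDerivAt_expPoly_succ (p.loc i) a y).const_mul (p.coeff i)).congr_deriv ?_
    simp; ring

/-- From `l = λ_i + (l - λ_i)` each pole splits into one of the same order with coefficient
multiplied by `λ_i` and one of order lower by one. For a simple pole the second part is a constant,
which accounts for the whole difference. -/
theorem isBigO_principal_deriv (p : PoleFamily) (e : ℂ) :
    (fun l => p.deriv.principal l - l * p.principal l) =O[𝓝[≠] e] fun _ => (1 : ℂ) := by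
  have h : (fun _ : ℂ => ∑ i, if p.ord i = 0 then -p.coeff i else 0) =O[𝓝[≠] e]
      fun _ => (1 : ℂ) := isBigO_const_const _ one_ne_zero _
  refine h.congr' ?_ EventuallyEq.rfl
  have hne : ∀ᶠ l in 𝓝[≠] e, ∀ i : p.ι, l ≠ p.loc i :=
    eventually_all.2 fun i => eventually_ne_nhdsNE e _
  filter_upwards [hne] with l hl
  have e1 : p.deriv.principal l = ∑ i : p.ι ⊕ p.ι,
      p.deriv.coeff i * ((l - p.deriv.loc i) ^ (p.deriv.ord i + 1))⁻¹ := rfl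
  rw [e1, Fintype.sum_sum_type, ← Finset.sum_add_distrib, principal, Finset.mul_sum,
    ← Finset.sum_sub_distrib]
  refine Finset.sum_congr rfl fun i _ => ?_
  have h0 := sub_ne_zero.2 (hl i)
  simp only [deriv, Sum.elim_inl, Sum.elim_inr]
  rcases hn : p.ord i with _ | a
  · simp; field_simp; ring
  · simp; field_simp; ring

end PoleFamily

/-! ### The matrix exponential of a block Jordan matrix -/

namespace BoundStates

variable (b : BoundStates)

/-- The vector `e^{tA} B`, written out. -/
def chain (t : ℂ) (p : b.Idx) : ℂ :=
  t ^ (b.mult p.1 - 1 - p.2) / ((b.mult p.1 - 1 - p.2 : ℕ).factorial : ℂ) *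
    Complex.exp (t * b.pole p.1)

theorem chain_zero : b.chain 0 = b.vecB := by
  funext p
  have hp := p.2.2
  by_cases h : p.2.val + 1 = b.mult p.1
  · have h0 : b.mult p.1 - 1 - p.2.val = 0 := by omega
    simp [chain, vecB, h, h0]
  · have h0 : b.mult p.1 - 1 - p.2.val ≠ 0 := by omega
    simp [chain, vecB, h, h0]

theorem matA_mulVec_chain (t : ℂ) (p : b.Idx) :
    (b.matA.mulVec (b.chain t)) p = b.pole p.1 * b.chain t p +
      if h : p.2.val + 1 < b.mult p.1 then b.chain t ⟨p.1, ⟨p.2.val + 1, h⟩⟩ else 0 := by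
  obtain ⟨j, i⟩ := p
  rw [Matrix.mulVec, dotProduct, Fintype.sum_sigma, Finset.sum_eq_single j]
  · simp only [matA, Matrix.blockDiagonal'_apply_eq, Matrix.of_apply]
    rw [← Finset.add_sum_erase _ _ (Finset.mem_univ i)]
    simp only [if_true]
    congr 1
    split_ifs with h
    · rw [Finset.sum_eq_single ⟨i.val + 1, h⟩]
      · have : i ≠ ⟨i.val + 1, h⟩ := fun hh => by have := congrArg Fin.val hh; simp at this
        simp [this]
      · intro k hk hk'
        have h1 : i ≠ k := (Finset.ne_of_mem_erase hk).symm
        have h2 : i.val + 1 ≠ k.val := fun hh => hk' (Fin.ext hh.symm)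
        simp [h1, h2]
      · intro hk
        refine absurd (Finset.mem_erase.2 ⟨fun hh => ?_, Finset.mem_univ _⟩) hk
        have := congrArg Fin.val hh; simp at this
    · refine Finset.sum_eq_zero fun k hk => ?_
      have h1 : i ≠ k := (Finset.ne_of_mem_erase hk).symm
      have h2 : i.val + 1 ≠ k.val := fun hh => h (hh ▸ k.2)
      simp [h1, h2]
  · intro j' _ hj
    refine Finset.sum_eq_zero fun k _ => ?_
    rw [matA, Matrix.blockDiagonal'_apply_ne _ _ _ hj.symm, zero_mul]
  · simp

theorem hasDerivAt_chain (t : ℂ) (p : b.Idx) :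
    HasDerivAt (fun t => b.chain t p) ((b.matA.mulVec (b.chain t)) p) t := by
  rw [matA_mulVec_chain]
  have hE : HasDerivAt (fun t : ℂ => Complex.exp (t * b.pole p.1))
      (Complex.exp (t * b.pole p.1) * (1 * b.pole p.1)) t :=
    ((hasDerivAt_id t).mul_const _).cexp
  have hp := p.2.2
  unfold chain
  split_ifs with h
  · obtain ⟨a, ha⟩ : ∃ a, b.mult p.1 - 1 - p.2.val = a + 1 :=
      ⟨b.mult p.1 - 1 - p.2.val - 1, by omega⟩
    have ha' : b.mult p.1 - 1 - (p.2.val + 1) = a := by omega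
    simp only [ha, ha']
    have h1 := (((hasDerivAt_id t).pow (a + 1)).div_const ((a + 1).factorial : ℂ)).mul hE
    refine h1.congr_deriv ?_
    have f1 : ((a.factorial : ℕ) : ℂ) ≠ 0 := by exact_mod_cast a.factorial_ne_zero
    have f2 : ((a : ℂ) + 1) ≠ 0 := by exact_mod_cast a.succ_ne_zero
    rw [Nat.factorial_succ]
    push_cast
    simp
    field_simp
    ring
  · have ha : b.mult p.1 - 1 - p.2.val = 0 := by omega
    simp only [ha, pow_zero, Nat.factorial_zero, Nat.cast_one, div_one, one_mul, add_zero]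
    refine hE.congr_deriv ?_
    ring

section

attribute [local instance] Matrix.linftyOpNormedRing Matrix.linftyOpNormedAlgebra

theorem hasDerivAt_exp_entry {n : Type*} [Fintype n] [DecidableEq n] (M : Matrix n n ℂ) (t : ℂ)
    (i k : n) :
    HasDerivAt (fun t : ℂ => NormedSpace.exp (t • M) i k) ((NormedSpace.exp (t • M) * M) i k) t := by
  have h := hasDerivAt_exp_smul_const (𝕂 := ℂ) M t
  have hL : Continuous (Matrix.entryLinearMap ℂ ℂ i k : Matrix n n ℂ →ₗ[ℂ] ℂ) :=
    continuous_id.matrix_elem i k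
  exact (ContinuousLinearMap.mk _ hL).hasFDerivAt.comp_hasDerivAt t h

end

/-- The explicit vector `chain` solves `X' = A X` with `X(0) = B`, so `e^{-tA} X(t)` is constant and
equal to `B`. -/
theorem exp_mulVec_vecB (t : ℂ) :
    (NormedSpace.exp (t • b.matA)).mulVec b.vecB = b.chain t := by
  have key : ∀ t i, (NormedSpace.exp (t • (-b.matA))).mulVec (b.chain t) i = b.vecB i := by
    intro t i
    have hd : ∀ t, HasDerivAt
        (fun t => (NormedSpace.exp (t • (-b.matA))).mulVec (b.chain t) i) 0 t := by
      intro t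
      have h := HasDerivAt.fun_sum (u := Finset.univ) fun k _ =>
        (hasDerivAt_exp_entry (-b.matA) t i k).mul (b.hasDerivAt_chain t k)
      refine h.congr_deriv ?_
      rw [Finset.sum_add_distrib]
      have e1 : ∑ k, (NormedSpace.exp (t • (-b.matA)) * -b.matA) i k * b.chain t k
          = -(NormedSpace.exp (t • (-b.matA))).mulVec (b.matA.mulVec (b.chain t)) i := by
        rw [Matrix.mulVec_mulVec, mul_neg]
        simp [Matrix.mulVec, dotProduct]
      rw [e1]
      exact neg_add_cancel _
    have h0 := is_const_of_deriv_eq_zero (fun t => (hd t).differentiableAt)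
      (fun t => (hd t).deriv) t 0
    rw [h0, zero_smul, NormedSpace.exp_zero, Matrix.one_mulVec, chain_zero]
  have h1 : NormedSpace.exp (t • b.matA) * NormedSpace.exp (t • (-b.matA)) = 1 := by
    rw [smul_neg, ← Matrix.exp_add_of_commute _ _ ((Commute.refl (t • b.matA)).neg_right), add_neg_cancel,
      NormedSpace.exp_zero]
  rw [← show (NormedSpace.exp (t • (-b.matA))).mulVec (b.chain t) = b.vecB from funext (key t),
    Matrix.mulVec_mulVec, h1, Matrix.one_mulVec]

theorem expTerm_eq (s : ℂ) (y : ℝ) : b.expTerm s y = ∑ p : b.Idx,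
    b.c p.1 p.2 * ((s * y) ^ (p.2 : ℕ) / ((p.2 : ℕ).factorial : ℂ) *
      Complex.exp (s * y * b.pole p.1)) := by
  rw [expTerm, exp_mulVec_vecB, dotProduct, Fintype.sum_sigma, Fintype.sum_sigma]
  refine Finset.sum_congr rfl fun j _ => ?_
  -- The row `C` lists the normalization constants in decreasing order, while the entries of `e^{tA}
  -- B` carry decreasing powers; reversing the index pairs `c_{jk}` with the power `k`.
  rw [← Equiv.sum_comp Fin.revPerm]
  refine Finset.sum_congr rfl fun k _ => ?_
  have hk := k.2
  simp only [vecC, chain, Fin.revPerm_apply, Fin.rev_rev, Fin.val_rev]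
  rw [show b.mult j - 1 - (b.mult j - (k.val + 1)) = k.val by omega]

/-- The bound states in the upper half plane as a pole family. -/
def upperFamily : PoleFamily where
  ι := b.Idx
  fin := inferInstance
  loc p := b.pole p.1
  ord p := p.2
  coeff p := b.c p.1 p.2

/-- The bound states in the lower half plane, reflected to the upper one. -/
def lowerFamily : PoleFamily where
  ι := b.Idx
  fin := inferInstance
  loc p := -b.pole p.1
  ord p := p.2
  -- The sign comes from `(-iy) ^ k = (-1) ^ k (iy) ^ k`.
  coeff p := (-1) ^ (p.2 : ℕ) * b.c p.1 p.2

theorem expTerm_upper (y : ℝ) : b.expTerm Complex.I y = b.upperFamily.kernel y := by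
  rw [expTerm_eq]
  refine Finset.sum_congr rfl fun p _ => ?_
  show _ = b.c p.1 p.2 * expPoly (b.pole p.1) p.2 y
  rw [expPoly]
  congr 3; ring

theorem expTerm_lower (y : ℝ) : b.expTerm (-Complex.I) y = b.lowerFamily.kernel y := by
  rw [expTerm_eq]
  refine Finset.sum_congr rfl fun p _ => ?_
  show _ = (-1) ^ (p.2 : ℕ) * b.c p.1 p.2 * expPoly (-b.pole p.1) p.2 y
  rw [expPoly, show -Complex.I * (y : ℂ) = -1 * (Complex.I * y) by ring, mul_pow,
    show -1 * (Complex.I * (y : ℂ)) * b.pole p.1 = Complex.I * -b.pole p.1 * y by ring]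
  ring

variable {b}

theorem range_loc_upperFamily (hm : ∀ j, 0 < b.mult j) :
    Set.range b.upperFamily.loc = Set.range b.pole := by
  ext l
  constructor
  · rintro ⟨p, rfl⟩; exact ⟨p.1, rfl⟩
  · rintro ⟨j, rfl⟩; exact ⟨⟨j, ⟨0, hm j⟩⟩, rfl⟩

theorem range_loc_lowerFamily (hm : ∀ j, 0 < b.mult j) :
    Set.range b.lowerFamily.loc = Set.range fun j => -b.pole j := by
  ext l
  constructor
  · rintro ⟨p, rfl⟩; exact ⟨p.1, rfl⟩
  · rintro ⟨j, rfl⟩; exact ⟨⟨j, ⟨0, hm j⟩⟩, rfl⟩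

theorem isBigO_principal_block {c : (j : Fin b.N) → Fin (b.mult j) → ℂ} {w : Fin b.N → ℂ}
    (hw : Function.Injective w) (j : Fin b.N) :
    (fun z : ℂ => (∑ p : b.Idx, c p.1 p.2 * ((z - w p.1) ^ ((p.2 : ℕ) + 1))⁻¹) -
      ∑ k, c j k * ((z - w j) ^ ((k : ℕ) + 1))⁻¹) =O[𝓝[≠] (w j)] fun _ => (1 : ℂ) := by
  have h := PoleFamily.isBigO_sum_one (s := Finset.univ.erase j) fun j' hj' =>
    PoleFamily.isBigO_sum_one (s := Finset.univ) fun (k : Fin (b.mult j')) _ =>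
      (PoleFamily.isBigO_pow_inv_of_ne (hw.ne (Finset.ne_of_mem_erase hj').symm)
        ((k : ℕ) + 1)).const_mul_left (c j' k)
  refine h.congr_left fun z => ?_
  rw [Fintype.sum_sigma, ← Finset.add_sum_erase _ _ (Finset.mem_univ j), add_sub_cancel_left]

end BoundStates

end

section

/-! ### Residue conditions at the bound states -/

open PoleFamily (eventually_ne_nhdsNE)

theorem _root_.ContinuousAt.isBigO_one_nhdsNE {f : ℂ → ℂ} {e : ℂ} (h : ContinuousAt f e) :
    f =O[𝓝[≠] e] fun _ => (1 : ℂ) :=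
  (h.tendsto.isBigO_one ℂ).mono nhdsWithin_le_nhds

theorem isBigO_one_mul {F : Filter ℂ} {f g : ℂ → ℂ} (hf : f =O[F] fun _ => (1 : ℂ))
    (hg : g =O[F] fun _ => (1 : ℂ)) : (fun z => f z * g z) =O[F] fun _ => (1 : ℂ) := by
  simpa using hf.mul hg

theorem continuousAt_zetaOf {e : ℂ} (he : e.im ≠ 0) : ContinuousAt zetaOf e :=
  continuousAt_cpow_const (Complex.mem_slitPlane_iff.2 (Or.inr he))

/-- The pole of `T` has order `m_j` and `f - γ_j g` vanishes to that order, so `T f` may be replaced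
by `T γ_j g` up to a bounded error. The polar part of `T γ_j / ζ` is prescribed by the normalization
constants. -/
theorem IsBoundStateData.near {U : Set ℂ} {T : ℂ → ℂ} {f g : ℂ → ℝ → Fin 2 → ℂ} {s : ℂ}
    {b : BoundStates} (h : IsBoundStateData U T f g s b) (j : Fin b.N) (he : (b.pole j).im ≠ 0)
    (x : ℝ) (i : Fin 2)
    (hg : (fun z => g (zetaOf z) x i) =O[𝓝[≠] (b.pole j)] fun _ => (1 : ℂ)) :
    (fun z => T (zetaOf z) * f (zetaOf z) x i -
        zetaOf z * (∑ k, s * b.c j k / (z - b.pole j) ^ ((k : ℕ) + 1)) * g (zetaOf z) x i)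
      =O[𝓝[≠] (b.pole j)] fun _ => (1 : ℂ) := by
  obtain ⟨γ, h1, h2⟩ := h.norming j
  set e := b.pole j
  have hm := h.mult_pos j
  -- The order of a function that is not meromorphic is `0` by convention, so a nonzero order
  -- already entails meromorphy.
  have hT : MeromorphicAt (fun z => T (zetaOf z)) e :=
    meromorphicAt_of_meromorphicOrderAt_ne_zero (by
      rw [h.order j]; exact_mod_cast (by omega : (-(b.mult j : ℤ)) ≠ 0))
  obtain ⟨T₀, hT₀, -, hTe⟩ := (meromorphicOrderAt_eq_int_iff hT).1 (h.order j)
  have a1 : (fun z => T (zetaOf z)) =O[𝓝[≠] e] fun z => ((z - e) ^ (b.mult j))⁻¹ := by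
    have := (isBigO_refl (fun z => ((z - e) ^ (b.mult j))⁻¹) (𝓝[≠] e)).mul
      hT₀.continuousAt.isBigO_one_nhdsNE
    simp only [mul_one] at this
    refine this.congr' ?_ EventuallyEq.rfl
    filter_upwards [hTe] with z hz
    rw [hz, zpow_neg, zpow_natCast, smul_eq_mul]
  have a2 := ((isBigO_pi.1 (h1 x) i).mono nhdsWithin_le_nhds : _ =O[𝓝[≠] e] _)
  have a3 := (a1.mul a2).trans (show (fun z => ((z - e) ^ (b.mult j))⁻¹ * (z - e) ^ (b.mult j))
      =O[𝓝[≠] e] fun _ => (1 : ℂ) from by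
    refine (isBigO_refl (fun _ => (1 : ℂ)) _).congr' ?_ EventuallyEq.rfl
    filter_upwards [eventually_ne_nhdsNE e e] with z hz
    exact (inv_mul_cancel₀ (pow_ne_zero _ (sub_ne_zero.2 hz))).symm)
  have a4 := isBigO_one_mul (isBigO_one_mul (continuousAt_zetaOf he).isBigO_one_nhdsNE hg) h2
  refine (a3.add a4).congr' ?_ EventuallyEq.rfl
  filter_upwards [eventually_ne_nhdsNE e 0] with z hz
  have hz' := zetaOf_ne_zero hz
  simp only [Pi.sub_apply, Pi.smul_apply, smul_eq_mul]
  field_simp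
  ring

variable {q r : 𝓢(ℝ, ℂ)}

section

variable {u v : 𝓢(ℝ, ℂ)}

theorem continuousAt_mR {e : ℂ} (he : 0 < e.im) (x : ℝ) :
    ContinuousAt (fun l => mR₁ u v l x) e ∧ ContinuousAt (fun l => mR₂ u v l x) e :=
  have h := isJost_mR u v
  ⟨((h.diffOn₁ x).differentiableAt (isOpen_upper.mem_nhds he)).continuousAt,
    ((h.diffOn₂ x).differentiableAt (isOpen_upper.mem_nhds he)).continuousAt⟩

theorem continuousAt_psi {e : ℂ} (he : 0 < e.im) (x : ℝ) :
    ContinuousAt (fun l => psiA u v l x) e ∧ ContinuousAt (fun l => psiB u v l x) e := by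
  have h := continuousAt_mR (u := u) (v := v) he x
  have hE : ContinuousAt (fun l : ℂ => Complex.exp (Complex.I * l * x)) e := by fun_prop
  exact ⟨hE.mul h.1, hE.mul h.2⟩

end

theorem eventually_upper {e : ℂ} (he : 0 < e.im) : ∀ᶠ z in 𝓝[≠] e, 0 < z.im :=
  eventually_nhdsWithin_of_eventually_nhds (isOpen_upper.mem_nhds he)

theorem tendsto_neg_nhdsNE (e : ℂ) : Tendsto (fun z : ℂ => -z) (𝓝[≠] e) (𝓝[≠] (-e)) := by
  refine tendsto_nhdsWithin_iff.2 ⟨continuous_neg.continuousAt.mono_left nhdsWithin_le_nhds, ?_⟩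
  filter_upwards [eventually_mem_nhdsWithin] with z hz hz'
  exact hz (neg_injective hz')

theorem ne_zero_of_im_pos {z : ℂ} (hz : 0 < z.im) : z ≠ 0 := fun h => by simp [h] at hz

theorem im_sq_zetaOf {z : ℂ} (hz : 0 < z.im) : 0 ≤ (zetaOf z ^ 2).im := by
  rw [zetaOf_sq]; exact hz.le

theorem im_sq_zetaOf_neg {z : ℂ} (hz : 0 < z.im) : (zetaOf (-z) ^ 2).im ≤ 0 := by
  rw [zetaOf_sq]; simpa using hz.le

theorem transT_eq {z : ℂ} (hz : 0 < z.im) : transT q r (zetaOf z) = 1 / aCoef q (potV q r) z ∧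
    transT q r (zetaOf z) = 1 / aCoef (potU q r) r z := by
  have h0 := zetaOf_ne_zero (ne_zero_of_im_pos hz)
  rw [transT]
  constructor
  · rw [wronskian_phi_psi_gaugeV (im_sq_zetaOf hz) h0, zetaOf_sq]
  · rw [wronskian_phi_psi_gaugeU (im_sq_zetaOf hz) h0, zetaOf_sq]

theorem transTBar_eq {z : ℂ} (hz : 0 < z.im) :
    transTBar q r (zetaOf (-z)) = 1 / aCoef (potV q r) q z ∧
    transTBar q r (zetaOf (-z)) = 1 / aCoef r (potU q r) z := by
  have h0 := zetaOf_ne_zero (neg_ne_zero.2 (ne_zero_of_im_pos hz))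
  rw [transTBar]
  constructor
  · rw [wronskian_bar_gaugeV (im_sq_zetaOf_neg hz) h0, zetaOf_sq, neg_neg]
  · rw [wronskian_bar_gaugeU (im_sq_zetaOf_neg hz) h0, zetaOf_sq, neg_neg]

theorem IsUpperBoundStates.mem_range {b : BoundStates} (h : IsUpperBoundStates q r b) {l : ℂ}
    (hl : 0 < l.im) (h0 : aCoef q (potV q r) l = 0 ∨ aCoef (potU q r) r l = 0) :
    l ∈ Set.range b.upperFamily.loc := by
  rw [BoundStates.range_loc_upperFamily h.mult_pos]
  refine h.complete l hl ?_
  rcases h0 with h0 | h0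
  · refine meromorphicOrderAt_neg_of_zero
      (diffOn_aCoef.analyticOnNhd isOpen_upper l hl) (aCoef_eventually_ne_zero hl) h0 ?_
    filter_upwards [eventually_upper hl] with z hz using (transT_eq hz).1
  · refine meromorphicOrderAt_neg_of_zero
      (diffOn_aCoef.analyticOnNhd isOpen_upper l hl) (aCoef_eventually_ne_zero hl) h0 ?_
    filter_upwards [eventually_upper hl] with z hz using (transT_eq hz).2

theorem IsLowerBoundStates.mem_range {b : BoundStates} (h : IsLowerBoundStates q r b) {l : ℂ}
    (hl : 0 < l.im) (h0 : aCoef (potV q r) q l = 0 ∨ aCoef r (potU q r) l = 0) :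
    l ∈ Set.range b.lowerFamily.loc := by
  rw [BoundStates.range_loc_lowerFamily h.mult_pos]
  have hneg : ∀ {u v : 𝓢(ℝ, ℂ)}, AnalyticAt ℂ (fun z => aCoef u v (-z)) (-l) := fun {u v} => by
    have h1 : AnalyticAt ℂ (aCoef u v) (- -l) := by
      rw [neg_neg]; exact diffOn_aCoef.analyticOnNhd isOpen_upper l hl
    exact h1.comp analyticAt_id.neg
  have ht := tendsto_neg_nhdsNE (-l)
  rw [neg_neg] at ht
  obtain ⟨j, hj⟩ := h.complete (-l) (by simpa using hl) (by
    rcases h0 with h0 | h0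
    · refine meromorphicOrderAt_neg_of_zero hneg (ht.eventually (aCoef_eventually_ne_zero hl))
        (by simpa using h0) ?_
      filter_upwards [ht.eventually (eventually_upper hl)] with z hz
      simpa using (transTBar_eq (q := q) (r := r) hz).1
    · refine meromorphicOrderAt_neg_of_zero hneg (ht.eventually (aCoef_eventually_ne_zero hl))
        (by simpa using h0) ?_
      filter_upwards [ht.eventually (eventually_upper hl)] with z hz
      simpa using (transTBar_eq (q := q) (r := r) hz).2)
  exact ⟨j, by simp [hj]⟩

theorem IsUpperBoundStates.near {b : BoundStates} (h : IsUpperBoundStates q r b) (j : Fin b.N)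
    (x : ℝ) (i : Fin 2) :
    (fun z => transT q r (zetaOf z) * jostPhi q r (zetaOf z) x i -
        zetaOf z * (Complex.I * b.upperFamily.principal z) * jostPsi q r (zetaOf z) x i)
      =O[𝓝[≠] (b.pole j)] fun _ => (1 : ℂ) := by
  have he : 0 < (b.pole j).im := h.mem j
  have hζ := (continuousAt_zetaOf he.ne').isBigO_one_nhdsNE
  have hψ := continuousAt_psi (u := q) (v := potV q r) he x
  have hA := hψ.1.isBigO_one_nhdsNE
  have hB := hψ.2.isBigO_one_nhdsNE
  have hg : (fun z => jostPsi q r (zetaOf z) x i) =O[𝓝[≠] (b.pole j)] fun _ => (1 : ℂ) := by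
    fin_cases i
    · refine (isBigO_one_mul hζ hA).congr' ?_ EventuallyEq.rfl
      filter_upwards [eventually_upper he] with z hz
      simp [jostPsi_gaugeV (im_sq_zetaOf hz), gaugeV, zetaOf_sq]
    · refine (hB.add (hA.const_mul_left (Complex.I / 2 * r x))).congr' ?_ EventuallyEq.rfl
      filter_upwards [eventually_upper he] with z hz
      simp [jostPsi_gaugeV (im_sq_zetaOf hz), gaugeV, zetaOf_sq]
  have h1 := IsBoundStateData.near h j he.ne' x i hg
  have h2 := (isBigO_one_mul (isBigO_one_mul hζ hg)
    (BoundStates.isBigO_principal_block (c := b.c) h.injective j)).const_mul_left Complex.I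
  refine (h1.sub h2).congr_left fun z => ?_
  have e1 : ∑ k, Complex.I * b.c j k / (z - b.pole j) ^ ((k : ℕ) + 1)
      = Complex.I * ∑ k, b.c j k * ((z - b.pole j) ^ ((k : ℕ) + 1))⁻¹ := by
    rw [Finset.mul_sum]
    exact Finset.sum_congr rfl fun k _ => by rw [div_eq_mul_inv, mul_assoc]
  have e2 : b.upperFamily.principal z
      = ∑ p : b.Idx, b.c p.1 p.2 * ((z - b.pole p.1) ^ ((p.2 : ℕ) + 1))⁻¹ := rfl
  rw [e1, e2]
  ring

theorem IsLowerBoundStates.near {b : BoundStates} (h : IsLowerBoundStates q r b) (j : Fin b.N)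
    (x : ℝ) (i : Fin 2) :
    (fun w => transTBar q r (zetaOf (-w)) * jostPhiBar q r (zetaOf (-w)) x i -
        zetaOf (-w) * (Complex.I * b.lowerFamily.principal w) * jostPsiBar q r (zetaOf (-w)) x i)
      =O[𝓝[≠] (-b.pole j)] fun _ => (1 : ℂ) := by
  have he0 : (b.pole j).im < 0 := h.mem j
  have he : 0 < (-b.pole j).im := by simpa using he0
  have ht := tendsto_neg_nhdsNE (-b.pole j)
  rw [neg_neg] at ht
  have ht' := tendsto_neg_nhdsNE (b.pole j)
  have hζ := (continuousAt_zetaOf he0.ne).isBigO_one_nhdsNE.comp_tendsto ht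
  have hψ := continuousAt_psi (u := r) (v := potU q r) he x
  have hA := hψ.1.isBigO_one_nhdsNE
  have hB := hψ.2.isBigO_one_nhdsNE
  have hg : (fun w => jostPsiBar q r (zetaOf (-w)) x i)
      =O[𝓝[≠] (-b.pole j)] fun _ => (1 : ℂ) := by
    fin_cases i
    · refine (hB.sub (hA.const_mul_left (Complex.I / 2 * q x))).congr' ?_ EventuallyEq.rfl
      filter_upwards [eventually_upper he] with z hz
      simp [jostPsiBar_gaugeU (im_sq_zetaOf_neg hz), gaugeU, zetaOf_sq]
    · refine (isBigO_one_mul hζ hA).congr' ?_ EventuallyEq.rfl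
      filter_upwards [eventually_upper he] with z hz
      simp [jostPsiBar_gaugeU (im_sq_zetaOf_neg hz), gaugeU, zetaOf_sq]
  have hg' : (fun z => jostPsiBar q r (zetaOf z) x i) =O[𝓝[≠] (b.pole j)] fun _ => (1 : ℂ) := by
    have := hg.comp_tendsto ht'
    simpa [Function.comp_def] using this
  have h1 := (IsBoundStateData.near h j he0.ne x i hg').comp_tendsto ht
  have h2 := (isBigO_one_mul (isBigO_one_mul hζ hg)
    (BoundStates.isBigO_principal_block (c := fun j k => (-1) ^ (k : ℕ) * b.c j k)
      (w := fun j => -b.pole j) (neg_injective.comp h.injective) j)).const_mul_left Complex.I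
  refine (h1.sub h2).congr_left fun w => ?_
  have e1 : ∑ k, -Complex.I * b.c j k / (-w - b.pole j) ^ ((k : ℕ) + 1)
      = Complex.I * ∑ k : Fin (b.mult j), (-1) ^ (k : ℕ) * b.c j k *
        ((w - -b.pole j) ^ ((k : ℕ) + 1))⁻¹ := by
    rw [Finset.mul_sum]
    refine Finset.sum_congr rfl fun k _ => ?_
    rw [show -w - b.pole j = -1 * (w - -b.pole j) by ring, mul_pow, div_eq_mul_inv, mul_inv,
      ← inv_pow, inv_neg_one, pow_succ]
    ring
  have e2 : b.lowerFamily.principal w = ∑ p : b.Idx, (-1) ^ (p.2 : ℕ) * b.c p.1 p.2 *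
      ((w - -b.pole p.1) ^ ((p.2 : ℕ) + 1))⁻¹ := rfl
  simp only [Function.comp_apply]
  rw [e1, e2]
  ring

/-- Stripping the exponentials from the two Jost solutions multiplies the residue factor by
`e^{2ilx}`. On principal parts this is the shift of the kernel by `2x`. -/
theorem isBigO_shift_of_near {L R a B : ℂ → ℂ} {e : ℂ} {x : ℝ} {p : PoleFamily}
    (hR : ContinuousAt R e)
    (hB : (fun l => p.principal l - B l) =O[𝓝[≠] e] fun _ => (1 : ℂ))
    (h : (fun l => Complex.exp (-Complex.I * l * x) * L l / a l -
      Complex.I * B l * (Complex.exp (Complex.I * l * x) * R l)) =O[𝓝[≠] e] fun _ => (1 : ℂ)) :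
    (fun l => L l / a l - Complex.I * (p.shift (2 * x)).principal l * R l)
      =O[𝓝[≠] e] fun _ => (1 : ℂ) := by
  have c1 : ContinuousAt (fun l : ℂ => Complex.exp (Complex.I * l * x)) e := by fun_prop
  have hE := c1.isBigO_one_nhdsNE
  have hR' := hR.isBigO_one_nhdsNE
  have h1 := isBigO_one_mul hE h
  have h2 := (isBigO_one_mul (isBigO_one_mul (isBigO_one_mul hE hE) hB) hR').const_mul_left
    Complex.I
  have h3 := (isBigO_one_mul (p.isBigO_principal_shift (2 * x) e) hR').const_mul_left Complex.I
  refine ((h1.sub h2).sub h3).congr_left fun l => ?_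
  have e1 : Complex.exp (Complex.I * l * x) * Complex.exp (-Complex.I * l * x) = 1 := by
    rw [← Complex.exp_add]; simp
  have e2 : Complex.exp (Complex.I * l * ((2 * x : ℝ) : ℂ))
      = Complex.exp (Complex.I * l * x) * Complex.exp (Complex.I * l * x) := by
    rw [← Complex.exp_add]; congr 1; push_cast; ring
  rw [e2]
  linear_combination (L l / a l) * e1

end

/-! ### Half-plane data in both gauges, and Fourier kernels -/

section

open PoleFamily (eventually_ne_nhdsNE)

section

variable {u v : 𝓢(ℝ, ℂ)}

theorem halfPlaneData_shift (x : ℝ) {p : PoleFamily} {B : ℂ → ℂ}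
    (hp : ∀ e ∈ Set.range p.loc, 0 < e.im)
    (hreal : ∀ l : ℂ, l.im = 0 → aCoef u v l ≠ 0)
    (hzero : ∀ l : ℂ, 0 < l.im → aCoef u v l = 0 → l ∈ Set.range p.loc)
    (hB : ∀ e, (fun l => p.principal l - B l) =O[𝓝[≠] e] fun _ => (1 : ℂ))
    (near : ∀ e ∈ Set.range p.loc,
      ((fun l => phiA u v l x / aCoef u v l - Complex.I * B l * psiA u v l x)
        =O[𝓝[≠] e] fun _ => (1 : ℂ)) ∧
      ((fun l => phiB u v l x / aCoef u v l - Complex.I * B l * psiB u v l x)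
        =O[𝓝[≠] e] fun _ => (1 : ℂ))) :
    HalfPlaneData (fun l => mR₁ u v l x) (fun l => mR₂ u v l x)
      (fun l => mL₁ u v l x / aCoef u v l) (fun l => mL₂ u v l x / aCoef u v l)
      (p.shift (2 * x)) := by
  have hr := p.range_loc_shift (2 * x)
  have hmem : ∀ i, (p.shift (2 * x)).loc i ∈ Set.range p.loc := fun i => hr ▸ Set.mem_range_self i
  exact halfPlaneData x (fun i => hp _ (hmem i)) hreal (fun l hl h0 => hr ▸ hzero l hl h0)
    (fun i => isBigO_shift_of_near (continuousAt_mR (hp _ (hmem i)) x).1 (hB _)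
      (near _ (hmem i)).1)
    (fun i => isBigO_shift_of_near (continuousAt_mR (hp _ (hmem i)) x).2 (hB _)
      (near _ (hmem i)).2)

end

variable {q r : 𝓢(ℝ, ℂ)} {b : BoundStates}

theorem isBigO_inv_zetaOf {e : ℂ} (he : e.im ≠ 0) :
    (fun z => (zetaOf z)⁻¹) =O[𝓝[≠] e] fun _ => (1 : ℂ) :=
  ((continuousAt_zetaOf he).inv₀ (zetaOf_ne_zero fun h => he (by simp [h]))).isBigO_one_nhdsNE

/-- Undoing the gauge, the second component yields the relation for `phiB` after division by `ζ`;
adding `(i/2) q` times it to the first component yields the one for `phiA`. The factors `ζ` cancel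
and the principal part is that of the bound states itself. -/
theorem halfPlaneData_upper_gaugeU (hreg : NoRealSingularity q r) (h : IsUpperBoundStates q r b)
    (x : ℝ) :
    HalfPlaneData (fun l => mR₁ (potU q r) r l x) (fun l => mR₂ (potU q r) r l x)
      (fun l => mL₁ (potU q r) r l x / aCoef (potU q r) r l)
      (fun l => mL₂ (potU q r) r l x / aCoef (potU q r) r l) (b.upperFamily.shift (2 * x)) := by
  have hpole : ∀ e ∈ Set.range b.upperFamily.loc, ∃ j, e = b.pole j := by
    rintro e ⟨p, rfl⟩; exact ⟨p.1, rfl⟩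
  refine halfPlaneData_shift x (B := b.upperFamily.principal) (fun e he => ?_)
    (fun l hl => (aCoef_real_ne_zero hreg hl).2.1) (fun l hl h0 => h.mem_range hl (Or.inr h0))
    (fun e => by simpa using isBigO_const_const (0 : ℂ) (one_ne_zero (α := ℂ)) (𝓝[≠] e))
    fun e he => ?_
  · obtain ⟨j, rfl⟩ := hpole e he; exact h.mem j
  obtain ⟨j, rfl⟩ := hpole e he
  have hj : 0 < (b.pole j).im := h.mem j
  have h0 := h.near j x 0
  have h1 := h.near j x 1
  have hB := isBigO_one_mul (isBigO_inv_zetaOf hj.ne') h1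
  have hA := h0.add (hB.const_mul_left (Complex.I / 2 * q x))
  constructor
  · refine hA.congr' ?_ EventuallyEq.rfl
    filter_upwards [eventually_upper hj] with z hz
    have hζ := zetaOf_ne_zero (ne_zero_of_im_pos hz)
    rw [(transT_eq hz).2, jostPhi_gaugeU (im_sq_zetaOf hz), jostPsi_gaugeU (im_sq_zetaOf hz) hζ,
      zetaOf_sq]
    simp [gaugeU]
    field_simp
    ring
  · refine hB.congr' ?_ EventuallyEq.rfl
    filter_upwards [eventually_upper hj] with z hz
    have hζ := zetaOf_ne_zero (ne_zero_of_im_pos hz)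
    rw [(transT_eq hz).2, jostPhi_gaugeU (im_sq_zetaOf hz), jostPsi_gaugeU (im_sq_zetaOf hz) hζ,
      zetaOf_sq]
    simp [gaugeU]
    field_simp

/-- Here `φ` carries `ζ⁻¹` and `ψ` does not, so the residue factor is multiplied by `ζ² = λ`.
Multiplying a principal part by `λ` is the operation `PoleFamily.deriv`. -/
theorem halfPlaneData_upper_gaugeV (hreg : NoRealSingularity q r) (h : IsUpperBoundStates q r b)
    (x : ℝ) :
    HalfPlaneData (fun l => mR₁ q (potV q r) l x) (fun l => mR₂ q (potV q r) l x)
      (fun l => mL₁ q (potV q r) l x / aCoef q (potV q r) l)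
      (fun l => mL₂ q (potV q r) l x / aCoef q (potV q r) l)
      (b.upperFamily.deriv.shift (2 * x)) := by
  have hr := b.upperFamily.range_loc_deriv
  have hpole : ∀ e ∈ Set.range b.upperFamily.deriv.loc, ∃ j, e = b.pole j := by
    rw [hr]; rintro e ⟨p, rfl⟩; exact ⟨p.1, rfl⟩
  refine halfPlaneData_shift x (B := fun l => l * b.upperFamily.principal l) (fun e he => ?_)
    (fun l hl => (aCoef_real_ne_zero hreg hl).1)
    (fun l hl h0 => hr ▸ h.mem_range hl (Or.inl h0))
    b.upperFamily.isBigO_principal_deriv fun e he => ?_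
  · obtain ⟨j, rfl⟩ := hpole e he; exact h.mem j
  obtain ⟨j, rfl⟩ := hpole e he
  have hj : 0 < (b.pole j).im := h.mem j
  have hA := h.near j x 0
  have h1 := h.near j x 1
  have hB := (isBigO_one_mul (continuousAt_zetaOf hj.ne').isBigO_one_nhdsNE h1).sub
    (hA.const_mul_left (Complex.I / 2 * r x))
  constructor
  · refine hA.congr' ?_ EventuallyEq.rfl
    filter_upwards [eventually_upper hj] with z hz
    have hζ := zetaOf_ne_zero (ne_zero_of_im_pos hz)
    have hs := zetaOf_sq z
    rw [(transT_eq hz).1, jostPhi_gaugeV (im_sq_zetaOf hz) hζ, jostPsi_gaugeV (im_sq_zetaOf hz),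
      hs]
    simp [gaugeV]
    field_simp
    rw [hs]; ring
  · refine hB.congr' ?_ EventuallyEq.rfl
    filter_upwards [eventually_upper hj] with z hz
    have hζ := zetaOf_ne_zero (ne_zero_of_im_pos hz)
    have hs := zetaOf_sq z
    rw [(transT_eq hz).1, jostPhi_gaugeV (im_sq_zetaOf hz) hζ, jostPsi_gaugeV (im_sq_zetaOf hz),
      hs]
    simp [gaugeV]
    field_simp
    rw [hs]; ring

theorem halfPlaneData_lower_gaugeV (hreg : NoRealSingularity q r) (h : IsLowerBoundStates q r b)
    (x : ℝ) :
    HalfPlaneData (fun l => mR₁ (potV q r) q l x) (fun l => mR₂ (potV q r) q l x)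
      (fun l => mL₁ (potV q r) q l x / aCoef (potV q r) q l)
      (fun l => mL₂ (potV q r) q l x / aCoef (potV q r) q l) (b.lowerFamily.shift (2 * x)) := by
  have hpole : ∀ e ∈ Set.range b.lowerFamily.loc, ∃ j, e = -b.pole j := by
    rintro e ⟨p, rfl⟩; exact ⟨p.1, rfl⟩
  have him : ∀ j, 0 < (-b.pole j).im := fun j => by
    have : (b.pole j).im < 0 := h.mem j
    simpa using this
  refine halfPlaneData_shift x (B := b.lowerFamily.principal) (fun e he => ?_)
    (fun l hl => (aCoef_real_ne_zero hreg hl).2.2.1) (fun l hl h0 => h.mem_range hl (Or.inl h0))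
    (fun e => by simpa using isBigO_const_const (0 : ℂ) (one_ne_zero (α := ℂ)) (𝓝[≠] e))
    fun e he => ?_
  · obtain ⟨j, rfl⟩ := hpole e he; exact him j
  obtain ⟨j, rfl⟩ := hpole e he
  have hj := him j
  have ht := tendsto_neg_nhdsNE (-b.pole j)
  have hζi := (isBigO_inv_zetaOf (e := - -b.pole j) (by simpa using hj.ne')).comp_tendsto ht
  have h0 := h.near j x 0
  have h1 := h.near j x 1
  have hB := isBigO_one_mul hζi h0
  have hA := h1.sub (hB.const_mul_left (Complex.I / 2 * r x))
  constructor
  · refine hA.congr' ?_ EventuallyEq.rfl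
    filter_upwards [eventually_upper hj] with z hz
    have hζ := zetaOf_ne_zero (neg_ne_zero.2 (ne_zero_of_im_pos hz))
    have hs := zetaOf_sq (-z)
    rw [(transTBar_eq hz).1, jostPhiBar_gaugeV (im_sq_zetaOf_neg hz),
      jostPsiBar_gaugeV (im_sq_zetaOf_neg hz) hζ, hs, neg_neg]
    simp [gaugeV]
    field_simp
    ring
  · refine hB.congr' ?_ EventuallyEq.rfl
    filter_upwards [eventually_upper hj] with z hz
    have hζ := zetaOf_ne_zero (neg_ne_zero.2 (ne_zero_of_im_pos hz))
    have hs := zetaOf_sq (-z)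
    rw [(transTBar_eq hz).1, jostPhiBar_gaugeV (im_sq_zetaOf_neg hz),
      jostPsiBar_gaugeV (im_sq_zetaOf_neg hz) hζ, hs, neg_neg]
    simp [gaugeV]
    field_simp

/-- As in the upper half plane the residue factor gains `ζ²`. In the reflected variable `l` this
equals `-l`, hence the extra sign on the differentiated family. -/
theorem halfPlaneData_lower_gaugeU (hreg : NoRealSingularity q r) (h : IsLowerBoundStates q r b)
    (x : ℝ) :
    HalfPlaneData (fun l => mR₁ r (potU q r) l x) (fun l => mR₂ r (potU q r) l x)
      (fun l => mL₁ r (potU q r) l x / aCoef r (potU q r) l)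
      (fun l => mL₂ r (potU q r) l x / aCoef r (potU q r) l)
      ((b.lowerFamily.deriv.smul (-1)).shift (2 * x)) := by
  have hr : Set.range (b.lowerFamily.deriv.smul (-1)).loc = _ := b.lowerFamily.range_loc_deriv
  have hpole : ∀ e ∈ Set.range (b.lowerFamily.deriv.smul (-1)).loc, ∃ j, e = -b.pole j := by
    rw [hr]; rintro e ⟨p, rfl⟩; exact ⟨p.1, rfl⟩
  have him : ∀ j, 0 < (-b.pole j).im := fun j => by
    have : (b.pole j).im < 0 := h.mem j
    simpa using this
  refine halfPlaneData_shift x (B := fun l => -l * b.lowerFamily.principal l) (fun e he => ?_)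
    (fun l hl => (aCoef_real_ne_zero hreg hl).2.2.2)
    (fun l hl h0 => hr ▸ h.mem_range hl (Or.inr h0))
    (fun e => (b.lowerFamily.isBigO_principal_deriv e).neg_left.congr_left fun l => by
      rw [PoleFamily.principal_smul]; ring) fun e he => ?_
  · obtain ⟨j, rfl⟩ := hpole e he; exact him j
  obtain ⟨j, rfl⟩ := hpole e he
  have hj := him j
  have ht := tendsto_neg_nhdsNE (-b.pole j)
  have hζ' := (continuousAt_zetaOf (e := - -b.pole j)
    (by simpa using hj.ne')).isBigO_one_nhdsNE.comp_tendsto ht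
  have h0 := h.near j x 0
  have hA := h.near j x 1
  have hB := (isBigO_one_mul hζ' h0).add (hA.const_mul_left (Complex.I / 2 * q x))
  constructor
  · refine hA.congr' ?_ EventuallyEq.rfl
    filter_upwards [eventually_upper hj] with z hz
    have hζ := zetaOf_ne_zero (neg_ne_zero.2 (ne_zero_of_im_pos hz))
    have hs := zetaOf_sq (-z)
    rw [(transTBar_eq hz).2, jostPhiBar_gaugeU (im_sq_zetaOf_neg hz) hζ,
      jostPsiBar_gaugeU (im_sq_zetaOf_neg hz), hs, neg_neg]
    simp [gaugeU]
    field_simp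
    rw [hs]; ring
  · refine hB.congr' ?_ EventuallyEq.rfl
    filter_upwards [eventually_upper hj] with z hz
    have hζ := zetaOf_ne_zero (neg_ne_zero.2 (ne_zero_of_im_pos hz))
    have hs := zetaOf_sq (-z)
    rw [(transTBar_eq hz).2, jostPhiBar_gaugeU (im_sq_zetaOf_neg hz) hζ,
      jostPsiBar_gaugeU (im_sq_zetaOf_neg hz), hs, neg_neg]
    simp [gaugeU]
    field_simp
    rw [hs]; ring

/-! ### The reflection coefficients and their Fourier transforms -/

section

variable {u v : 𝓢(ℝ, ℂ)}

/-- The numerator is, up to sign and exponential factors, the Wronskian of the solution normalised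
at `-∞` with one normalised at `+∞`. With the factor `e^{-2iλx}` it becomes constant in `x`. -/
theorem reflAt_eq_exp {l : ℂ} (hl : l.im = 0) (x : ℝ) :
    reflAt u v x l = Complex.exp (2 * Complex.I * l * x) * reflAt u v 0 l := by
  have h1 : 0 ≤ l.im := hl.ge
  have h2 : 0 ≤ (-l).im := by simp [hl]
  have hR := isJost_mR v u
  have key := eq_of_hasDerivAt_zero (f := fun x : ℝ => Complex.exp (-2 * Complex.I * l * x) *
    (mL₂ u v l x * mR₂ v u (-l) x - mL₁ u v l x * mR₁ v u (-l) x)) (fun x => by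
      have h := hasDerivAt_exp_mul (w := -2 * Complex.I * l)
        (((hasDerivAt_mL₂ (u := u) (v := v) h1 x).mul (hR.hasDerivAt₂ h2 x)).sub
        ((hasDerivAt_mL₁ (u := u) (v := v) h1 x).mul (hR.hasDerivAt₁ h2 x)))
      refine h.congr_deriv ?_
      simp only [Pi.sub_apply, Pi.mul_apply]
      ring) x 0
  have e1 : Complex.exp (2 * Complex.I * l * x) * Complex.exp (-2 * Complex.I * l * x) = 1 := by
    rw [← Complex.exp_add]
    simp
  simp only [Complex.ofReal_zero, mul_zero, Complex.exp_zero, one_mul] at key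
  rw [reflAt, reflAt, ← key, ← mul_div_assoc, ← mul_assoc, e1, one_mul]

theorem invFour_reflAt (x y : ℝ) :
    invFour (fun ξ => reflAt u v x (2 * Real.pi * ξ)) y
      = invFour (fun ξ => reflAt u v 0 (2 * Real.pi * ξ)) (2 * x + y) := by
  unfold invFour
  congr 1
  funext ξ
  beta_reduce
  rw [reflAt_eq_exp (by simp), ← mul_assoc, ← Complex.exp_add]
  congr 2
  push_cast
  ring

end

theorem invFour_eq_integral (f : ℂ → ℂ) (y : ℝ) :
    invFour (fun ξ => f (2 * Real.pi * ξ)) y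
      = 1 / (2 * Real.pi) * ∫ l : ℝ, f l * Complex.exp (Complex.I * l * y) := by
  have h := Measure.integral_comp_mul_left
    (fun l : ℝ => f l * Complex.exp (Complex.I * l * y)) (2 * Real.pi)
  have hpos : (0 : ℝ) < 2 * Real.pi := Real.two_pi_pos
  rw [abs_of_pos (inv_pos.2 hpos)] at h
  rw [invFour]
  have e : (1 / (2 * Real.pi) : ℂ) = (((2 * Real.pi)⁻¹ : ℝ) : ℂ) := by push_cast; ring
  rw [e, ← Complex.real_smul, ← h]
  congr 1
  funext ξ
  rw [mul_comm]
  push_cast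
  congr 2
  ring

/-- Differentiation under the integral produces `ξ ρ(ξ)`, which the decay of `ρ` alone does not make
integrable. It is integrable because it is a multiple of another reflection coefficient, the one of
the other gauge. -/
theorem hasDerivAt_invFour {ρ σ : ℝ → ℂ} (hρ : IsReflection ρ) (hσ : IsReflection σ)
    {c : ℂ} (h : ∀ ξ, c * σ ξ = 2 * Real.pi * ξ * ρ ξ) (y : ℝ) :
    HasDerivAt (invFour ρ) (Complex.I * c * invFour σ y) y := by
  have hd : ∀ ξ y : ℝ, HasDerivAt
      (fun y : ℝ => Complex.exp (2 * Real.pi * Complex.I * y * ξ) * ρ ξ)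
      (Complex.I * c * (Complex.exp (2 * Real.pi * Complex.I * y * ξ) * σ ξ)) y := by
    intro ξ y
    have h1 := (((Complex.ofRealCLM.hasDerivAt (x := y)).const_mul (2 * Real.pi * Complex.I)
      |>.mul_const (ξ : ℂ)).cexp).mul_const (ρ ξ)
    refine h1.congr_deriv ?_
    simp
    linear_combination (-Complex.I * Complex.exp (2 * Real.pi * Complex.I * y * ξ)) * h ξ
  have hnorm : ∀ (y ξ : ℝ), ‖Complex.exp (2 * Real.pi * Complex.I * y * ξ)‖ = 1 := by
    intro y ξ
    rw [show (2 * Real.pi * Complex.I * y * ξ : ℂ) = ((2 * Real.pi * y * ξ : ℝ) : ℂ) * Complex.I by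
      push_cast; ring, Complex.norm_exp_ofReal_mul_I]
  have hm : ∀ {τ : ℝ → ℂ}, IsReflection τ → ∀ y : ℝ, Continuous
      fun ξ : ℝ => Complex.exp (2 * Real.pi * Complex.I * y * ξ) * τ ξ := fun hτ y => by
    have := hτ.cont
    fun_prop
  have key := hasDerivAt_integral_of_dominated_loc_of_deriv_le (μ := volume) (𝕜 := ℝ)
    (F := fun (y : ℝ) (ξ : ℝ) => Complex.exp (2 * Real.pi * Complex.I * y * ξ) * ρ ξ)
    (F' := fun (y : ℝ) (ξ : ℝ) =>
      Complex.I * c * (Complex.exp (2 * Real.pi * Complex.I * y * ξ) * σ ξ))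
    (x₀ := y) (s := Set.univ) (bound := fun ξ => ‖c‖ * ‖σ ξ‖) univ_mem
    (Eventually.of_forall fun y => (hm hρ y).aestronglyMeasurable)
    (hρ.integrable.norm.mono' (hm hρ y).aestronglyMeasurable
      (Eventually.of_forall fun ξ => by rw [norm_mul, hnorm, one_mul]))
    ((hm hσ y).const_mul _ |>.aestronglyMeasurable)
    (Eventually.of_forall fun ξ y _ => by
      rw [norm_mul, norm_mul, norm_mul, hnorm, Complex.norm_I, one_mul, one_mul])
    (hσ.integrable.norm.const_mul _) (Eventually.of_forall fun ξ y _ => hd ξ y)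
  rw [invFour, ← integral_const_mul]
  exact key.2

theorem reflHat_eq (y : ℝ) : reflHat q r y
    = invFour (fun ξ => reflAt (potU q r) r 0 (2 * Real.pi * ξ)) y := by
  rw [invFour_eq_integral, reflHat]
  congr 1
  refine integral_congr_ae ?_
  filter_upwards [compl_mem_ae_iff.2 (measure_singleton (0 : ℝ))] with l hl
  have hl0 : (l : ℂ) ≠ 0 := by exact_mod_cast hl
  rw [reflR_gaugeU (by rw [zetaOf_sq]; simp) (zetaOf_ne_zero hl0), zetaOf_sq]

theorem reflBarHat_eq (y : ℝ) : reflBarHat q r y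
    = invFour (fun ξ => reflAt (potV q r) q 0 (2 * Real.pi * ξ)) y := by
  rw [invFour_eq_integral, reflBarHat, ← integral_neg_eq_self]
  congr 1
  refine integral_congr_ae ?_
  filter_upwards [compl_mem_ae_iff.2 (measure_singleton (0 : ℝ))] with l hl
  have hl0 : (((-l : ℝ)) : ℂ) ≠ 0 := by
    rw [Complex.ofReal_neg, neg_ne_zero]; exact_mod_cast hl
  rw [reflRBar_gaugeV (by rw [zetaOf_sq]; simp) (zetaOf_ne_zero hl0), zetaOf_sq]
  push_cast
  rw [neg_neg]
  congr 2
  ring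

end

section

/-! ### The Marchenko equations at a fixed `x` -/

theorem integral_Ioi_comp_add (g : ℝ → ℂ) (x : ℝ) :
    ∫ z in Set.Ioi (0 : ℝ), g (x + z) = ∫ z in Set.Ioi x, g z := by
  rw [← integral_indicator measurableSet_Ioi, ← integral_indicator measurableSet_Ioi,
    ← integral_add_left_eq_self ((Set.Ioi x).indicator g) x]
  congr 1
  funext z
  by_cases hz : 0 < z
  · rw [Set.indicator_of_mem (show z ∈ Set.Ioi 0 from hz),
      Set.indicator_of_mem (show x + z ∈ Set.Ioi x by simpa using hz)]
  · rw [Set.indicator_of_notMem (show z ∉ Set.Ioi 0 from hz),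
      Set.indicator_of_notMem (show x + z ∉ Set.Ioi x by simpa using hz)]

theorem memLp_shift_indicator {g : ℝ → ℂ} {x : ℝ}
    (hg : MemLp g 2 (volume.restrict (Set.Ioi x))) :
    MemLp (fun y => (Set.Ioi x).indicator g (x + y)) 2 volume :=
  ((memLp_indicator_iff_restrict measurableSet_Ioi).2 hg).comp_measurePreserving
    (measurePreserving_add_left volume x)

/-- The translation `z ↦ x + z` carries the equations to the half line `(0, ∞)` with kernels `ω(2x +
·)`. These are the kernels of the reflection coefficient seen from `x` and of the pole family
shifted by `2x`. -/
theorem tendsto_of_marchenko_shift {u v : 𝓢(ℝ, ℂ)} {x : ℝ} {p p' : PoleFamily}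
    (d : HalfPlaneData (fun l => mR₁ u v l x) (fun l => mR₂ u v l x)
      (fun l => mL₁ u v l x / aCoef u v l) (fun l => mL₂ u v l x / aCoef u v l) (p.shift (2 * x)))
    (d' : HalfPlaneData (fun l => mR₁ v u l x) (fun l => mR₂ v u l x)
      (fun l => mL₁ v u l x / aCoef v u l) (fun l => mL₂ v u l x / aCoef v u l)
      (p'.shift (2 * x)))
    (hreal : ∀ l : ℂ, l.im = 0 → aCoef u v l ≠ 0) (hreal' : ∀ l : ℂ, l.im = 0 → aCoef v u l ≠ 0)
    {g g' ω ω' : ℝ → ℂ} (hg : MemLp g 2 (volume.restrict (Set.Ioi x)))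
    (hg' : MemLp g' 2 (volume.restrict (Set.Ioi x)))
    (hω : ∀ y, ω y = invFour (fun ξ => reflAt u v 0 (2 * Real.pi * ξ)) y + p.kernel y)
    (hω' : ∀ y, ω' y = invFour (fun ξ => reflAt v u 0 (2 * Real.pi * ξ)) y + p'.kernel y)
    {s s' : ℂ}
    (eq : ∀ y > x, g' y + s * ω (x + y) + ∫ z in Set.Ioi x, g z * ω (z + y) = 0)
    (eq' : ∀ y > x, g y + s' * ω' (x + y) + ∫ z in Set.Ioi x, g' z * ω' (z + y) = 0) :
    Tendsto g (𝓝[>] x) (𝓝 (-s' * u x / 2 + s / 2 * ∫ y in Set.Ioi x, u y * v y)) := by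
  have hR := isJost_mR u v
  have tr : ∀ {g g' ω : ℝ → ℂ} {s : ℂ} {τ : ℝ → ℂ},
      (∀ y, τ y = ω (2 * x + y)) →
      (∀ y > x, g' y + s * ω (x + y) + ∫ z in Set.Ioi x, g z * ω (z + y) = 0) →
      ∀ y > (0 : ℝ), (Set.Ioi x).indicator g' (x + y) + s * τ y +
        ∫ z in Set.Ioi (0 : ℝ), (Set.Ioi x).indicator g (x + z) * τ (z + y) = 0 := by
    intro g g' ω s τ hτ h y hy
    have hxy : x < x + y := by linarith
    have h1 := h (x + y) hxy
    rw [← integral_Ioi_comp_add] at h1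
    rw [Set.indicator_of_mem (show x + y ∈ Set.Ioi x from hxy), hτ,
      show 2 * x + y = x + (x + y) by ring]
    refine Eq.trans ?_ h1
    congr 1
    refine setIntegral_congr_fun measurableSet_Ioi fun z hz => ?_
    have hz' : x < x + z := by
      have : (0 : ℝ) < z := hz
      linarith
    rw [Set.indicator_of_mem (show x + z ∈ Set.Ioi x from hz'), hτ]
    congr 2; ring
  have im0 : ∀ ξ : ℝ, (2 * Real.pi * ξ : ℂ).im = 0 := fun ξ => by simp
  have h := tendsto_of_marchenko d d' (isReflection_reflAt hreal x) (isReflection_reflAt hreal' x)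
    (fun ξ => jump₁ (im0 ξ) (hreal _ (im0 ξ)) x) (fun ξ => jump₂ (im0 ξ) (hreal _ (im0 ξ)) x)
    (fun ξ => jump₁ (im0 ξ) (hreal' _ (im0 ξ)) x) (fun ξ => jump₂ (im0 ξ) (hreal' _ (im0 ξ)) x)
    (memLp_shift_indicator hg) (memLp_shift_indicator hg')
    (fun y hy => Set.indicator_of_notMem (by simpa using hy) _)
    (fun y hy => Set.indicator_of_notMem (by simpa using hy) _)
    (tr (fun y => by rw [hω, invFour_reflAt, PoleFamily.kernel_shift]) eq)
    (tr (fun y => by rw [hω', invFour_reflAt, PoleFamily.kernel_shift]) eq')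
    (hR.isBigO₁ x) (hR.isBigO₂ x)
  have ht : Tendsto (fun y => y - x) (𝓝[>] x) (𝓝[>] 0) := by
    refine tendsto_nhdsWithin_iff.2 ⟨?_, ?_⟩
    · have : ContinuousAt (fun y : ℝ => y - x) x := by fun_prop
      simpa using this.tendsto.mono_left nhdsWithin_le_nhds
    · filter_upwards [self_mem_nhdsWithin] with y hy
      exact sub_pos.2 (show x < y from hy)
  have h2 := h.comp ht
  have hval : -Complex.I * (s' * (u x / (2 * Complex.I)) +
      s * (Complex.I / 2 * ∫ y in Set.Ioi x, u y * v y))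
      = -s' * u x / 2 + s / 2 * ∫ y in Set.Ioi x, u y * v y := by
    have hI := Complex.I_ne_zero
    field_simp
    linear_combination (-s * ∫ y in Set.Ioi x, u y * v y) * Complex.I_sq
  rw [hval] at h2
  refine h2.congr' ?_
  filter_upwards [self_mem_nhdsWithin] with y hy
  simp [Set.indicator_of_mem hy]

variable {q r : 𝓢(ℝ, ℂ)} {b : BoundStates}

theorem marchenkoOmega_eq (y : ℝ) : marchenkoOmega q r b y
    = invFour (fun ξ => reflAt (potU q r) r 0 (2 * Real.pi * ξ)) y + b.upperFamily.kernel y := by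
  rw [marchenkoOmega, reflHat_eq, b.expTerm_upper]

theorem marchenkoOmegaBar_eq (y : ℝ) : marchenkoOmegaBar q r b y
    = invFour (fun ξ => reflAt (potV q r) q 0 (2 * Real.pi * ξ)) y + b.lowerFamily.kernel y := by
  rw [marchenkoOmegaBar, reflBarHat_eq, b.expTerm_lower]

theorem dense_two_pi_ne_zero {f g : ℝ → ℂ} (hf : Continuous f) (hg : Continuous g)
    (h : ∀ ξ, ξ ≠ 0 → f ξ = g ξ) (ξ : ℝ) : f ξ = g ξ :=
  congrFun (Continuous.ext_on (dense_compl_singleton (0 : ℝ)) hf hg h) ξ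

/-- For `λ ≠ 0` this is `ζR = λ · R/ζ`; both sides are continuous, so it persists at `λ = 0`. -/
theorem reflAt_gauge (hreg : NoRealSingularity q r) (ξ : ℝ) :
    1 * reflAt q (potV q r) 0 (2 * Real.pi * ξ)
      = 2 * Real.pi * ξ * reflAt (potU q r) r 0 (2 * Real.pi * ξ) := by
  have c1 := (isReflection_reflAt (fun l hl => (aCoef_real_ne_zero hreg hl).1) 0).cont
  have c2 := (isReflection_reflAt (fun l hl => (aCoef_real_ne_zero hreg hl).2.1) 0).cont
  refine dense_two_pi_ne_zero (f := fun ξ : ℝ => 1 * reflAt q (potV q r) 0 (2 * Real.pi * ξ))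
    (g := fun ξ : ℝ => 2 * Real.pi * ξ * reflAt (potU q r) r 0 (2 * Real.pi * ξ))
    (by fun_prop) (by fun_prop) (fun ξ hξ => ?_) ξ
  set l : ℂ := 2 * Real.pi * ξ
  have hl : l ≠ 0 := by simp [l, hξ, Real.pi_ne_zero]
  have him : (zetaOf l ^ 2).im = 0 := by rw [zetaOf_sq]; simp [l]
  have hζ := zetaOf_ne_zero hl
  have h1 := reflR_gaugeV (q := q) (r := r) him hζ
  have h2 := reflR_gaugeU (q := q) (r := r) him hζ
  have hs := zetaOf_sq l
  rw [hs] at h1 h2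
  rw [← h1, ← h2]
  nth_rw 3 [← hs]
  field_simp

theorem reflAt_gauge_bar (hreg : NoRealSingularity q r) (ξ : ℝ) :
    -1 * reflAt r (potU q r) 0 (2 * Real.pi * ξ)
      = 2 * Real.pi * ξ * reflAt (potV q r) q 0 (2 * Real.pi * ξ) := by
  have c1 := (isReflection_reflAt (fun l hl => (aCoef_real_ne_zero hreg hl).2.2.2) 0).cont
  have c2 := (isReflection_reflAt (fun l hl => (aCoef_real_ne_zero hreg hl).2.2.1) 0).cont
  refine dense_two_pi_ne_zero (f := fun ξ : ℝ => -1 * reflAt r (potU q r) 0 (2 * Real.pi * ξ))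
    (g := fun ξ : ℝ => 2 * Real.pi * ξ * reflAt (potV q r) q 0 (2 * Real.pi * ξ))
    (by fun_prop) (by fun_prop) (fun ξ hξ => ?_) ξ
  set l : ℂ := 2 * Real.pi * ξ
  have hl : -l ≠ 0 := by simp [l, hξ, Real.pi_ne_zero]
  have him : (zetaOf (-l) ^ 2).im = 0 := by rw [zetaOf_sq]; simp [l]
  have hζ := zetaOf_ne_zero hl
  have h1 := reflRBar_gaugeU (q := q) (r := r) him hζ
  have h2 := reflRBar_gaugeV (q := q) (r := r) him hζ
  have hs := zetaOf_sq (-l)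
  rw [hs, neg_neg] at h1 h2
  rw [← h1, ← h2]
  have hs' : l = -zetaOf (-l) ^ 2 := by rw [hs, neg_neg]
  generalize zetaOf (-l) = ζ at *
  rw [hs']
  field_simp

theorem deriv_marchenkoOmega (hreg : NoRealSingularity q r) (y : ℝ) :
    -Complex.I * deriv (marchenkoOmega q r b) y
      = invFour (fun ξ => reflAt q (potV q r) 0 (2 * Real.pi * ξ)) y
        + b.upperFamily.deriv.kernel y := by
  rw [funext (marchenkoOmega_eq (q := q) (r := r) (b := b))]
  have h1 := hasDerivAt_invFour
    (isReflection_reflAt (fun l hl => (aCoef_real_ne_zero hreg hl).2.1) 0)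
    (isReflection_reflAt (fun l hl => (aCoef_real_ne_zero hreg hl).1) 0) (reflAt_gauge hreg) y
  rw [(h1.fun_add (b.upperFamily.hasDerivAt_kernel y)).deriv]
  linear_combination (-(invFour (fun ξ => reflAt q (potV q r) 0 (2 * Real.pi * ξ)) y
        + b.upperFamily.deriv.kernel y)) * Complex.I_sq

theorem deriv_marchenkoOmegaBar (hreg : NoRealSingularity q r) (y : ℝ) :
    Complex.I * deriv (marchenkoOmegaBar q r b) y
      = invFour (fun ξ => reflAt r (potU q r) 0 (2 * Real.pi * ξ)) y
        + (b.lowerFamily.deriv.smul (-1)).kernel y := by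
  rw [funext (marchenkoOmegaBar_eq (q := q) (r := r) (b := b))]
  have h1 := hasDerivAt_invFour
    (isReflection_reflAt (fun l hl => (aCoef_real_ne_zero hreg hl).2.2.1) 0)
    (isReflection_reflAt (fun l hl => (aCoef_real_ne_zero hreg hl).2.2.2) 0)
    (reflAt_gauge_bar hreg) y
  rw [(h1.fun_add (b.lowerFamily.hasDerivAt_kernel y)).deriv, PoleFamily.kernel_smul]
  linear_combination (-invFour (fun ξ => reflAt r (potU q r) 0 (2 * Real.pi * ξ)) y
        + b.lowerFamily.deriv.kernel y) * Complex.I_sq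

/-! ### The boundary values in terms of the potentials -/

theorem integral_mul_potV (q r : 𝓢(ℝ, ℂ)) (x : ℝ) :
    ∫ y in Set.Ioi x, q y * potV q r y = -(Complex.I / 2) * (∫ y in Set.Ioi x, q y * deriv r y)
      - 1 / 4 * ∫ y in Set.Ioi x, q y ^ 2 * r y ^ 2 := by
  have i1 : IntegrableOn (fun y => q y * deriv r y) (Set.Ioi x) :=
    (schwartzMul q (SchwartzMap.derivCLM ℂ ℂ r)).integrable.integrableOn
  have i2 : IntegrableOn (fun y => q y ^ 2 * r y ^ 2) (Set.Ioi x) :=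
    ((schwartzMul (schwartzMul q q) (schwartzMul r r)).integrable.congr
      (Eventually.of_forall fun y => by simp only [schwartzMul_apply]; ring)).integrableOn
  rw [← integral_const_mul, ← integral_const_mul, ← integral_sub (i1.const_mul _) (i2.const_mul _)]
  refine integral_congr_ae (Eventually.of_forall fun y => ?_)
  simp only [potV_apply]
  ring

/-- Integrating `q' r` by parts leaves the boundary term `-q(x) r(x)`, the source of the additional
summand in `K₂(x, x)` as compared with `K̄₁(x, x)`. -/
theorem integral_potU_mul (q r : 𝓢(ℝ, ℂ)) (x : ℝ) :
    ∫ y in Set.Ioi x, potU q r y * r y = -(Complex.I / 2) * (q x * r x)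
      - Complex.I / 2 * (∫ y in Set.Ioi x, q y * deriv r y)
      - 1 / 4 * ∫ y in Set.Ioi x, q y ^ 2 * r y ^ 2 := by
  have i1 : IntegrableOn (fun y => q y * deriv r y) (Set.Ioi x) :=
    (schwartzMul q (SchwartzMap.derivCLM ℂ ℂ r)).integrable.integrableOn
  have i1' : IntegrableOn (fun y => deriv q y * r y) (Set.Ioi x) :=
    (schwartzMul (SchwartzMap.derivCLM ℂ ℂ q) r).integrable.integrableOn
  have i2 : IntegrableOn (fun y => q y ^ 2 * r y ^ 2) (Set.Ioi x) :=
    ((schwartzMul (schwartzMul q q) (schwartzMul r r)).integrable.congr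
      (Eventually.of_forall fun y => by simp only [schwartzMul_apply]; ring)).integrableOn
  have hparts := integral_Ioi_mul_deriv_eq_deriv_mul (a := x) (u := q) (v := r)
    (u' := deriv q) (v' := deriv r) (a' := q x * r x) (b' := 0)
    (fun y _ => q.differentiableAt.hasDerivAt) (fun y _ => r.differentiableAt.hasDerivAt) i1 i1'
    (((q.continuous.mul r.continuous).tendsto x).mono_left nhdsWithin_le_nhds)
    (tendsto_schwartz_atTop (schwartzMul q r))
  have e : ∫ y in Set.Ioi x, potU q r y * r y = Complex.I / 2 * (∫ y in Set.Ioi x, deriv q y * r y)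
      - 1 / 4 * ∫ y in Set.Ioi x, q y ^ 2 * r y ^ 2 := by
    rw [← integral_const_mul, ← integral_const_mul,
      ← integral_sub (i1'.const_mul _) (i2.const_mul _)]
    refine integral_congr_ae (Eventually.of_forall fun y => ?_)
    simp only [potU_apply]
    ring
  rw [e]
  linear_combination (Complex.I / 2) * hparts

/-- The vacuous inhomogeneous terms with coefficient `0` bring the four scalar equations to a common
shape, so that each row is a two-equation system with coefficients `0` and `1`. -/
theorem IsMarchenkoSolution.equations {Ω ΩBar : ℝ → ℂ} {K : ℝ → ℝ → Matrix (Fin 2) (Fin 2) ℂ}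
    (hK : IsMarchenkoSolution Ω ΩBar K) (x : ℝ) :
    (∀ y > x, K x y 0 0 + 0 * (-Complex.I * deriv Ω (x + y)) +
      ∫ z in Set.Ioi x, K x z 0 1 * (-Complex.I * deriv Ω (z + y)) = 0) ∧
    (∀ y > x, K x y 0 1 + 1 * ΩBar (x + y) + ∫ z in Set.Ioi x, K x z 0 0 * ΩBar (z + y) = 0) ∧
    (∀ y > x, K x y 1 0 + 1 * Ω (x + y) + ∫ z in Set.Ioi x, K x z 1 1 * Ω (z + y) = 0) ∧
    (∀ y > x, K x y 1 1 + 0 * (Complex.I * deriv ΩBar (x + y)) +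
      ∫ z in Set.Ioi x, K x z 1 0 * (Complex.I * deriv ΩBar (z + y)) = 0) := by
  have ent := fun y (hy : x < y) i j => congrFun (congrFun (hK.eqn x y hy) i) j
  have comm : ∀ a b c : ℂ, a * (b * c) = b * a * c := fun a b c => by ring
  simp only [one_mul, comm]
  exact ⟨fun y hy => by simpa using (ent y hy 0 0).symm,
    fun y hy => by simpa using (ent y hy 0 1).symm,
    fun y hy => by simpa using (ent y hy 1 0).symm,
    fun y hy => by simpa using (ent y hy 1 1).symm⟩

end

end GIScattering

end

/-! ### The boundary values of the Marchenko solution -/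

theorem theorem5p3 (q r : 𝓢(ℝ, ℂ))
    (hreg : GIScattering.NoRealSingularity q r)
    (b bBar : GIScattering.BoundStates)
    (hb : GIScattering.IsUpperBoundStates q r b)
    (hbBar : GIScattering.IsLowerBoundStates q r bBar)
    (K : ℝ → ℝ → Matrix (Fin 2) (Fin 2) ℂ)
    (hK : GIScattering.IsMarchenkoSolution
      (GIScattering.marchenkoOmega q r b) (GIScattering.marchenkoOmegaBar q r bBar) K)
    (x : ℝ) :
    Tendsto (fun y => K x y 0 1) (𝓝[>] x) (𝓝 (-(q x) / 2)) ∧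
    Tendsto (fun y => K x y 1 1) (𝓝[>] x)
      (𝓝 (-(Complex.I * q x * r x / 4)
          - Complex.I / 4 * (∫ y in Set.Ioi x, q y * deriv r y)
          - 1 / 8 * (∫ y in Set.Ioi x, q y ^ 2 * r y ^ 2))) ∧
    Tendsto (fun y => K x y 0 0) (𝓝[>] x)
      (𝓝 (-(Complex.I / 4 * (∫ y in Set.Ioi x, q y * deriv r y))
          - 1 / 8 * (∫ y in Set.Ioi x, q y ^ 2 * r y ^ 2))) ∧
    Tendsto (fun y => K x y 1 0) (𝓝[>] x) (𝓝 (-(r x) / 2)) := by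
  obtain ⟨e00, e01, e10, e11⟩ := hK.equations x
  have hV := fun l hl => (GIScattering.aCoef_real_ne_zero hreg (l := l) hl).1
  have hU := fun l hl => (GIScattering.aCoef_real_ne_zero hreg (l := l) hl).2.1
  have hV' := fun l hl => (GIScattering.aCoef_real_ne_zero hreg (l := l) hl).2.2.1
  have hU' := fun l hl => (GIScattering.aCoef_real_ne_zero hreg (l := l) hl).2.2.2
  have dV := GIScattering.halfPlaneData_upper_gaugeV hreg hb x
  have dU := GIScattering.halfPlaneData_upper_gaugeU hreg hb x
  have dV' := GIScattering.halfPlaneData_lower_gaugeV hreg hbBar x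
  have dU' := GIScattering.halfPlaneData_lower_gaugeU hreg hbBar x
  have m := hK.memLp x
  have wΩ := GIScattering.marchenkoOmega_eq (q := q) (r := r) (b := b)
  have wΩBar := GIScattering.marchenkoOmegaBar_eq (q := q) (r := r) (b := bBar)
  have wΩ' := GIScattering.deriv_marchenkoOmega (b := b) hreg
  have wΩBar' := GIScattering.deriv_marchenkoOmegaBar (b := bBar) hreg
  -- Each row is used twice, with the roles of its two equations exchanged. The entry whose own
  -- equation is inhomogeneous (`s' = 1`) gives `-u(x)/2`; the other one (`s = 1`) gives `(1/2)
  -- ∫_x^∞ u v`. Here `(u, v)` is `(q, potV)` or `(potU, r)`, in either order.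
  refine ⟨?_, ?_, ?_, ?_⟩
  · convert GIScattering.tendsto_of_marchenko_shift dV dV' hV hV' (m 0 1) (m 0 0) wΩ' wΩBar
      e00 e01 using 2
    ring
  · convert GIScattering.tendsto_of_marchenko_shift dU dU' hU hU' (m 1 1) (m 1 0) wΩ wΩBar'
      e10 e11 using 2
    rw [GIScattering.integral_potU_mul]
    ring
  · convert GIScattering.tendsto_of_marchenko_shift dV' dV hV' hV (m 0 0) (m 0 1) wΩBar wΩ'
      e01 e00 using 2
    simp_rw [mul_comm (GIScattering.potV q r _)]
    rw [GIScattering.integral_mul_potV]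
    ring
  · convert GIScattering.tendsto_of_marchenko_shift dU' dU hU' hU (m 1 0) (m 1 1) wΩBar' wΩ
      e11 e10 using 2
    ring
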